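/- Let $n\ge 2$. For smooth functions $\psi>0$ and $\phi$ on $(0,\infty)$ put $g=dx^2+\psi(x)^2g_{\mathbb S^n}$ on $M^{n+1}=(0,\infty)\times\mathbb S^n$ and $\omega=\phi'$; call $(\psi,\phi)$ a steady gradient soliton if $\mathrm{Ric}(g)+\nabla\nabla\phi=0$ on $M$. Where defined, set $$W=\frac1{-\omega+n\psi'/\psi},\qquad X=\sqrt n\,W\,\frac{\psi'}{\psi},\qquad Y=\frac{\sqrt{n(n-1)}\,W}{\psi},$$ and consider the planar system $$\frac{dX}{dy}=X^3-X+\frac{Y^2}{\sqrt n},\qquad \frac{dY}{dy}=Y\Big(X^2-\frac{X}{\sqrt n}\Big).\tag{1}$$ A soliton $(\psi,\phi)$ corresponds to a solution $\gamma:\mathbb R\to\mathbb R^2$ of (1) if $W>0$ on $(0,\infty)$ and there is a bijection $x\mapsto y$ from $(0,\infty)$ onto $\mathbb R$ with $dy=dx/W$ along which $(X,Y)=\gamma(y)$. Let $Q=\{X>0,\;Y>0,\;X^2+Y^2<1\}$. A trajectory is called singular if it solves (1), lies in $Q$, and tends to $(1,0)$ as $y\to-\infty$. We say that $(\psi,\phi)$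 has Bryant asymptotics if there are constants $c,C,x_0>0$ such that for $x\ge x_0$ $$cx^{1/2}\le\psi\le Cx^{1/2},\quad cx^{-1/2}\le\psi'\le Cx^{-1/2},\quad -Cx^{-3/2}\le\psi''\le-cx^{-3/2},\quad -C<\omega<-c,\quad |\omega'|\le Cx^{-2}.$$ Proposition (half-complete steady solitons). There are a one-parameter family $(\Gamma_s)_{s\in\mathbb R}$ of singular trajectories defined on all of $\mathbb R$, with $(s,y)\mapsto\Gamma_s(y)$ continuous, and a one-parameter family $(\psi_s,\phi_s)_{s\in\mathbb R}$ of steady gradient solitons on $(0,\infty)\times\mathbb S^n$ such that: 1. Every singular trajectory defined on some half-line $(-\infty,b)$ is of the form $y\mapsto\Gamma_s(y+c)$ for exactly one pair $(s,c)\in\mathbb R^2$. 2. For each $s$, $(\psi_s,\phi_s)$ corresponds to $\Gamma_s$; there is $a>0$ with $\psi_s(x)\sim a\,x^{1/\sqrt n}$, and $\omega_s(x)\sim\frac{\sqrt n-1}{x}$, as $x\to0^+$; the metric is complete towards $x=+\infty$ (for every $\delta>0$ the set $[\delta,\infty)\times\mathbb S^n$ is complete for the Riemannian distance of $M$); and $(\psi_s,\phi_s)$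 has Bryant asymptotics. 3. If $\psi_{s'}(kx)=k\psi_s(x)$ for all $x>0$ and some $k>0$, then $s=s'$. Conversely, every steady gradient soliton $(\psi,\phi)$ on $(0,\infty)\times\mathbb S^n$ for which $(X,Y)$ is defined and lies in $Q$ for all $x>0$ and $(X,Y)\to(1,0)$ as $x\to0^+$ satisfies $\psi(kx)=k\psi_s(x)$ and $\phi(kx)=\phi_s(x)+b$ for all $x>0$, for some $s,b\in\mathbb R$, $k>0$. 4. The Bryant soliton, that is, any steady gradient soliton corresponding to a solution of (1) on $\mathbb R$ which tends to $\big(\tfrac1{\sqrt n},\sqrt{1-\tfrac1n}\big)$ as $y\to-\infty$ and to $(0,0)$ as $y\to+\infty$, has Bryant asymptotics as well. -/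

import Mathlib

open Set Filter Topology Asymptotics
open scoped ContDiff

noncomputable section

namespace SteadySoliton

/-! ### Curvature of a Riemannian metric in a global coordinate system

The `N` coordinates are those of `EuclideanSpace ℝ (Fin N)`; a metric is given by its matrix of
components `g z i j` at the point `z`. -/

/-- The partial derivative `∂ᵢ f`. -/
def pd {N : ℕ} (i : Fin N) (f : EuclideanSpace ℝ (Fin N) → ℝ)
    (z : EuclideanSpace ℝ (Fin N)) : ℝ :=
  fderiv ℝ f z (EuclideanSpace.single i 1)

/-- The Christoffel symbols of the second kind,
`Γᵏᵢⱼ = ½ ∑ₗ gᵏˡ (∂ᵢ gⱼₗ + ∂ⱼ gᵢₗ - ∂ₗ gᵢⱼ)`. -/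
def christoffel {N : ℕ} (g : EuclideanSpace ℝ (Fin N) → Matrix (Fin N) (Fin N) ℝ)
    (k i j : Fin N) (z : EuclideanSpace ℝ (Fin N)) : ℝ :=
  (1 / 2 : ℝ) * ∑ l, (g z)⁻¹ k l *
    (pd i (fun w => g w j l) z + pd j (fun w => g w i l) z - pd l (fun w => g w i j) z)

/-- The Ricci tensor,
`Rᵢⱼ = ∑ₖ (∂ₖ Γᵏᵢⱼ - ∂ⱼ Γᵏᵢₖ + ∑ₗ (Γᵏₖₗ Γˡᵢⱼ - Γᵏⱼₗ Γˡᵢₖ))`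
(positive on round spheres). -/
def ricci {N : ℕ} (g : EuclideanSpace ℝ (Fin N) → Matrix (Fin N) (Fin N) ℝ)
    (i j : Fin N) (z : EuclideanSpace ℝ (Fin N)) : ℝ :=
  ∑ k, (pd k (christoffel g k i j) z - pd j (christoffel g k i k) z +
    ∑ l, (christoffel g k k l z * christoffel g l i j z -
      christoffel g k j l z * christoffel g l i k z))

/-- The covariant Hessian, `(∇∇f)ᵢⱼ = ∂ᵢ ∂ⱼ f - ∑ₖ Γᵏᵢⱼ ∂ₖ f`. -/
def hess {N : ℕ} (g : EuclideanSpace ℝ (Fin N) → Matrix (Fin N) (Fin N) ℝ)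
    (f : EuclideanSpace ℝ (Fin N) → ℝ) (i j : Fin N) (z : EuclideanSpace ℝ (Fin N)) : ℝ :=
  pd i (pd j f) z - ∑ k, christoffel g k i j z * pd k f z

/-- The length of the curve `γ : [0, 1] → M` with respect to the metric `g`. -/
def curveLength {N : ℕ} (g : EuclideanSpace ℝ (Fin N) → Matrix (Fin N) (Fin N) ℝ)
    (γ : ℝ → EuclideanSpace ℝ (Fin N)) : ℝ :=
  ∫ t in (0 : ℝ)..1, √(∑ i, ∑ j, g (γ t) i j * deriv γ t i * deriv γ t j)

/-! ### Spherically symmetric metrics on `(0, ∞) × Sⁿ`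

The manifold `M = (0, ∞) × Sⁿ` is covered by a single coordinate system: the diffeomorphism
`(x, p) ↦ x • p` onto `ℝⁿ⁺¹ ∖ {0}`, whose inverse is `z ↦ (‖z‖, ‖z‖⁻¹ • z)`. -/

/-- The components of the metric `dx² + ψ(x)² g_{Sⁿ}` on `(0, ∞) × Sⁿ` in the coordinates
`z = x • p ∈ ℝⁿ⁺¹ ∖ {0}`: the pullback under `z ↦ (x, p) = (‖z‖, ‖z‖⁻¹ • z)`, where `g_{Sⁿ}` is the
restriction to `Sⁿ ⊆ ℝⁿ⁺¹` of the Euclidean inner product. -/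
def warpedMetric (n : ℕ) (ψ : ℝ → ℝ) (z : EuclideanSpace ℝ (Fin (n + 1))) :
    Matrix (Fin (n + 1)) (Fin (n + 1)) ℝ :=
  Matrix.of fun i j =>
    pd i (fun w => ‖w‖) z * pd j (fun w => ‖w‖) z +
      ψ ‖z‖ ^ 2 * inner ℝ
        (fderiv ℝ (fun w : EuclideanSpace ℝ (Fin (n + 1)) => ‖w‖⁻¹ • w) z
          (EuclideanSpace.single i 1))
        (fderiv ℝ (fun w : EuclideanSpace ℝ (Fin (n + 1)) => ‖w‖⁻¹ • w) z
          (EuclideanSpace.single j 1))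

/-- `g = dx² + ψ(x)² g_{Sⁿ}` is a (smooth) metric on `(0, ∞) × Sⁿ` which, with the (smooth)
potential `φ = φ(x)`, satisfies the gradient Ricci soliton equation `Ric(g) + ∇∇φ + lam g = 0`. -/
structure IsGradientSoliton (n : ℕ) (lam : ℝ) (ψ φ : ℝ → ℝ) : Prop where
  smooth_metric : ContDiffOn ℝ ∞ ψ (Ioi 0)
  pos : ∀ x, 0 < x → 0 < ψ x
  smooth_potential : ContDiffOn ℝ ∞ φ (Ioi 0)
  soliton_eq : ∀ z : EuclideanSpace ℝ (Fin (n + 1)), z ≠ 0 → ∀ i j : Fin (n + 1),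
    ricci (warpedMetric n ψ) i j z + hess (warpedMetric n ψ) (fun w => φ ‖w‖) i j z
      + lam * warpedMetric n ψ z i j = 0

/-- The singular profile at `x = 0`: `ψ ∼ a x^{1/√n}` for some `a > 0` and
`ω = φ' ∼ (√n - 1) / x` as `x → 0⁺`. -/
def HasSingularProfile (n : ℕ) (ψ φ : ℝ → ℝ) : Prop :=
  (∃ a : ℝ, 0 < a ∧ ψ ~[𝓝[>] 0] fun x => a * x ^ (1 / √(n : ℝ))) ∧
    deriv φ ~[𝓝[>] 0] fun x => (√(n : ℝ) - 1) / x

/-- Completeness of `((0, ∞) × Sⁿ, dx² + ψ² g_{Sⁿ})` towards `x = +∞`: for every `δ > 0`, the set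
`[δ, ∞) × Sⁿ` is complete for the Riemannian distance of `(0, ∞) × Sⁿ` (the infimum of the lengths
of the `C¹` curves joining two points). -/
def IsCompleteTowardsInfinity (n : ℕ) (ψ : ℝ → ℝ) : Prop :=
  ∀ δ : ℝ, 0 < δ → ∀ z : ℕ → EuclideanSpace ℝ (Fin (n + 1)), (∀ k, δ ≤ ‖z k‖) →
    (∀ ε : ℝ, 0 < ε → ∃ K : ℕ, ∀ k, K ≤ k → ∀ m, K ≤ m →
      ∃ γ : ℝ → EuclideanSpace ℝ (Fin (n + 1)), ContDiff ℝ 1 γ ∧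
        (∀ t ∈ Icc (0 : ℝ) 1, γ t ≠ 0) ∧ γ 0 = z k ∧ γ 1 = z m ∧
        curveLength (warpedMetric n ψ) γ < ε) →
    ∃ zlim : EuclideanSpace ℝ (Fin (n + 1)), δ ≤ ‖zlim‖ ∧ Tendsto z atTop (𝓝 zlim)

/-- The asymptotic behaviour at `x = +∞` of the Bryant soliton, where `ω = φ'`: for `x` large,
`ψ`, `ψ'`, `-ψ''` are bounded above and below by positive multiples of
`x^{1/2}`, `x^{-1/2}`, `x^{-3/2}`, moreover `ω` lies between two negative constants and
`ω' = O(x⁻²)`. -/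
def HasBryantAsymptotics (ψ φ : ℝ → ℝ) : Prop :=
  ∃ c C M : ℝ, 0 < c ∧ 0 < C ∧ 0 < M ∧ ∀ x : ℝ, M ≤ x →
    (c * x ^ (1 / 2 : ℝ) ≤ ψ x ∧ ψ x ≤ C * x ^ (1 / 2 : ℝ)) ∧
    (c * x ^ (-(1 / 2) : ℝ) ≤ deriv ψ x ∧ deriv ψ x ≤ C * x ^ (-(1 / 2) : ℝ)) ∧
    (-C * x ^ (-(3 / 2) : ℝ) ≤ deriv (deriv ψ) x ∧
      deriv (deriv ψ) x ≤ -c * x ^ (-(3 / 2) : ℝ)) ∧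
    (-C < deriv φ x ∧ deriv φ x < -c) ∧
    |deriv (deriv φ) x| ≤ C / x ^ 2

/-- `(ψ₂, φ₂)` is obtained from `(ψ₁, φ₁)` by the homothety with factor `k > 0` (that is,
`g₂ = k² g₁` after the reparametrization `x ↦ k x`) and by adding a constant to the potential. -/
def IsRescalingOf (k : ℝ) (ψ₂ φ₂ ψ₁ φ₁ : ℝ → ℝ) : Prop :=
  ∃ b : ℝ, ∀ x : ℝ, 0 < x → ψ₂ (k * x) = k * ψ₁ x ∧ φ₂ (k * x) = φ₁ x + b

/-! ### The planar system -/

/-- `W = 1 / (-ω + n ψ'/ψ)` with `ω = φ'`. -/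
def phaseW (n : ℕ) (ψ φ : ℝ → ℝ) (x : ℝ) : ℝ :=
  1 / (-deriv φ x + n * (deriv ψ x / ψ x))

/-- `X = √n W ψ'/ψ`. -/
def phaseX (n : ℕ) (ψ φ : ℝ → ℝ) (x : ℝ) : ℝ :=
  √(n : ℝ) * phaseW n ψ φ x * (deriv ψ x / ψ x)

/-- `Y = √(n(n-1)) W / ψ`. -/
def phaseY (n : ℕ) (ψ φ : ℝ → ℝ) (x : ℝ) : ℝ :=
  √((n : ℝ) * ((n : ℝ) - 1)) * phaseW n ψ φ x / ψ x

/-- The part of the unit disk `X² + Y² < 1` in the open first quadrant. -/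
def openQuarterDisk : Set (ℝ × ℝ) := {p | 0 < p.1 ∧ 0 < p.2 ∧ p.1 ^ 2 + p.2 ^ 2 < 1}

/-- `γ = (X, Y)` solves `X' = X³ - X + Y²/√n`, `Y' = Y (X² - X/√n)` on the open set `I`. -/
def IsSolutionOn (n : ℕ) (I : Set ℝ) (γ : ℝ → ℝ × ℝ) : Prop :=
  ∀ y ∈ I, HasDerivAt γ
    ((γ y).1 ^ 3 - (γ y).1 + (γ y).2 ^ 2 / √(n : ℝ),
      (γ y).2 * ((γ y).1 ^ 2 - (γ y).1 / √(n : ℝ))) y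

/-- `γ` is a trajectory on `I` (an interval unbounded below) that emanates from the equilibrium
point `(1, 0)` and lies in the open first quadrant inside the unit disk. -/
structure IsSingularTrajectory (n : ℕ) (I : Set ℝ) (γ : ℝ → ℝ × ℝ) : Prop where
  solution : IsSolutionOn n I γ
  emanates : Tendsto γ atBot (𝓝 (1, 0))
  mem : ∀ y ∈ I, γ y ∈ openQuarterDisk

/-- `γ` is the Bryant trajectory: it emanates from `(1/√n, √(1 - 1/n))` and converges to the
origin. -/
structure IsBryantTrajectory (n : ℕ) (γ : ℝ → ℝ × ℝ) : Prop where
  solution : IsSolutionOn n univ γ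
  emanates : Tendsto γ atBot (𝓝 (1 / √(n : ℝ), √(1 - 1 / (n : ℝ))))
  converges : Tendsto γ atTop (𝓝 (0, 0))

/-- The pair `(ψ, φ)` corresponds to the trajectory `γ : ℝ → ℝ²`: there is an increasing bijection
`x ↦ y` from `(0, ∞)` onto `ℝ` with `dy = dx / W` along which `(X, Y) = γ(y)`. -/
def CorrespondsTo (n : ℕ) (ψ φ : ℝ → ℝ) (γ : ℝ → ℝ × ℝ) : Prop :=
  ∃ y : ℝ → ℝ, BijOn y (Ioi 0) univ ∧ ∀ x : ℝ, 0 < x →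
    0 < phaseW n ψ φ x ∧ HasDerivAt y (1 / phaseW n ψ φ x) x ∧
    (phaseX n ψ φ x, phaseY n ψ φ x) = γ (y x)

/-! ### The explicit form of the metric -/

/-- `∂ᵢ ‖z‖ = zᵢ / ‖z‖`. -/
theorem hasFDerivAt_norm_euclidean {N : ℕ} {z : EuclideanSpace ℝ (Fin N)} (hz : z ≠ 0) :
    HasFDerivAt (fun w : EuclideanSpace ℝ (Fin N) => ‖w‖) (‖z‖⁻¹ • innerSL ℝ z) z := by
  have h := (hasStrictFDerivAt_norm_sq z).hasFDerivAt.sqrt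
    (by simpa using hz)
  have hn : ‖z‖ ≠ 0 := norm_ne_zero_iff.2 hz
  refine (h.congr_of_eventuallyEq (Eventually.of_forall fun w => ?_)).congr_fderiv ?_
  · simp
  · ext v
    simp
    field_simp

/-- In the coordinates `z`, the metric is
`gᵢⱼ = zᵢ zⱼ / |z|² + (ψ(|z|)² / |z|²) (δᵢⱼ - zᵢ zⱼ / |z|²)`. -/
theorem warpedMetric_apply (n : ℕ) (ψ : ℝ → ℝ) (z : EuclideanSpace ℝ (Fin (n + 1)))
    (hz : z ≠ 0) (i j : Fin (n + 1)) :
    warpedMetric n ψ z i j = z i * z j / ‖z‖ ^ 2 +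
      ψ ‖z‖ ^ 2 / ‖z‖ ^ 2 * ((if i = j then 1 else 0) - z i * z j / ‖z‖ ^ 2) := by
  have hn : ‖z‖ ≠ 0 := norm_ne_zero_iff.2 hz
  have h1 := hasFDerivAt_norm_euclidean hz
  have h2 := ((hasDerivAt_inv hn).comp_hasFDerivAt z h1).smul (hasFDerivAt_id z)
  have h3 : fderiv ℝ (fun w : EuclideanSpace ℝ (Fin (n + 1)) => ‖w‖⁻¹ • w) z = _ := h2.fderiv
  have hzz : inner ℝ z z = ‖z‖ ^ 2 := real_inner_self_eq_norm_sq z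
  have key : ∀ u v : EuclideanSpace ℝ (Fin (n + 1)),
      inner ℝ (fderiv ℝ (fun w : EuclideanSpace ℝ (Fin (n + 1)) => ‖w‖⁻¹ • w) z u)
        (fderiv ℝ (fun w : EuclideanSpace ℝ (Fin (n + 1)) => ‖w‖⁻¹ • w) z v) =
      (inner ℝ u v - inner ℝ z u * inner ℝ z v / ‖z‖ ^ 2) / ‖z‖ ^ 2 := by
    intro u v
    rw [h3]
    simp [inner_add_left, inner_add_right, inner_smul_left, inner_smul_right,
      real_inner_comm z u]
    field_simp
    ring
  have hij : inner ℝ (EuclideanSpace.single i (1 : ℝ) : EuclideanSpace ℝ (Fin (n + 1)))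
      (EuclideanSpace.single j 1) = if i = j then 1 else 0 := by
    simp [EuclideanSpace.inner_single_left]
  simp only [warpedMetric, pd, Matrix.of_apply, key, h1.fderiv, hij]
  simp [EuclideanSpace.inner_single_right]
  field_simp

end SteadySoliton

end

/-!
In the coordinates `z = x • p` the warped metric is radial, `A(r) δᵢⱼ + B(r) zᵢ zⱼ` with
`A + r² B = 1`. Its connection and curvature are computed within this ansatz
(`christoffel_warpedMetric`, `ricci_warpedMetric`, `hess_warpedMetric`), and the steady soliton
equation becomes the pair `φ'' = n ψ''/ψ`, `ψ ψ'' = (n - 1) (1 - ψ'²) + ψ ψ' φ'`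
(`isGradientSoliton_zero_iff`). In terms of the phase variables these equations are the planar
system together with `dW/dx = X²`.

The planar dynamics rests on two identities, with `a = 1/√n` and `L = 1 - X² - Y²`: along solutions
`L' = 2 X² L` and `(X - a)' = (X² - 1) (X - a) - a L`. The first keeps solutions in the unit disk,
hence global; by the second, the segment `X = a`, `0 < Y < √(1 - a²)` is a transversal that a
solution crosses at most once. Backwards from the segment, `L` decays exponentially and the solution
tends to `(1, 0)`; forwards, monotone quantities force it into the origin; conversely a solution
emanating from `(1, 0)` that never met the segment would have `L` growing without bound. So the
trajectories emanating from `(1, 0)` are parametrized, up to translation, by their points on the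
segment (`exists_singular_family`), and no analysis of the stationary point `(1, 0)` is needed.

Comparing `L' = 2 X² L` with `dW/dy = X² W` gives `L = C W²` along a soliton. The scaling `C = 1`
turns a trajectory into a soliton by `W = √L`, `dx = W dy`, `ψ = √(n(n-1)) W / Y`, `φ = n log ψ - y`
(`exists_arclength`, `solitonODE_of_trajectory`), and shows that a soliton is determined by its
trajectory up to scaling and an additive constant in `φ` (`isRescalingOf_of_trajectory`). Homothetic
members of the family coincide because the spherical equation recovers `φ'` from `ψ` where `ψ' ≠ 0`.

As `x → 0`, one has `W ∼ x`, and `log ψ - a log W` is monotone and bounded, which gives the singular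
profile. As `x → ∞`, `W` tends to a positive constant, and the relaxation lemma
`tendsto_of_relaxation`, applied to `u = X/Y²` and to `(u - a)/Y²`, gives `u → a` and
`(u - a)/Y² → 2 a³`, whence `1/Y²` grows linearly and all Bryant asymptotics follow
(`SolitonODE.hasBryantAsymptotics`). That argument uses only that the phase curve tends to the
origin, so that it applies to the Bryant soliton as well.
-/

noncomputable section

namespace SteadySoliton

/-! ### Radial metrics: gradients, inverse and Christoffel symbols -/

section Gradient

variable {N : ℕ}

/-- `f` is differentiable at `z`, and `d i` is its partial derivative `∂ᵢ f` there. This is a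
gradient for the coordinate derivatives `pd`, convenient for computing them by the usual rules. -/
def HasGrad (f : EuclideanSpace ℝ (Fin N) → ℝ) (d : Fin N → ℝ)
    (z : EuclideanSpace ℝ (Fin N)) : Prop :=
  DifferentiableAt ℝ f z ∧ ∀ i, pd i f z = d i

theorem HasGrad.congr_grad {f : EuclideanSpace ℝ (Fin N) → ℝ} {d d' : Fin N → ℝ}
    {z : EuclideanSpace ℝ (Fin N)} (h : HasGrad f d z) (hd : ∀ i, d i = d' i) : HasGrad f d' z :=
  ⟨h.1, fun i => (h.2 i).trans (hd i)⟩

theorem HasGrad.congr {f g : EuclideanSpace ℝ (Fin N) → ℝ} {d : Fin N → ℝ}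
    {z : EuclideanSpace ℝ (Fin N)} (h : HasGrad f d z) (hfg : g =ᶠ[𝓝 z] f) : HasGrad g d z :=
  ⟨h.1.congr_of_eventuallyEq hfg, fun i => by rw [← h.2 i, pd, pd, hfg.fderiv_eq]⟩

theorem HasGrad.add {f g : EuclideanSpace ℝ (Fin N) → ℝ} {d e : Fin N → ℝ}
    {z : EuclideanSpace ℝ (Fin N)} (hf : HasGrad f d z) (hg : HasGrad g e z) :
    HasGrad (fun w => f w + g w) (fun i => d i + e i) z :=
  ⟨hf.1.add hg.1, fun i => by
    simp only [← hf.2, ← hg.2, pd]; rw [fderiv_fun_add hf.1 hg.1]; rfl⟩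

theorem HasGrad.mul {f g : EuclideanSpace ℝ (Fin N) → ℝ} {d e : Fin N → ℝ}
    {z : EuclideanSpace ℝ (Fin N)} (hf : HasGrad f d z) (hg : HasGrad g e z) :
    HasGrad (fun w => f w * g w) (fun i => d i * g z + f z * e i) z :=
  ⟨hf.1.mul hg.1, fun i => by
    simp only [← hf.2, ← hg.2, pd]; rw [fderiv_fun_mul hf.1 hg.1]; simp; ring⟩

theorem hasGrad_const (c : ℝ) (z : EuclideanSpace ℝ (Fin N)) :
    HasGrad (fun _ => c) (fun _ => 0) z :=
  ⟨differentiableAt_const c, fun i => by simp [pd]⟩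

theorem hasGrad_coord (k : Fin N) (z : EuclideanSpace ℝ (Fin N)) :
    HasGrad (fun w => w k) (fun i => if i = k then 1 else 0) z := by
  have h : HasFDerivAt (fun w : EuclideanSpace ℝ (Fin N) => w k)
    (EuclideanSpace.proj k : EuclideanSpace ℝ (Fin N) →L[ℝ] ℝ) z :=
    (EuclideanSpace.proj k : EuclideanSpace ℝ (Fin N) →L[ℝ] ℝ).hasFDerivAt
  exact ⟨h.differentiableAt, fun i => by rw [pd, h.fderiv]; simp [eq_comm]⟩

theorem hasGrad_radial {F : ℝ → ℝ} {F' : ℝ} {z : EuclideanSpace ℝ (Fin N)} (hz : z ≠ 0)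
    (hF : HasDerivAt F F' ‖z‖) :
    HasGrad (fun w => F ‖w‖) (fun i => F' * z i / ‖z‖) z := by
  have h := hF.comp_hasFDerivAt z (hasFDerivAt_norm_euclidean hz)
  refine ⟨h.differentiableAt, fun i => ?_⟩
  rw [pd, show (fun w : EuclideanSpace ℝ (Fin N) => F ‖w‖) = F ∘ fun w => ‖w‖ from rfl, h.fderiv]
  simp [EuclideanSpace.inner_single_right]
  ring

theorem eventually_ne_zero {z : EuclideanSpace ℝ (Fin N)} (hz : z ≠ 0) :
    ∀ᶠ w in 𝓝 z, w ≠ 0 := isOpen_ne.mem_nhds hz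

theorem sum_coord_mul_self (z : EuclideanSpace ℝ (Fin N)) : ∑ k, z k * z k = ‖z‖ ^ 2 := by
  rw [EuclideanSpace.real_norm_sq_eq]
  exact Finset.sum_congr rfl fun k _ => (sq _).symm

/-- The inverse of a metric `a δᵢⱼ + b zᵢ zⱼ` for which the radial vector `z / ‖z‖` has length one
(`a + b ‖z‖² = 1`) is of the same form, with `a⁻¹` in place of `a`. -/
theorem inv_apply_of_radial {a b : ℝ} {z : EuclideanSpace ℝ (Fin N)} {g : Matrix (Fin N) (Fin N) ℝ}
    (hg : ∀ i j, g i j = a * (if i = j then 1 else 0) + b * (z i * z j))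
    (ha : a ≠ 0) (hz : z ≠ 0) (hab : b * ‖z‖ ^ 2 = 1 - a) (k l : Fin N) :
    g⁻¹ k l = a⁻¹ * (if k = l then 1 else 0) + (1 - a⁻¹) / ‖z‖ ^ 2 * (z k * z l) := by
  have hr : ‖z‖ ≠ 0 := norm_ne_zero_iff.2 hz
  have : g⁻¹ = Matrix.of fun k l =>
      a⁻¹ * (if k = l then 1 else 0) + (1 - a⁻¹) / ‖z‖ ^ 2 * (z k * z l) := by
    apply Matrix.inv_eq_right_inv
    ext i j
    rw [Matrix.mul_apply, Matrix.one_apply]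
    simp only [hg, Matrix.of_apply]
    have key : ∀ x, (a * (if i = x then 1 else 0) + b * (z i * z x)) *
        (a⁻¹ * (if x = j then 1 else 0) + (1 - a⁻¹) / ‖z‖ ^ 2 * (z x * z j)) =
        (if i = x then (if x = j then 1 else 0) + a * ((1 - a⁻¹) / ‖z‖ ^ 2 * (z x * z j)) else 0)
        + ((if x = j then b * a⁻¹ * (z i * z x) else 0) +
          (b * ((1 - a⁻¹) / ‖z‖ ^ 2) * (z i * z j)) * (z x * z x)) := by
      intro x
      split_ifs <;> field_simp <;> ring
    simp only [key, Finset.sum_add_distrib, Finset.sum_ite_eq, Finset.sum_ite_eq', Finset.mem_univ,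
      if_true, ← Finset.mul_sum, sum_coord_mul_self]
    have hb : b = (1 - a) / ‖z‖ ^ 2 := by field_simp; linarith
    rw [hb]
    field_simp
    ring
  rw [this, Matrix.of_apply]

/-- The Christoffel symbols of a radial metric `A(r) δᵢⱼ + B(r) zᵢ zⱼ` whose radial lines are
parametrized by arc length (`A + r² B = 1`). -/
theorem christoffel_of_radial {g : EuclideanSpace ℝ (Fin N) → Matrix (Fin N) (Fin N) ℝ}
    {A B : ℝ → ℝ} {A' B' : ℝ} {z : EuclideanSpace ℝ (Fin N)} (hz : z ≠ 0)
    (hg : ∀ w ≠ 0, ∀ i j, g w i j = A ‖w‖ * (if i = j then 1 else 0) + B ‖w‖ * (w i * w j))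
    (hA : HasDerivAt A A' ‖z‖) (hB : HasDerivAt B B' ‖z‖) (hA0 : A ‖z‖ ≠ 0)
    (hAB : B ‖z‖ * ‖z‖ ^ 2 = 1 - A ‖z‖) (k i j : Fin N) :
    christoffel g k i j z =
      A' / (2 * ‖z‖ * A ‖z‖) * (z i * (if j = k then 1 else 0) + z j * (if i = k then 1 else 0)) +
      (A' * (1 - (A ‖z‖)⁻¹) / ‖z‖ ^ 3 + B' / (2 * ‖z‖)) * (z i * z j * z k) +
      (B ‖z‖ - A' / (2 * ‖z‖)) * ((if i = j then 1 else 0) * z k) := by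
  have hr : ‖z‖ ≠ 0 := norm_ne_zero_iff.2 hz
  have hgrad : ∀ i j, HasGrad (fun w => g w i j) (fun l => A' * z l / ‖z‖ * (if i = j then 1 else 0)
      + (B' * z l / ‖z‖ * (z i * z j) + B ‖z‖ * ((if l = i then 1 else 0) * z j +
        z i * (if l = j then 1 else 0)))) z := by
    intro i j
    refine (((((hasGrad_radial hz hA).mul (hasGrad_const (if i = j then 1 else 0) z)).add
      ((hasGrad_radial hz hB).mul ((hasGrad_coord i z).mul (hasGrad_coord j z))))).congr
        ?_).congr_grad ?_
    · filter_upwards [eventually_ne_zero hz] with w hw using hg w hw i j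
    · intro l; ring
  have hinv := inv_apply_of_radial (hg z hz) hA0 hz hAB
  unfold christoffel
  simp only [(hgrad _ _).2, hinv]
  have key : ∀ l, ((A ‖z‖)⁻¹ * (if k = l then 1 else 0) + (1 - (A ‖z‖)⁻¹) / ‖z‖ ^ 2 * (z k * z l)) *
      (A' * z i / ‖z‖ * (if j = l then 1 else 0) + (B' * z i / ‖z‖ * (z j * z l) +
          B ‖z‖ * ((if i = j then 1 else 0) * z l + z j * (if i = l then 1 else 0))) +
        (A' * z j / ‖z‖ * (if i = l then 1 else 0) + (B' * z j / ‖z‖ * (z i * z l) +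
          B ‖z‖ * ((if j = i then 1 else 0) * z l + z i * (if j = l then 1 else 0)))) -
        (A' * z l / ‖z‖ * (if i = j then 1 else 0) + (B' * z l / ‖z‖ * (z i * z j) +
          B ‖z‖ * ((if l = i then 1 else 0) * z j + z i * (if l = j then 1 else 0))))) =
      (if k = l then (A ‖z‖)⁻¹ * (A' / ‖z‖ * (z i * (if j = l then 1 else 0) +
        z j * (if i = l then 1 else 0) - z l * (if i = j then 1 else 0)) +
        B' / ‖z‖ * (z i * z j * z l) + 2 * B ‖z‖ * ((if i = j then 1 else 0) * z l)) else 0) +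
      ((if j = l then (1 - (A ‖z‖)⁻¹) / ‖z‖ ^ 2 * z k * z l * (A' / ‖z‖) * z i else 0) +
      (if i = l then (1 - (A ‖z‖)⁻¹) / ‖z‖ ^ 2 * z k * z l * (A' / ‖z‖) * z j else 0) +
      ((1 - (A ‖z‖)⁻¹) / ‖z‖ ^ 2 * z k * (B' / ‖z‖ * (z i * z j) +
        (2 * B ‖z‖ - A' / ‖z‖) * (if i = j then 1 else 0))) * (z l * z l)) := by
    intro l
    rw [show (if l = i then (1:ℝ) else 0) = if i = l then 1 else 0 from by simp only [eq_comm],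
      show (if l = j then (1:ℝ) else 0) = if j = l then 1 else 0 from by simp only [eq_comm],
      show (if j = i then (1:ℝ) else 0) = if i = j then 1 else 0 from by simp only [eq_comm]]
    split_ifs <;> ring
  simp only [key, Finset.sum_add_distrib, Finset.sum_ite_eq, Finset.mem_univ,
      if_true, ← Finset.mul_sum, sum_coord_mul_self]
  have hb : B ‖z‖ = (1 - A ‖z‖) / ‖z‖ ^ 2 := by field_simp; linarith
  rw [hb]
  field_simp
  ring

end Gradient

/-! ### The Ricci tensor of a radial connection -/

section Ricci

variable {N : ℕ}

/-- The Ricci tensor of a connection whose coefficients have the radial form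
`P (zᵢ δⱼₖ + zⱼ δᵢₖ) + Q zᵢ zⱼ zₖ + S δᵢⱼ zₖ`, where `t zₗ` is the trace `∑ₖ Γᵏₖₗ`. -/
theorem ricci_of_christoffel {g : EuclideanSpace ℝ (Fin N) → Matrix (Fin N) (Fin N) ℝ}
    {P Q S : ℝ → ℝ} {P' Q' S' : ℝ} {z : EuclideanSpace ℝ (Fin N)} (hz : z ≠ 0)
    (hg : ∀ w ≠ 0, ∀ k i j, christoffel g k i j w =
      P ‖w‖ * (w i * (if j = k then 1 else 0) + w j * (if i = k then 1 else 0)) +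
        Q ‖w‖ * (w i * w j * w k) + S ‖w‖ * ((if i = j then 1 else 0) * w k))
    (hP : HasDerivAt P P' ‖z‖) (hQ : HasDerivAt Q Q' ‖z‖) (hS : HasDerivAt S S' ‖z‖)
    {p q s r t : ℝ} (hp : P ‖z‖ = p) (hq : Q ‖z‖ = q) (hs : S ‖z‖ = s) (hr : ‖z‖ = r)
    (ht : (N + 1) * p + q * r ^ 2 + s = t) (i j : Fin N) :
    ricci g i j z =
      (2 * P' / r + Q' * r + (N + 2) * q - ((N + 1) * P' + Q' * r ^ 2 + 2 * r * q + S') / r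
        + t * (2 * p + q * r ^ 2) - (p * t + s * (p + q * r ^ 2 + s) + p * (2 * p + q * r ^ 2)
          + q * ((2 * p + q * r ^ 2) * r ^ 2 + s * r ^ 2))) * (z i * z j) +
      (2 * p + N * s + S' * r - t + t * s * r ^ 2 - 2 * (s * p * r ^ 2)) *
        (if i = j then 1 else 0) := by
  have hr0 : r ≠ 0 := hr ▸ norm_ne_zero_iff.2 hz
  have hgrad : ∀ k i j, HasGrad (christoffel g k i j) (fun m =>
      P' * z m / r * (z i * (if j = k then 1 else 0) + z j * (if i = k then 1 else 0)) +
      p * ((if m = i then 1 else 0) * (if j = k then 1 else 0) +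
        (if m = j then 1 else 0) * (if i = k then 1 else 0)) +
      Q' * z m / r * (z i * z j * z k) +
      q * ((if m = i then 1 else 0) * (z j * z k) + (if m = j then 1 else 0) * (z i * z k) +
        (if m = k then 1 else 0) * (z i * z j)) +
      S' * z m / r * ((if i = j then 1 else 0) * z k) +
      s * ((if i = j then 1 else 0) * (if m = k then 1 else 0))) z := by
    intro k i j
    refine (((((hasGrad_radial hz hP).mul (((hasGrad_coord i z).mul
      (hasGrad_const (if j = k then 1 else 0) z)).add ((hasGrad_coord j z).mul
      (hasGrad_const (if i = k then 1 else 0) z)))).add ((hasGrad_radial hz hQ).mul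
      (((hasGrad_coord i z).mul (hasGrad_coord j z)).mul (hasGrad_coord k z)))).add
      ((hasGrad_radial hz hS).mul ((hasGrad_const (if i = j then 1 else 0) z).mul
        (hasGrad_coord k z)))).congr ?_).congr_grad ?_
    · filter_upwards [eventually_ne_zero hz] with w hw using hg w hw k i j
    · intro m; rw [hp, hq, hs, hr]; ring
  have hΓ := hg z hz
  rw [hp, hq, hs] at hΓ
  have hzz : ∑ k, z k * z k = r ^ 2 := by rw [sum_coord_mul_self, hr]
  -- traces and radial contractions of the Christoffel symbols
  have htr : ∀ l, ∑ k, christoffel g k k l z = t * z l := by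
    intro l
    have key : ∀ k, christoffel g k k l z = (if l = k then (p + s) * z k else 0) + p * z l +
        q * z l * (z k * z k) := by
      intro k; rw [hΓ]
      rw [show (if k = l then (1:ℝ) else 0) = if l = k then 1 else 0 from by simp only [eq_comm]]
      rw [if_pos rfl]; split_ifs with h
      · subst h; ring
      · ring
    simp only [key, Finset.sum_add_distrib, Finset.sum_ite_eq, Finset.mem_univ,
      if_true, ← Finset.mul_sum, hzz, Finset.sum_const, Finset.card_univ, Fintype.card_fin,
      nsmul_eq_mul]
    rw [← ht]; ring
  have hsymm : ∀ k i j, christoffel g k i j z = christoffel g k j i z := by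
    intro k i j; rw [hΓ, hΓ, show (if i = j then (1:ℝ) else 0) = if j = i then 1 else 0 from
      by simp only [eq_comm]]; ring
  have hlow : ∀ i k, ∑ l, z l * christoffel g l i k z =
      (2 * p + q * r ^ 2) * (z i * z k) + s * r ^ 2 * (if i = k then 1 else 0) := by
    intro i k
    have key : ∀ l, z l * christoffel g l i k z = (if k = l then p * z i * z l else 0) +
        (if i = l then p * z k * z l else 0) +
        (q * (z i * z k) + s * (if i = k then 1 else 0)) * (z l * z l) := by
      intro l; rw [hΓ]; split_ifs <;> ring
    simp only [key, Finset.sum_add_distrib, Finset.sum_ite_eq, Finset.mem_univ,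
      if_true, ← Finset.mul_sum, hzz]
    ring
  have hrad : ∀ i j, ∑ k, z k * christoffel g j i k z =
      (p + q * r ^ 2 + s) * (z i * z j) + p * r ^ 2 * (if i = j then 1 else 0) := by
    intro i j
    have key : ∀ k, z k * christoffel g j i k z = (if j = k then p * z i * z k else 0) +
        (if i = k then s * z j * z k else 0) +
        (q * (z i * z j) + p * (if i = j then 1 else 0)) * (z k * z k) := by
      intro k; rw [hΓ]
      rw [show (if k = j then (1:ℝ) else 0) = if j = k then 1 else 0 from by simp only [eq_comm]]
      split_ifs <;> ring
    simp only [key, Finset.sum_add_distrib, Finset.sum_ite_eq, Finset.mem_univ,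
      if_true, ← Finset.mul_sum, hzz]
    ring
  have h1 : ∑ k, pd k (christoffel g k i j) z =
      (2 * P' / r + Q' * r + (N + 2) * q) * (z i * z j) +
        (2 * p + N * s + S' * r) * (if i = j then 1 else 0) := by
    have key : ∀ k, pd k (christoffel g k i j) z =
        (if j = k then (P' / r * z i + q * z i) * z k + p * (if i = j then 1 else 0) else 0) +
        (if i = k then (P' / r * z j + q * z j) * z k + p * (if i = j then 1 else 0) else 0) +
        (Q' / r * (z i * z j) + S' / r * (if i = j then 1 else 0)) * (z k * z k) +
        (q * (z i * z j) + s * (if i = j then 1 else 0)) := by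
      intro k; rw [(hgrad k i j).2]; beta_reduce
      rw [show (if k = j then (1:ℝ) else 0) = if j = k then 1 else 0 from by simp only [eq_comm],
        show (if k = i then (1:ℝ) else 0) = if i = k then 1 else 0 from by simp only [eq_comm],
        if_pos rfl]
      by_cases h1 : j = k <;> by_cases h2 : i = k
      · subst h1; subst h2; simp; ring
      · subst h1; simp [h2]; ring
      · subst h2; simp [h1, Ne.symm h1]; ring
      · simp only [if_neg h1, if_neg h2]; ring
    simp only [key, Finset.sum_add_distrib, Finset.sum_ite_eq, Finset.mem_univ,
      if_true, ← Finset.mul_sum, hzz, Finset.sum_const, Finset.card_univ, Fintype.card_fin,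
      nsmul_eq_mul]
    field_simp
    ring
  have h2 : ∑ k, pd j (christoffel g k i k) z =
      (((N + 1) * P' + Q' * r ^ 2 + 2 * r * q + S') / r) * (z i * z j) +
        t * (if i = j then 1 else 0) := by
    have key : ∀ k, pd j (christoffel g k i k) z =
        (if i = k then (P' / r + S' / r) * z j * z k + (p + s) * (if i = j then 1 else 0) else 0) +
        (if j = k then 2 * q * z i * z k else 0) +
        (Q' / r * (z i * z j) + q * (if i = j then 1 else 0)) * (z k * z k) +
        (P' / r * (z i * z j) + p * (if i = j then 1 else 0)) := by
      intro k; rw [(hgrad k i k).2]; beta_reduce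
      rw [show (if j = i then (1:ℝ) else 0) = if i = j then 1 else 0 from by simp only [eq_comm],
        if_pos rfl]
      by_cases h1 : j = k <;> by_cases h2 : i = k
      · subst h1; subst h2; simp; ring
      · subst h1; simp [h2]; ring
      · subst h2; simp [h1, Ne.symm h1]; ring
      · simp only [if_neg h1, if_neg h2]; ring
    simp only [key, Finset.sum_add_distrib, Finset.sum_ite_eq, Finset.mem_univ,
      if_true, ← Finset.mul_sum, hzz, Finset.sum_const, Finset.card_univ, Fintype.card_fin,
      nsmul_eq_mul]
    rw [← ht]
    field_simp
    ring
  have h3 : ∑ k, ∑ l, christoffel g k k l z * christoffel g l i j z =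
      t * ((2 * p + q * r ^ 2) * (z i * z j) + s * r ^ 2 * (if i = j then 1 else 0)) := by
    rw [Finset.sum_comm]
    simp only [← Finset.sum_mul, htr]
    rw [← hlow, Finset.mul_sum]
    exact Finset.sum_congr rfl fun l _ => by ring
  have h4 : ∑ k, ∑ l, christoffel g k j l z * christoffel g l i k z =
      p * z j * (t * z i) + s * ((p + q * r ^ 2 + s) * (z i * z j) +
        p * r ^ 2 * (if i = j then 1 else 0)) +
      p * ((2 * p + q * r ^ 2) * (z i * z j) + s * r ^ 2 * (if i = j then 1 else 0)) +
      q * z j * (((2 * p + q * r ^ 2) * r ^ 2 + s * r ^ 2) * z i) := by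
    have inner : ∀ k, ∑ l, christoffel g k j l z * christoffel g l i k z =
        p * z j * christoffel g k k i z + s * (z k * christoffel g j i k z) +
        (if j = k then p * ((2 * p + q * r ^ 2) * (z i * z k) +
          s * r ^ 2 * (if i = k then 1 else 0)) else 0) +
        q * z j * ((2 * p + q * r ^ 2) * z i * (z k * z k) +
          (if i = k then s * r ^ 2 * z k else 0)) := by
      intro k
      have key : ∀ l, christoffel g k j l z * christoffel g l i k z =
          (if k = l then p * z j * christoffel g l i k z else 0) +
          (if j = l then s * z k * christoffel g l i k z else 0) +
          (p * (if j = k then 1 else 0) + q * z j * z k) * (z l * christoffel g l i k z) := by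
        intro l
        rw [hΓ k j l, show (if l = k then (1:ℝ) else 0) = if k = l then 1 else 0 from
          by simp only [eq_comm]]
        split_ifs <;> ring
      simp only [key, Finset.sum_add_distrib, Finset.sum_ite_eq, Finset.mem_univ,
        if_true, ← Finset.mul_sum, hlow, hsymm k i k]
      split_ifs <;> ring
    simp only [inner, Finset.sum_add_distrib, Finset.sum_ite_eq, Finset.mem_univ,
        if_true, ← Finset.mul_sum, htr, hrad, hzz]
    ring
  unfold ricci
  simp only [Finset.sum_add_distrib, Finset.sum_sub_distrib, h1, h2, h3, h4]
  ring

end Ricci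

/-! ### The soliton equation for a warped product -/

/-- With `r = ‖z‖`, the coefficients of the radial form are `P = ψ' / (r ψ) - 1 / r²`,
`S = 1 / r² - ψ ψ' / r³` and `Q = -(2 P + S) / r²`; the last relation says that radial lines are
geodesics. -/
theorem christoffel_warpedMetric (n : ℕ) {ψ : ℝ → ℝ} {ψ' : ℝ} {z : EuclideanSpace ℝ (Fin (n + 1))}
    (hz : z ≠ 0) (hψ : HasDerivAt ψ ψ' ‖z‖) (hψ0 : ψ ‖z‖ ≠ 0) (k i j : Fin (n + 1)) :
    christoffel (warpedMetric n ψ) k i j z =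
      (ψ' / (‖z‖ * ψ ‖z‖) - 1 / ‖z‖ ^ 2) *
        (z i * (if j = k then 1 else 0) + z j * (if i = k then 1 else 0)) +
      (-(2 * (ψ' / (‖z‖ * ψ ‖z‖)) - 1 / ‖z‖ ^ 2 - ψ ‖z‖ * ψ' / ‖z‖ ^ 3) / ‖z‖ ^ 2) *
        (z i * z j * z k) +
      (1 / ‖z‖ ^ 2 - ψ ‖z‖ * ψ' / ‖z‖ ^ 3) * ((if i = j then 1 else 0) * z k) := by
  have hr : ‖z‖ ≠ 0 := norm_ne_zero_iff.2 hz
  have hA : HasDerivAt (fun r => ψ r ^ 2 / r ^ 2)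
      (2 * ψ ‖z‖ * ψ' / ‖z‖ ^ 2 - 2 * ψ ‖z‖ ^ 2 / ‖z‖ ^ 3) ‖z‖ := by
    refine ((hψ.pow 2).div (hasDerivAt_pow 2 ‖z‖) (pow_ne_zero 2 hr)).congr_deriv ?_
    simp
    field_simp
  have hB : HasDerivAt (fun r => (1 - ψ r ^ 2 / r ^ 2) / r ^ 2)
      (-(2 * ψ ‖z‖ * ψ' / ‖z‖ ^ 2 - 2 * ψ ‖z‖ ^ 2 / ‖z‖ ^ 3) / ‖z‖ ^ 2 -
        2 * (1 - ψ ‖z‖ ^ 2 / ‖z‖ ^ 2) / ‖z‖ ^ 3) ‖z‖ := by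
    refine ((hA.const_sub 1).div (hasDerivAt_pow 2 ‖z‖) (pow_ne_zero 2 hr)).congr_deriv ?_
    simp
    field_simp
  rw [christoffel_of_radial hz (A := fun r => ψ r ^ 2 / r ^ 2)
    (B := fun r => (1 - ψ r ^ 2 / r ^ 2) / r ^ 2) ?_ hA hB
    (div_ne_zero (pow_ne_zero 2 hψ0) (pow_ne_zero 2 hr)) (by field_simp) k i j]
  · congr 1
    · congr 1
      · congr 1
        field_simp
      · congr 1
        field_simp
        ring
    · congr 1
      field_simp
      ring
  · intro w hw i j
    rw [warpedMetric_apply n ψ w hw]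
    have : ‖w‖ ≠ 0 := norm_ne_zero_iff.2 hw
    field_simp
    ring

/-- `Ric = -n (ψ''/ψ) dx² + ((n - 1) (1 - ψ'²) - ψ ψ'') g_{Sⁿ}`, in the coordinates `z`. -/
theorem ricci_warpedMetric (n : ℕ) {ψ : ℝ → ℝ} (hψ : ContDiffOn ℝ ∞ ψ (Ioi 0))
    (hpos : ∀ x, 0 < x → 0 < ψ x) {z : EuclideanSpace ℝ (Fin (n + 1))} (hz : z ≠ 0) {r : ℝ}
    (hr : ‖z‖ = r) (i j : Fin (n + 1)) :
    ricci (warpedMetric n ψ) i j z =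
      -n * deriv (deriv ψ) r / ψ r * (z i * z j / r ^ 2) +
      ((n - 1) * (1 - deriv ψ r ^ 2) - ψ r * deriv (deriv ψ) r) / r ^ 2 *
        ((if i = j then 1 else 0) - z i * z j / r ^ 2) := by
  have hr0 : 0 < r := hr ▸ norm_pos_iff.2 hz
  have hd : ∀ x, 0 < x → HasDerivAt ψ (deriv ψ x) x := fun x hx =>
    ((hψ.differentiableOn (by simp)).differentiableAt (Ioi_mem_nhds hx)).hasDerivAt
  have hψ1 : ContDiffOn ℝ ∞ (deriv ψ) (Ioi 0) := hψ.deriv_of_isOpen isOpen_Ioi (by simp)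
  have hd2 : HasDerivAt (deriv ψ) (deriv (deriv ψ) r) r :=
    ((hψ1.differentiableOn (by simp)).differentiableAt (Ioi_mem_nhds hr0)).hasDerivAt
  have hd1 := hd r hr0
  have hp0 := (hpos r hr0).ne'
  set f := ψ r with hf
  set f1 := deriv ψ r with hf1
  set f2 := deriv (deriv ψ) r with hf2
  have hrne := hr0.ne'
  have hP0 : HasDerivAt (fun x => deriv ψ x / (x * ψ x))
      (f2 / (r * f) - f1 * (f + r * f1) / (r * f) ^ 2) r := by
    refine (hd2.div ((hasDerivAt_id r).mul hd1) (mul_ne_zero hrne hp0)).congr_deriv ?_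
    simp only [Pi.mul_apply, id, ← hf, ← hf1]
    field_simp
  have hi2 : HasDerivAt (fun x : ℝ => 1 / x ^ 2) (-2 / r ^ 3) r := by
    refine ((hasDerivAt_const r (1:ℝ)).div (hasDerivAt_pow 2 r) (pow_ne_zero 2 hrne)).congr_deriv ?_
    simp
    field_simp
  have hS0 : HasDerivAt (fun x : ℝ => ψ x * deriv ψ x / x ^ 3)
      ((f1 * f1 + f * f2) / r ^ 3 - 3 * (f * f1) / r ^ 4) r := by
    refine ((hd1.mul hd2).div (hasDerivAt_pow 3 r) (pow_ne_zero 3 hrne)).congr_deriv ?_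
    simp only [Pi.mul_apply, ← hf, ← hf1]
    field_simp
    ring
  have hP := hP0.sub hi2
  have hS := hi2.sub hS0
  have hQ := ((((hP0.const_mul 2).sub hi2).sub hS0).neg).div (hasDerivAt_pow 2 r)
    (pow_ne_zero 2 hrne)
  rw [← hr] at hP hS hQ
  have hmain := ricci_of_christoffel (g := warpedMetric n ψ) hz
    (fun w hw k i j => christoffel_warpedMetric n hw (hd _ (norm_pos_iff.2 hw))
      (hpos _ (norm_pos_iff.2 hw)).ne' k i j) hP hQ hS rfl rfl rfl hr rfl i j
  rw [hmain]
  simp only [hr, ← hf, ← hf1, Pi.neg_apply, Pi.sub_apply, Pi.div_apply]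
  push_cast
  generalize (if i = j then (1:ℝ) else 0) = δ
  field_simp
  ring

/-- `∇∇φ = φ'' dx² + ψ ψ' φ' g_{Sⁿ}`, in the coordinates `z`. -/
theorem hess_warpedMetric (n : ℕ) {ψ φ : ℝ → ℝ} (hψ : ContDiffOn ℝ ∞ ψ (Ioi 0))
    (hpos : ∀ x, 0 < x → 0 < ψ x) (hφ : ContDiffOn ℝ ∞ φ (Ioi 0))
    {z : EuclideanSpace ℝ (Fin (n + 1))} (hz : z ≠ 0) {r : ℝ}
    (hr : ‖z‖ = r) (i j : Fin (n + 1)) :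
    hess (warpedMetric n ψ) (fun w => φ ‖w‖) i j z =
      deriv (deriv φ) r * (z i * z j / r ^ 2) +
      ψ r * deriv ψ r * deriv φ r / r ^ 2 *
        ((if i = j then 1 else 0) - z i * z j / r ^ 2) := by
  have hr0 : 0 < r := hr ▸ norm_pos_iff.2 hz
  have hd : ∀ {f : ℝ → ℝ}, ContDiffOn ℝ ∞ f (Ioi 0) → ∀ x, 0 < x → HasDerivAt f (deriv f x) x :=
    fun hf x hx =>
    ((hf.differentiableOn (by simp)).differentiableAt (Ioi_mem_nhds hx)).hasDerivAt
  have hφ1 : ContDiffOn ℝ ∞ (deriv φ) (Ioi 0) := hφ.deriv_of_isOpen isOpen_Ioi (by simp)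
  have hrne := hr0.ne'
  have hp0 := (hpos r hr0).ne'
  have h1 : ∀ w ≠ 0, ∀ k, pd k (fun w : EuclideanSpace ℝ (Fin (n + 1)) => φ ‖w‖) w =
      deriv φ ‖w‖ / ‖w‖ * w k := fun w hw k => by
    rw [(hasGrad_radial hw (hd hφ _ (norm_pos_iff.2 hw))).2]; ring
  have h0 : HasDerivAt (fun x => deriv φ x / x) (deriv (deriv φ) r / r - deriv φ r / r ^ 2) r := by
    refine ((hd hφ1 r hr0).div (hasDerivAt_id r) hrne).congr_deriv ?_
    simp only [id]
    field_simp
  have h2 : HasGrad (pd j (fun w : EuclideanSpace ℝ (Fin (n + 1)) => φ ‖w‖)) (fun i =>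
      (deriv (deriv φ) r / r - deriv φ r / r ^ 2) * z i / r * z j +
        deriv φ r / r * (if i = j then 1 else 0)) z := by
    rw [← hr] at h0
    refine (((hasGrad_radial hz h0).mul (hasGrad_coord j z)).congr ?_).congr_grad ?_
    · filter_upwards [eventually_ne_zero hz] with w hw using h1 w hw j
    · intro m; rw [hr]
  have hzz : ∑ k, z k * z k = r ^ 2 := by rw [sum_coord_mul_self, hr]
  unfold hess
  rw [h2.2]
  simp only [h1 z hz, christoffel_warpedMetric n hz (hd hψ _ (norm_pos_iff.2 hz))
      (hpos _ (norm_pos_iff.2 hz)).ne', hr]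
  have key : ∀ k, ((deriv ψ r / (r * ψ r) - 1 / r ^ 2) *
        (z i * (if j = k then 1 else 0) + z j * (if i = k then 1 else 0)) +
      (-(2 * (deriv ψ r / (r * ψ r)) - 1 / r ^ 2 - ψ r * deriv ψ r / r ^ 3) / r ^ 2) *
        (z i * z j * z k) +
      (1 / r ^ 2 - ψ r * deriv ψ r / r ^ 3) * ((if i = j then 1 else 0) * z k)) *
      (deriv φ r / r * z k) =
      (if j = k then (deriv ψ r / (r * ψ r) - 1 / r ^ 2) * (deriv φ r / r) * z i * z k else 0) +
      (if i = k then (deriv ψ r / (r * ψ r) - 1 / r ^ 2) * (deriv φ r / r) * z j * z k else 0) +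
      (deriv φ r / r) *
      ((-(2 * (deriv ψ r / (r * ψ r)) - 1 / r ^ 2 - ψ r * deriv ψ r / r ^ 3) / r ^ 2) * (z i * z j)
      + (1 / r ^ 2 - ψ r * deriv ψ r / r ^ 3) * (if i = j then 1 else 0)) * (z k * z k) := by
    intro k
    split_ifs <;> ring
  simp only [key, Finset.sum_add_distrib, Finset.sum_ite_eq, Finset.mem_univ,
    if_true, ← Finset.mul_sum, hzz]
  generalize (if i = j then (1:ℝ) else 0) = δ
  field_simp
  ring

/-- The steady soliton equation as a system of ordinary differential equations: the radial component
`φ'' = n ψ''/ψ` and the spherical component `ψ ψ'' = (n - 1) (1 - ψ'²) + ψ ψ' φ'`. -/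
structure SolitonODE (n : ℕ) (ψ φ : ℝ → ℝ) : Prop where
  smooth_metric : ContDiffOn ℝ ∞ ψ (Ioi 0)
  pos : ∀ x, 0 < x → 0 < ψ x
  smooth_potential : ContDiffOn ℝ ∞ φ (Ioi 0)
  radial : ∀ x, 0 < x → deriv (deriv φ) x = n * deriv (deriv ψ) x / ψ x
  spherical : ∀ x, 0 < x → ψ x * deriv (deriv ψ) x =
    (n - 1) * (1 - deriv ψ x ^ 2) + ψ x * deriv ψ x * deriv φ x

/-- For the forward direction: at a point of the first coordinate axis, the `(0, 0)` component of
the tensor equation is the radial equation and any other diagonal component is the spherical one;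
such a component exists as `n ≥ 1`. -/
theorem isGradientSoliton_zero_iff {n : ℕ} (hn : 1 ≤ n) {ψ φ : ℝ → ℝ} :
    IsGradientSoliton n 0 ψ φ ↔ SolitonODE n ψ φ := by
  constructor
  · rintro ⟨hψ, hpos, hφ, h⟩
    have key : ∀ x : ℝ, 0 < x → ∀ i j : Fin (n + 1),
        (-n * deriv (deriv ψ) x / ψ x + deriv (deriv φ) x) *
          ((if i = 0 then 1 else 0) * (if j = 0 then 1 else 0)) +
        ((n - 1) * (1 - deriv ψ x ^ 2) - ψ x * deriv (deriv ψ) x + ψ x * deriv ψ x * deriv φ x) /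
          x ^ 2 * ((if i = j then 1 else 0) - (if i = 0 then 1 else 0) * (if j = 0 then 1 else 0))
          = 0 := by
      intro x hx i j
      have hz : EuclideanSpace.single (0 : Fin (n + 1)) x ≠ 0 := by simp [hx.ne']
      have hr : ‖EuclideanSpace.single (0 : Fin (n + 1)) x‖ = x := by simp [abs_of_pos hx]
      have h0 := h _ hz i j
      rw [ricci_warpedMetric n hψ hpos hz hr, hess_warpedMetric n hψ hpos hφ hz hr] at h0
      simp only [PiLp.single_apply, zero_mul, add_zero] at h0
      refine Eq.trans ?_ h0
      rw [show (if i = 0 then x else 0) = x * (if i = 0 then 1 else 0) by split_ifs <;> simp,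
        show (if j = 0 then x else 0) = x * (if j = 0 then 1 else 0) by split_ifs <;> simp]
      generalize (if i = 0 then (1:ℝ) else 0) = a
      generalize (if j = 0 then (1:ℝ) else 0) = b
      have := (hpos x hx).ne'
      field_simp
      ring
    refine ⟨hψ, hpos, hφ, fun x hx => ?_, fun x hx => ?_⟩
    · have := key x hx 0 0
      simp at this
      have h2 := (hpos x hx).ne'
      field_simp at this ⊢
      linarith
    · have := key x hx (Fin.last n) (Fin.last n)
      have hl : Fin.last n ≠ 0 := by
        rw [Ne, Fin.ext_iff]; simp; omega
      simp [hl, hx.ne'] at this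
      linarith
  · rintro ⟨hψ, hpos, hφ, h1, h2⟩
    refine ⟨hψ, hpos, hφ, fun z hz i j => ?_⟩
    have hx : 0 < ‖z‖ := norm_pos_iff.2 hz
    rw [ricci_warpedMetric n hψ hpos hz rfl, hess_warpedMetric n hψ hpos hφ hz rfl, h1 _ hx,
      h2 _ hx]
    have := (hpos _ hx).ne'
    field_simp
    ring

/-! ### Auxiliary facts on ordinary differential equations and limits -/

/-- A bounded Lipschitz vector field has global integral curves: Picard–Lindelöf gives solutions on
the intervals `(-(k + 1), k + 1)`, because the bound keeps them in the ball of radius `C (k + 1)`.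
-/
theorem exists_global_solution {E : Type*} [NormedAddCommGroup E] [NormedSpace ℝ E]
    [CompleteSpace E] {v : E → E} {K C : NNReal} (hv : LipschitzWith K v) (hb : ∀ x, ‖v x‖ ≤ C)
    (p : E) : ∃ γ : ℝ → E, γ 0 = p ∧ ∀ t, HasDerivAt γ (v (γ t)) t := by
  have hex : ∀ k : ℕ, ∃ α : ℝ → E, α 0 = p ∧
      ∀ t ∈ Ioo (-(k + 1 : ℝ)) (k + 1), HasDerivAt α (v (α t)) t := by
    intro k
    have h0 : (0 : ℝ) ∈ Icc (-(k + 1 : ℝ)) (k + 1) := ⟨by linarith [k.cast_nonneg (α := ℝ)],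
      by linarith [k.cast_nonneg (α := ℝ)]⟩
    have hPL : IsPicardLindelof (fun _ => v) (⟨0, h0⟩ : Icc (-(k + 1 : ℝ)) (k + 1)) p
        (C * (k + 1)) 0 C K :=
      { lipschitzOnWith := fun _ _ => hv.lipschitzOnWith
        continuousOn := fun _ _ => continuousOn_const
        norm_le := fun _ _ x _ => hb x
        mul_max_le := by simp }
    obtain ⟨α, hα, hα'⟩ := hPL.exists_eq_forall_mem_Icc_hasDerivWithinAt₀
    exact ⟨α, hα, fun t ht => (hα' t (Ioo_subset_Icc_self ht)).hasDerivAt (Icc_mem_nhds ht.1 ht.2)⟩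
  choose α h0 hα using hex
  have hagree : ∀ k m : ℕ, ∀ t ∈ Ioo (-(k + 1 : ℝ)) (k + 1), t ∈ Ioo (-(m + 1 : ℝ)) (m + 1) →
      α k t = α m t := by
    have hle : ∀ k m : ℕ, k ≤ m → ∀ t ∈ Ioo (-(k + 1 : ℝ)) (k + 1), α k t = α m t := by
      intro k m hkm t ht
      have hkm' : (k : ℝ) ≤ m := by exact_mod_cast hkm
      refine ODE_solution_unique_of_mem_Ioo (v := fun _ => v) (s := fun _ => univ) (t₀ := 0)
        (fun _ _ => hv.lipschitzOnWith) ⟨by linarith [k.cast_nonneg (α := ℝ)],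
          by linarith [k.cast_nonneg (α := ℝ)]⟩ (fun t ht => ⟨hα k t ht, trivial⟩)
        (fun t ht => ⟨hα m t ⟨by linarith [ht.1], by linarith [ht.2]⟩, trivial⟩)
        (by rw [h0, h0]) ht
    intro k m t hk hm
    rcases le_total k m with h | h
    · exact hle k m h t hk
    · exact (hle m k h t hm).symm
  have hmem : ∀ t : ℝ, t ∈ Ioo (-((⌊|t|⌋₊ : ℝ) + 1)) (⌊|t|⌋₊ + 1) := fun t =>
    abs_lt.1 (Nat.lt_floor_add_one |t|)
  -- glue the local solutions: `t` lies in the interval of index `⌊|t|⌋₊`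
  refine ⟨fun t => α ⌊|t|⌋₊ t, by simp [h0], fun t => ?_⟩
  refine (hα ⌊|t|⌋₊ t (hmem t)).congr_of_eventuallyEq ?_
  filter_upwards [Ioo_mem_nhds (hmem t).1 (hmem t).2] with u hu
  exact hagree _ _ u (hmem u) hu

/-- Grönwall's inequality in both time directions. -/
theorem dist_solution_le {E : Type*} [NormedAddCommGroup E] [NormedSpace ℝ E]
    {v : E → E} {K : NNReal} (hv : LipschitzWith K v) {γ δ : ℝ → E}
    (hγ : ∀ t, HasDerivAt γ (v (γ t)) t) (hδ : ∀ t, HasDerivAt δ (v (δ t)) t) (t : ℝ) :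
    dist (γ t) (δ t) ≤ dist (γ 0) (δ 0) * Real.exp (K * |t|) := by
  rcases le_total 0 t with ht | ht
  · have := dist_le_of_trajectories_ODE (v := fun _ => v) (fun _ => hv)
      (HasDerivAt.continuousOn fun t _ => hγ t) (fun t _ => (hγ t).hasDerivWithinAt)
      (HasDerivAt.continuousOn fun t _ => hδ t) (fun t _ => (hδ t).hasDerivWithinAt) le_rfl t
      ⟨ht, le_rfl⟩
    simpa [abs_of_nonneg ht] using this
  · have hrev : ∀ {η : ℝ → E}, (∀ t, HasDerivAt η (v (η t)) t) →
        ∀ t, HasDerivAt (fun t => η (-t)) ((fun x => -v x) (η (-t))) t := by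
      intro η hη t
      simpa [Function.comp_def] using (hη (-t)).scomp t (hasDerivAt_neg t)
    have := dist_le_of_trajectories_ODE (v := fun _ x => -v x) (K := K) (fun _ => hv.neg)
      (HasDerivAt.continuousOn fun t _ => hrev hγ t) (fun t _ => (hrev hγ t).hasDerivWithinAt)
      (HasDerivAt.continuousOn fun t _ => hrev hδ t) (fun t _ => (hrev hδ t).hasDerivWithinAt)
      le_rfl (-t) ⟨neg_nonneg.2 ht, le_rfl⟩
    simpa [abs_of_nonpos ht] using this

/-- The integrating factor `e = exp (-∫ a)` of `f' = a f + b`. -/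
theorem exists_integrating_factor {f a b : ℝ → ℝ} (ha : Continuous a)
    (hf : ∀ t, HasDerivAt f (a t * f t + b t) t) :
    ∃ e : ℝ → ℝ, e 0 = 1 ∧ (∀ t, 0 < e t) ∧ ∀ t, HasDerivAt (fun t => f t * e t) (b t * e t) t := by
  have hA : ∀ t, HasDerivAt (fun t => ∫ u in (0 : ℝ)..t, a u) (a t) t := fun t =>
    intervalIntegral.integral_hasDerivAt_right (ha.intervalIntegrable _ _)
      (ha.stronglyMeasurableAtFilter _ _) ha.continuousAt
  refine ⟨fun t => Real.exp (-∫ u in (0 : ℝ)..t, a u), by simp, fun t => Real.exp_pos _,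
    fun t => ?_⟩
  refine ((hf t).mul (hA t).fun_neg.exp).congr_deriv ?_
  ring

theorem pos_of_linear {f a : ℝ → ℝ} (ha : Continuous a) (hf : ∀ t, HasDerivAt f (a t * f t) t)
    (h0 : 0 < f 0) (t : ℝ) : 0 < f t := by
  obtain ⟨e, he0, he, h⟩ := exists_integrating_factor (b := fun _ => 0) ha (by simpa using hf)
  have hc : f t * e t = f 0 * e 0 := is_const_of_deriv_eq_zero
    (fun t => (h t).differentiableAt) (fun t => by rw [(h t).deriv]; simp) t 0
  rw [he0, mul_one] at hc
  exact pos_of_mul_pos_left (hc ▸ h0) (he t).le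

theorem pos_of_linear_of_nonneg {f a b : ℝ → ℝ} (ha : Continuous a)
    (hf : ∀ t, HasDerivAt f (a t * f t + b t) t) (hb : ∀ t, 0 ≤ b t)
    (h0 : 0 < f 0) {t : ℝ} (ht : 0 ≤ t) : 0 < f t := by
  obtain ⟨e, he0, he, h⟩ := exists_integrating_factor ha hf
  have hm : Monotone fun t => f t * e t := monotone_of_deriv_nonneg
    (fun t => (h t).differentiableAt)
    (fun t => by rw [(h t).deriv]; exact mul_nonneg (hb t) (he t).le)
  have := hm ht
  simp only [he0, mul_one] at this
  exact pos_of_mul_pos_left (h0.trans_le this) (he t).le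

/-- A solution of `f' = a f + b` with `b < 0` changes sign exactly once, at its zero. -/
theorem sign_of_linear_of_neg {f a b : ℝ → ℝ} (ha : Continuous a)
    (hf : ∀ t, HasDerivAt f (a t * f t + b t) t) (hb : ∀ t, b t < 0) (h0 : f 0 = 0) :
    (∀ t < 0, 0 < f t) ∧ ∀ t > 0, f t < 0 := by
  obtain ⟨e, he0, he, h⟩ := exists_integrating_factor ha hf
  have hm : StrictAnti fun t => f t * e t := strictAnti_of_deriv_neg
    (fun t => by rw [(h t).deriv]; exact mul_neg_of_neg_of_pos (hb t) (he t))
  constructor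
  · intro t ht
    have := hm ht
    simp only [h0, zero_mul] at this
    exact pos_of_mul_pos_left this (he t).le
  · intro t ht
    have := hm ht
    simp only [h0, zero_mul] at this
    exact neg_of_mul_neg_left this (he t).le

theorem exists_tendsto_of_antitoneOn {f : ℝ → ℝ} {a m : ℝ} (hf : AntitoneOn f (Ici a))
    (hm : ∀ t, a ≤ t → m ≤ f t) : ∃ l, m ≤ l ∧ l ≤ f a ∧ Tendsto f atTop (𝓝 l) := by
  have hanti : Antitone fun t => f (max t a) := fun s t hst =>
    hf (mem_Ici.2 (le_max_right _ _)) (mem_Ici.2 (le_max_right _ _)) (max_le_max_right a hst)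
  have h := tendsto_atTop_ciInf hanti ⟨m, by rintro _ ⟨t, rfl⟩; exact hm _ (le_max_right _ _)⟩
  have h' : Tendsto f atTop (𝓝 (⨅ t, f (max t a))) := by
    refine h.congr' ?_
    filter_upwards [eventually_ge_atTop a] with t ht
    rw [max_eq_left ht]
  refine ⟨_, ge_of_tendsto h' ?_, le_of_tendsto h' ?_, h'⟩
  · filter_upwards [eventually_ge_atTop a] with t ht using hm t ht
  · filter_upwards [eventually_ge_atTop a] with t ht using hf self_mem_Ici ht ht

/-- If a function and its derivative both converge at `+∞`, the derivative tends to `0`. -/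
theorem deriv_limit_eq_zero {f f' : ℝ → ℝ} {l c : ℝ} (hf : ∀ t, HasDerivAt f (f' t) t)
    (hl : Tendsto f atTop (𝓝 l)) (hc : Tendsto f' atTop (𝓝 c)) : c = 0 := by
  have hex : ∀ t, ∃ ξ ∈ Ioo t (t + 1), f' ξ = f (t + 1) - f t := fun t => by
    obtain ⟨ξ, hξ, h⟩ := exists_hasDerivAt_eq_slope f f' (lt_add_one t)
      (HasDerivAt.continuousOn fun t _ => hf t) (fun t _ => hf t)
    exact ⟨ξ, hξ, by rw [h]; simp⟩
  choose ξ hξ h using hex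
  have hξt : Tendsto ξ atTop atTop := tendsto_atTop_mono (fun t => (hξ t).1.le) tendsto_id
  have h1 : Tendsto (fun t => f' (ξ t)) atTop (𝓝 c) := hc.comp hξt
  have h2 : Tendsto (fun t => f (t + 1) - f t) atTop (𝓝 (l - l)) :=
    (hl.comp (tendsto_atTop_add_const_right _ _ tendsto_id)).sub hl
  rw [sub_self] at h2
  exact tendsto_nhds_unique (h1.congr h) h2

theorem deriv_limit_eq_zero_atBot {f f' : ℝ → ℝ} {l c : ℝ} (hf : ∀ t, HasDerivAt f (f' t) t)
    (hl : Tendsto f atBot (𝓝 l)) (hc : Tendsto f' atBot (𝓝 c)) : c = 0 := by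
  have := deriv_limit_eq_zero (f := fun t => f (-t)) (f' := fun t => -f' (-t)) (l := l) (c := -c)
    (fun t => by simpa [Function.comp_def] using (hf (-t)).scomp t (hasDerivAt_neg t))
    (hl.comp tendsto_neg_atTop_atBot) (hc.comp tendsto_neg_atTop_atBot).neg
  linarith

/-- Bootstrapping: solutions of an autonomous equation with smooth right-hand side are smooth. -/
theorem contDiffOn_of_autonomous {E : Type*} [NormedAddCommGroup E] [NormedSpace ℝ E]
    {s : Set ℝ} (hs : IsOpen s) {f : ℝ → E} {G : E → E} (hG : ContDiff ℝ ∞ G)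
    (hf : ∀ x ∈ s, HasDerivAt f (G (f x)) x) : ContDiffOn ℝ ∞ f s := by
  rw [contDiffOn_infty]
  intro k
  induction k with
  | zero => exact contDiffOn_zero.2 (HasDerivAt.continuousOn hf)
  | succ k ih =>
    rw [show ((k + 1 : ℕ) : WithTop ℕ∞) = (k : WithTop ℕ∞) + 1 by push_cast; rfl,
      contDiffOn_succ_iff_deriv_of_isOpen hs]
    refine ⟨fun x hx => (hf x hx).differentiableAt.differentiableWithinAt, by simp, ?_⟩
    exact ((hG.of_le (by exact_mod_cast le_top)).comp_contDiffOn ih).congr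
      fun x hx => (hf x hx).deriv

/-! ### Dynamics of the planar system in the quarter disk -/

/-- The vector field `(X³ - X + a Y², Y (X² - a X))` of the planar system; `a = 1/√n`. -/
def planarField (a : ℝ) (p : ℝ × ℝ) : ℝ × ℝ :=
  (p.1 ^ 3 - p.1 + a * p.2 ^ 2, p.2 * (p.1 ^ 2 - a * p.1))

theorem contDiff_planarField (a : ℝ) : ContDiff ℝ ∞ (planarField a) := by
  unfold planarField
  fun_prop

theorem isSolutionOn_iff {n : ℕ} {I : Set ℝ} {γ : ℝ → ℝ × ℝ} :
    IsSolutionOn n I γ ↔ ∀ y ∈ I, HasDerivAt γ (planarField (1 / √(n : ℝ)) (γ y)) y := by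
  refine forall₂_congr fun y _ => ?_
  rw [planarField]
  ring_nf

/-- The function `1 - X² - Y²`, which vanishes on the unit circle. It is a Lyapunov function of the
planar system: its derivative along solutions is `2 X²` times itself. -/
def lyapunov (p : ℝ × ℝ) : ℝ := 1 - p.1 ^ 2 - p.2 ^ 2

theorem mem_openQuarterDisk_iff {p : ℝ × ℝ} :
    p ∈ openQuarterDisk ↔ 0 < p.1 ∧ 0 < p.2 ∧ 0 < lyapunov p := by
  refine and_congr_right fun _ => and_congr_right fun _ => ?_
  rw [lyapunov]
  constructor <;> intro h <;> linarith

theorem hasDerivAt_fst {γ : ℝ → ℝ × ℝ} {v : ℝ × ℝ} {y : ℝ} (h : HasDerivAt γ v y) :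
    HasDerivAt (fun y => (γ y).1) v.1 y := by
  simpa using h.hasFDerivAt.fst.hasDerivAt

theorem hasDerivAt_snd {γ : ℝ → ℝ × ℝ} {v : ℝ × ℝ} {y : ℝ} (h : HasDerivAt γ v y) :
    HasDerivAt (fun y => (γ y).2) v.2 y := by
  simpa using h.hasFDerivAt.snd.hasDerivAt

/-- The derivative of `1 - X² - Y²` along an integral curve of a multiple of the planar field. The
factor `c` accommodates both the cut-off field and the reparametrization by `x`, where `c = 1/W`. -/
theorem hasDerivAt_lyapunov_smul {a c : ℝ} {γ : ℝ → ℝ × ℝ} {y : ℝ}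
    (h : HasDerivAt γ (c • planarField a (γ y)) y) :
    HasDerivAt (fun y => lyapunov (γ y)) (c * (2 * (γ y).1 ^ 2) * lyapunov (γ y)) y := by
  refine ((((hasDerivAt_fst h).pow 2).const_sub 1).sub ((hasDerivAt_snd h).pow 2)).congr_deriv ?_
  simp only [planarField, lyapunov, Prod.smul_fst, Prod.smul_snd, smul_eq_mul]
  ring

/-- A smooth bump function that is `1` on the unit ball of `ℝ × ℝ`. This is the unit square of the
supremum norm, so that it contains the unit disk. -/
def cutoff : ContDiffBump (0 : ℝ × ℝ) := ⟨1, 2, one_pos, one_lt_two⟩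

/-- The planar field, cut off outside the unit square so as to be bounded and globally Lipschitz. -/
def cutoffField (a : ℝ) (p : ℝ × ℝ) : ℝ × ℝ := cutoff p • planarField a p

theorem exists_lipschitz_cutoffField (a : ℝ) : ∃ K C : NNReal, LipschitzWith K (cutoffField a) ∧
    ∀ p, ‖cutoffField a p‖ ≤ C := by
  have hs : HasCompactSupport (cutoffField a) := cutoff.hasCompactSupport.smul_right
  have hd : ContDiff ℝ ∞ (cutoffField a) := cutoff.contDiff.smul (contDiff_planarField a)
  obtain ⟨K, hK⟩ := hd.lipschitzWith_of_hasCompactSupport hs (by simp)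
  obtain ⟨C, hC⟩ := hs.exists_bound_of_continuous hd.continuous
  exact ⟨K, C.toNNReal, hK, fun p => (hC p).trans (Real.le_coe_toNNReal C)⟩

theorem cutoffField_eq {a : ℝ} {p : ℝ × ℝ} (hp : 0 < lyapunov p) :
    cutoffField a p = planarField a p := by
  have : p ∈ Metric.closedBall (0 : ℝ × ℝ) cutoff.rIn := by
    rw [mem_closedBall_zero_iff, Prod.norm_def]
    rw [lyapunov] at hp
    exact max_le ((sq_le_one_iff_abs_le_one _).1 (by nlinarith [sq_nonneg p.2]))
      ((sq_le_one_iff_abs_le_one _).1 (by nlinarith [sq_nonneg p.1]))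
  rw [cutoffField, cutoff.one_of_mem_closedBall this, one_smul]

/-- The open unit disk is invariant under the flow of the cut-off field. -/
theorem lyapunov_pos_of_cutoff {a : ℝ} {γ : ℝ → ℝ × ℝ}
    (h : ∀ y, HasDerivAt γ (cutoffField a (γ y)) y) (h0 : 0 < lyapunov (γ 0)) (y : ℝ) :
    0 < lyapunov (γ y) := by
  have hc : Continuous γ := continuous_iff_continuousAt.2 fun y => (h y).continuousAt
  refine pos_of_linear (a := fun y => cutoff (γ y) * (2 * (γ y).1 ^ 2)) ?_
    (fun y => hasDerivAt_lyapunov_smul (h y)) h0 y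
  exact (cutoff.continuous.comp hc).mul (by fun_prop)

/-- Through every point of the open unit disk passes a solution on `ℝ` that stays in the disk: the
cut-off field has a global solution, and it agrees with the planar field on the disk. -/
theorem exists_solution {a : ℝ} {p : ℝ × ℝ} (hp : 0 < lyapunov p) :
    ∃ γ : ℝ → ℝ × ℝ, γ 0 = p ∧ (∀ y, HasDerivAt γ (planarField a (γ y)) y) ∧
      ∀ y, 0 < lyapunov (γ y) := by
  obtain ⟨K, C, hK, hC⟩ := exists_lipschitz_cutoffField a
  obtain ⟨γ, h0, hγ⟩ := exists_global_solution hK hC p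
  have hL := lyapunov_pos_of_cutoff hγ (h0.symm ▸ hp)
  exact ⟨γ, h0, fun y => cutoffField_eq (hL y) ▸ hγ y, hL⟩

theorem solution_unique {a b : ℝ} {γ δ : ℝ → ℝ × ℝ}
    (hγ : ∀ y < b, HasDerivAt γ (planarField a (γ y)) y ∧ 0 < lyapunov (γ y))
    (hδ : ∀ y < b, HasDerivAt δ (planarField a (δ y)) y ∧ 0 < lyapunov (δ y))
    {y₀ : ℝ} (hy₀ : y₀ < b) (h0 : γ y₀ = δ y₀) {y : ℝ} (hy : y < b) : γ y = δ y := by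
  obtain ⟨K, C, hK, -⟩ := exists_lipschitz_cutoffField a
  refine ODE_solution_unique_of_mem_Ioo (v := fun _ => cutoffField a) (s := fun _ => univ)
    (a := min y y₀ - 1) (b := b) (t₀ := y₀) (fun _ _ => hK.lipschitzOnWith)
    ⟨by linarith [min_le_right y y₀], hy₀⟩
    (fun t ht => ⟨?_, trivial⟩) (fun t ht => ⟨?_, trivial⟩) h0 ⟨by linarith [min_le_left y y₀], hy⟩
  · rw [cutoffField_eq (hγ t ht.2).2]; exact (hγ t ht.2).1
  · rw [cutoffField_eq (hδ t ht.2).2]; exact (hδ t ht.2).1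

section Global

variable {a : ℝ} {γ : ℝ → ℝ × ℝ}

theorem continuous_of_solution (h : ∀ y, HasDerivAt γ (planarField a (γ y)) y) : Continuous γ :=
  continuous_iff_continuousAt.2 fun y => (h y).continuousAt

theorem hasDerivAt_lyapunov (h : ∀ y, HasDerivAt γ (planarField a (γ y)) y) (y : ℝ) :
    HasDerivAt (fun y => lyapunov (γ y)) (2 * (γ y).1 ^ 2 * lyapunov (γ y)) y := by
  simpa using hasDerivAt_lyapunov_smul (c := 1) (by simpa using h y)

theorem snd_pos_of_solution (h : ∀ y, HasDerivAt γ (planarField a (γ y)) y)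
    (h0 : 0 < (γ 0).2) (y : ℝ) : 0 < (γ y).2 := by
  have hc := continuous_of_solution h
  refine pos_of_linear (a := fun y => (γ y).1 ^ 2 - a * (γ y).1) (by fun_prop)
    (fun y => (hasDerivAt_snd (h y)).congr_deriv ?_) h0 y
  simp only [planarField]; ring

theorem fst_pos_of_solution (ha : 0 < a) (h : ∀ y, HasDerivAt γ (planarField a (γ y)) y)
    (h0 : 0 < (γ 0).1) {y : ℝ} (hy : 0 ≤ y) : 0 < (γ y).1 := by
  have hc := continuous_of_solution h
  refine pos_of_linear_of_nonneg (f := fun y => (γ y).1)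
    (a := fun y => (γ y).1 ^ 2 - 1) (b := fun y => a * (γ y).2 ^ 2) (by fun_prop)
    (fun y => (hasDerivAt_fst (h y)).congr_deriv ?_) (fun y => by positivity) h0 hy
  simp only [planarField]; ring

/-- A solution in the unit disk crosses the line `X = a` at most once, from right to left: since
`(X - a)' = (X² - 1) (X - a) - a (1 - X² - Y²)`, the line is a transversal. -/
theorem fst_sub_sign_of_solution (ha : 0 < a) (h : ∀ y, HasDerivAt γ (planarField a (γ y)) y)
    (hL : ∀ y, 0 < lyapunov (γ y)) (h0 : (γ 0).1 = a) :
    (∀ y < 0, a < (γ y).1) ∧ ∀ y > 0, (γ y).1 < a := by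
  have hc := continuous_of_solution h
  have := sign_of_linear_of_neg (f := fun y => (γ y).1 - a)
    (a := fun y => (γ y).1 ^ 2 - 1) (b := fun y => -(a * lyapunov (γ y))) (by fun_prop)
    (fun y => ((hasDerivAt_fst (h y)).sub_const a).congr_deriv (by
      simp only [planarField, lyapunov]; ring))
    (fun y => neg_neg_of_pos (mul_pos ha (hL y))) (by simp [h0])
  exact ⟨fun y hy => sub_pos.1 (this.1 y hy), fun y hy => sub_neg.1 (this.2 y hy)⟩

theorem mem_openQuarterDisk_of_solution (ha : 0 < a)
    (h : ∀ y, HasDerivAt γ (planarField a (γ y)) y)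
    (hL : ∀ y, 0 < lyapunov (γ y)) (h0 : (γ 0).1 = a) (h0' : 0 < (γ 0).2) (y : ℝ) :
    γ y ∈ openQuarterDisk := by
  refine mem_openQuarterDisk_iff.2 ⟨?_, snd_pos_of_solution h h0' y, hL y⟩
  rcases lt_or_ge y 0 with hy | hy
  · exact ha.trans ((fst_sub_sign_of_solution ha h hL h0).1 y hy)
  · exact fst_pos_of_solution ha h (h0.symm ▸ ha) hy

theorem fst_eq_sqrt {p : ℝ × ℝ} (hp : 0 ≤ p.1) : p.1 = √(1 - lyapunov p - p.2 ^ 2) := by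
  rw [lyapunov, show 1 - (1 - p.1 ^ 2 - p.2 ^ 2) - p.2 ^ 2 = p.1 ^ 2 by ring, Real.sqrt_sq hp]

/-- To the left of `X = a` both `1 - X² - Y²` and `Y` are monotone, so that `X` and `Y` converge;
their limit is an equilibrium in the open disk, that is, the origin. -/
theorem tendsto_atTop_of_solution (ha : 0 < a)
    (h : ∀ y, HasDerivAt γ (planarField a (γ y)) y) (hQ : ∀ y, γ y ∈ openQuarterDisk)
    (hlt : ∀ y > 0, (γ y).1 < a) : Tendsto γ atTop (𝓝 (0, 0)) := by
  have hQ' := fun y => mem_openQuarterDisk_iff.1 (hQ y)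
  have hLm : Monotone fun y => lyapunov (γ y) := monotone_of_deriv_nonneg
    (fun y => (hasDerivAt_lyapunov h y).differentiableAt) fun y => by
      rw [(hasDerivAt_lyapunov h y).deriv]
      have := (hQ' y).2.2
      positivity
  obtain ⟨l, -, hl0, hl⟩ := exists_tendsto_of_antitoneOn (f := fun y => -lyapunov (γ y)) (a := 0)
    (m := -1) (fun s _ t _ hst => neg_le_neg (hLm hst)) (fun t _ => by
      simp only [lyapunov]; nlinarith [sq_nonneg (γ t).1, sq_nonneg (γ t).2])
  have hc := continuous_of_solution h
  obtain ⟨m, hm0, -, hm⟩ := exists_tendsto_of_antitoneOn (f := fun y => (γ y).2) (a := 0)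
    (m := 0) (antitoneOn_of_deriv_nonpos (convex_Ici 0) (by fun_prop)
      (fun y _ => (hasDerivAt_snd (h y)).differentiableAt.differentiableWithinAt) (by
        intro y hy
        rw [interior_Ici] at hy
        rw [(hasDerivAt_snd (h y)).deriv]
        simp only [planarField]
        nlinarith [mul_pos (hQ' y).2.1 (hQ' y).1, hlt y hy]))
    (fun t _ => (hQ' t).2.1.le)
  have hX : Tendsto (fun y => (γ y).1) atTop (𝓝 (√(1 + l - m ^ 2))) := by
    refine (((hl.const_add 1).sub (hm.pow 2)).sqrt).congr fun y => ?_
    rw [← sub_eq_add_neg, ← fst_eq_sqrt (hQ' y).1.le]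
  have h1 := deriv_limit_eq_zero (fun y => (hasDerivAt_lyapunov h y).fun_neg) hl
    ((((hX.pow 2).const_mul 2).mul hl.neg).neg.congr fun y => by simp)
  have hl0' : l < 0 := by have := (hQ' 0).2.2; linarith
  have hX0 : √(1 + l - m ^ 2) = 0 := by
    have : √(1 + l - m ^ 2) ^ 2 * l = 0 := by linarith
    rcases mul_eq_zero.1 this with h | h
    · exact pow_eq_zero_iff two_ne_zero |>.1 h
    · exact absurd h hl0'.ne
  rw [hX0] at hX
  have h2 := deriv_limit_eq_zero (fun y => hasDerivAt_fst (h y)) hX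
    (((hX.pow 3).sub hX).add ((hm.pow 2).const_mul a))
  have hm0 : m = 0 := by
    simp at h2
    exact h2.resolve_left ha.ne'
  rw [hm0] at hm
  exact hX.prodMk_nhds hm

/-- Where `X ≥ c`, the function `1 - X² - Y²` grows at least like `exp (2 c² y)`. -/
theorem lyapunov_mul_exp_monotone (c : ℝ) (hc : 0 ≤ c) {s : Set ℝ} (hs : Convex ℝ s)
    (h : ∀ y, HasDerivAt γ (planarField a (γ y)) y) (hL : ∀ y, 0 < lyapunov (γ y))
    (hX : ∀ y ∈ s, c ≤ (γ y).1) :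
    MonotoneOn (fun y => lyapunov (γ y) * Real.exp (-(2 * c ^ 2) * y)) s := by
  have hd : ∀ y, HasDerivAt (fun y => lyapunov (γ y) * Real.exp (-(2 * c ^ 2) * y))
      (2 * ((γ y).1 ^ 2 - c ^ 2) * (lyapunov (γ y) * Real.exp (-(2 * c ^ 2) * y))) y := fun y => by
    refine ((hasDerivAt_lyapunov h y).mul
      (((hasDerivAt_id y).const_mul (-(2 * c ^ 2))).exp)).congr_deriv ?_
    simp only [id]; ring
  refine monotoneOn_of_deriv_nonneg hs (HasDerivAt.continuousOn fun y _ => hd y)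
    (fun y _ => (hd y).differentiableAt.differentiableWithinAt) fun y hy => ?_
  rw [(hd y).deriv]
  have h1 : 0 ≤ (γ y).1 ^ 2 - c ^ 2 :=
    sub_nonneg.2 (pow_le_pow_left₀ hc (hX y (interior_subset hy)) 2)
  have := hL y
  positivity

/-- To the right of `X = a`, backwards in time, `1 - X² - Y²` decays exponentially and `Y`
decreases; the limit is an equilibrium on the unit circle with `X > a` and `Y ≥ 0`, that is,
`(1, 0)`. -/
theorem tendsto_atBot_of_solution (ha : 0 < a)
    (h : ∀ y, HasDerivAt γ (planarField a (γ y)) y) (hQ : ∀ y, γ y ∈ openQuarterDisk)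
    (h0 : (γ 0).1 = a) (hlt : ∀ y < 0, a < (γ y).1) : Tendsto γ atBot (𝓝 (1, 0)) := by
  have hQ' := fun y => mem_openQuarterDisk_iff.1 (hQ y)
  have hle : ∀ y ≤ 0, a ≤ (γ y).1 := fun y hy => hy.eq_or_lt.elim (fun h => by rw [h, h0])
    fun h => (hlt y h).le
  have hc := continuous_of_solution h
  have hl : Tendsto (fun y => lyapunov (γ y)) atBot (𝓝 0) := by
    have hm := lyapunov_mul_exp_monotone a ha.le (convex_Iic 0) h (fun y => (hQ' y).2.2) hle
    have hexp : Tendsto (fun y => lyapunov (γ 0) * Real.exp (2 * a ^ 2 * y)) atBot (𝓝 0) := by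
      have : Tendsto (fun y : ℝ => 2 * a ^ 2 * y) atBot atBot :=
        tendsto_id.const_mul_atBot (by positivity)
      simpa using (Real.tendsto_exp_atBot.comp this).const_mul (lyapunov (γ 0))
    refine tendsto_of_tendsto_of_tendsto_of_le_of_le' tendsto_const_nhds hexp
      (Eventually.of_forall fun y => (hQ' y).2.2.le) ?_
    filter_upwards [eventually_le_atBot 0] with y hy
    have := hm (mem_Iic.2 hy) (mem_Iic.2 le_rfl) hy
    simp only [mul_zero, Real.exp_zero, mul_one] at this
    calc lyapunov (γ y)
        = lyapunov (γ y) * Real.exp (-(2 * a ^ 2) * y) * Real.exp (2 * a ^ 2 * y) := by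
          rw [mul_assoc, ← Real.exp_add]; simp
      _ ≤ _ := by gcongr
  obtain ⟨m, hm0, hmle, hm'⟩ := exists_tendsto_of_antitoneOn (f := fun y => (γ (-y)).2) (a := 0)
    (m := 0) (by
      have hmono : MonotoneOn (fun y => (γ y).2) (Iic 0) :=
        monotoneOn_of_deriv_nonneg (convex_Iic 0) (by fun_prop)
        (fun y _ => (hasDerivAt_snd (h y)).differentiableAt.differentiableWithinAt) (by
          intro y hy
          rw [interior_Iic] at hy
          rw [(hasDerivAt_snd (h y)).deriv]
          simp only [planarField]
          nlinarith [mul_pos (hQ' y).2.1 (hQ' y).1, hlt y hy])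
      intro s hs t ht hst
      exact hmono (by simpa using ht) (by simpa using hs) (neg_le_neg hst))
    (fun t _ => (hQ' _).2.1.le)
  have hm : Tendsto (fun y => (γ y).2) atBot (𝓝 m) := by
    simpa [Function.comp_def] using hm'.comp tendsto_neg_atBot_atTop
  have hX : Tendsto (fun y => (γ y).1) atBot (𝓝 (√(1 - 0 - m ^ 2))) := by
    refine (((hl.const_sub 1).sub (hm.pow 2)).sqrt).congr fun y => ?_
    rw [← fst_eq_sqrt (hQ' y).1.le]
  rw [sub_zero] at hX
  have h2 := deriv_limit_eq_zero_atBot (fun y => hasDerivAt_snd (h y)) hm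
    (hm.mul ((hX.pow 2).sub (hX.const_mul a)))
  have hgt : a < √(1 - m ^ 2) := by
    have h3 := (hQ' 0).2.2
    simp only [neg_zero] at hmle
    rw [lyapunov, h0] at h3
    refine Real.lt_sqrt_of_sq_lt ?_
    have : m ^ 2 ≤ (γ 0).2 ^ 2 := pow_le_pow_left₀ hm0 hmle 2
    linarith
  have hm0 : m = 0 := by
    rcases mul_eq_zero.1 h2 with h | h
    · exact h
    · nlinarith
  rw [hm0] at hm hX
  exact (by simpa using hX : Tendsto (fun y => (γ y).1) atBot (𝓝 1)).prodMk_nhds hm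

/-- A solution emanating from `(1, 0)` inside the disk meets the line `X = a`: otherwise it stays to
the right of it, and `1 - X² - Y²` would grow exponentially beyond `1`. -/
theorem exists_crossing (ha : 0 < a) (ha1 : a < 1)
    (h : ∀ y, HasDerivAt γ (planarField a (γ y)) y) (hL : ∀ y, 0 < lyapunov (γ y))
    (hlim : Tendsto γ atBot (𝓝 (1, 0))) : ∃ y, (γ y).1 = a := by
  have hc := continuous_of_solution h
  by_contra! hne
  have hgt : ∀ y, a ≤ (γ y).1 := by
    intro y
    by_contra! hlt
    have hX : Tendsto (fun y => (γ y).1) atBot (𝓝 1) := (continuous_fst.tendsto _).comp hlim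
    obtain ⟨y', hy'⟩ := (hX.eventually (lt_mem_nhds ha1)).exists
    obtain ⟨t, ht⟩ := mem_range_of_exists_le_of_exists_ge (f := fun y => (γ y).1) (by fun_prop)
      ⟨y, hlt.le⟩ ⟨y', hy'.le⟩
    exact hne t ht
  have hm := lyapunov_mul_exp_monotone a ha.le convex_univ h hL (fun y _ => hgt y)
  set L0 := lyapunov (γ 0) with hL0
  have hL0' : 0 < L0 := hL 0
  -- at this time the exponential lower bound exceeds `L0 * (1 + 1 / L0) > 1`
  set y := 1 / (L0 * (2 * a ^ 2)) with hy
  have hy0 : 0 < y := by positivity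
  have h1 := hm (mem_univ 0) (mem_univ y) hy0.le
  simp only [mul_zero, Real.exp_zero, mul_one, ← hL0] at h1
  have h2 : L0 * Real.exp (2 * a ^ 2 * y) ≤ lyapunov (γ y) := by
    calc L0 * Real.exp (2 * a ^ 2 * y)
        ≤ lyapunov (γ y) * Real.exp (-(2 * a ^ 2) * y) * Real.exp (2 * a ^ 2 * y) := by gcongr
      _ = lyapunov (γ y) := by rw [mul_assoc, ← Real.exp_add]; simp
  have h3 := Real.add_one_le_exp (2 * a ^ 2 * y)
  have h4 : 2 * a ^ 2 * y = 1 / L0 := by rw [hy]; field_simp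
  have h5 : lyapunov (γ y) ≤ 1 := by
    simp only [lyapunov]; nlinarith [sq_nonneg (γ y).1, sq_nonneg (γ y).2]
  rw [h4] at h3 h2
  have h6 : L0 * (1 / L0 + 1) ≤ 1 := (mul_le_mul_of_nonneg_left h3 hL0'.le).trans (h2.trans h5)
  rw [mul_add, mul_one_div_cancel hL0'.ne'] at h6
  linarith

end Global

/-! ### The family of trajectories emanating from `(1, 0)` -/

/-- A solution in the quarter disk on `(-∞, b)` extends to `ℝ` within the quarter disk. -/
theorem exists_extension {a b : ℝ} {γ : ℝ → ℝ × ℝ} (ha : 0 < a)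
    (h : ∀ y < b, HasDerivAt γ (planarField a (γ y)) y) (hQ : ∀ y < b, γ y ∈ openQuarterDisk) :
    ∃ δ : ℝ → ℝ × ℝ, (∀ y < b, δ y = γ y) ∧ (∀ y, HasDerivAt δ (planarField a (δ y)) y) ∧
      ∀ y, δ y ∈ openQuarterDisk := by
  have hQ' := fun y hy => mem_openQuarterDisk_iff.1 (hQ y hy)
  have hb : b - 1 < b := by linarith
  obtain ⟨η, h0, hη, hL⟩ := exists_solution (a := a) (hQ' (b - 1) hb).2.2
  have hd : ∀ y, HasDerivAt (fun y => η (y - (b - 1))) (planarField a (η (y - (b - 1)))) y :=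
    fun y => (hη _).comp_sub_const y (b - 1)
  have heq : ∀ y < b, η (y - (b - 1)) = γ y := fun y hy =>
    solution_unique (a := a) (fun y _ => ⟨hd y, hL _⟩) (fun y hy => ⟨h y hy, (hQ' y hy).2.2⟩) hb
      (by simp [h0]) hy
  refine ⟨_, heq, hd, fun y => ?_⟩
  rcases lt_or_ge y b with hy | hy
  · rw [heq y hy]; exact hQ y hy
  · refine mem_openQuarterDisk_iff.2 ⟨?_, snd_pos_of_solution hη ?_ _, hL _⟩
    · refine fst_pos_of_solution ha hη ?_ (by linarith)
      rw [h0]; exact (hQ' _ hb).1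
    · rw [h0]; exact (hQ' _ hb).2.1

/-- A parametrization by `s ∈ ℝ` of the heights `Y ∈ (0, √(1 - a²))` at which the line `X = a`
crosses the quarter disk. -/
def crossingHeight (a s : ℝ) : ℝ := √(1 - a ^ 2) * Real.sigmoid s

/-- The solutions starting at the points of the transversal `X = a`, with joint continuity in the
point and in time. -/
theorem exists_transversal_flow {a : ℝ} (ha : 0 < a) (ha1 : a < 1) :
    ∃ Γ : ℝ → ℝ → ℝ × ℝ, Continuous (fun p : ℝ × ℝ => Γ p.1 p.2) ∧
      ∀ s, Γ s 0 = (a, crossingHeight a s) ∧ (∀ y, HasDerivAt (Γ s) (planarField a (Γ s y)) y) ∧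
        ∀ y, 0 < lyapunov (Γ s y) := by
  have ha2 : 0 < 1 - a ^ 2 := by nlinarith
  have hex : ∀ s, 0 < lyapunov (a, crossingHeight a s) := by
    intro s
    have h1 : crossingHeight a s ^ 2 = (1 - a ^ 2) * Real.sigmoid s ^ 2 := by
      rw [crossingHeight, mul_pow, Real.sq_sqrt ha2.le]
    have h2 : Real.sigmoid s ^ 2 < 1 :=
      pow_lt_one₀ (Real.sigmoid_nonneg s) (Real.sigmoid_lt_one s) two_ne_zero
    simp only [lyapunov, h1]
    nlinarith
  choose Γ h0 hΓ hL using fun s => exists_solution (a := a) (hex s)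
  refine ⟨Γ, ?_, fun s => ⟨h0 s, hΓ s, hL s⟩⟩
  obtain ⟨K, C, hK, -⟩ := exists_lipschitz_cutoffField a
  have hcut : ∀ s y, HasDerivAt (Γ s) (cutoffField a (Γ s y)) y := fun s y => by
    rw [cutoffField_eq (hL s y)]; exact hΓ s y
  have hv : Continuous fun s => Γ s 0 := by
    simp only [h0, crossingHeight]
    have := continuous_sigmoid
    fun_prop
  rw [continuous_iff_continuousAt]
  rintro ⟨s₀, y₀⟩
  rw [ContinuousAt, tendsto_iff_dist_tendsto_zero]
  have hc0 : Continuous (Γ s₀) := continuous_of_solution (hΓ s₀)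
  have hlim : Tendsto (fun p : ℝ × ℝ => dist (Γ p.1 0) (Γ s₀ 0) * Real.exp (K * |p.2|) +
      dist (Γ s₀ p.2) (Γ s₀ y₀)) (𝓝 (s₀, y₀)) (𝓝 0) := by
    have : Continuous (fun p : ℝ × ℝ => dist (Γ p.1 0) (Γ s₀ 0) * Real.exp (K * |p.2|) +
      dist (Γ s₀ p.2) (Γ s₀ y₀)) :=
      (((hv.comp continuous_fst).dist continuous_const).mul (by fun_prop)).add
        ((hc0.comp continuous_snd).dist continuous_const)
    simpa using this.tendsto (s₀, y₀)
  refine squeeze_zero (fun _ => dist_nonneg) (fun p => ?_) hlim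
  exact (dist_triangle _ (Γ s₀ p.2) _).trans
    (add_le_add_left (dist_solution_le hK (hcut p.1) (hcut s₀) p.2) _)

/-- The trajectories emanating from `(1, 0)`, parametrized by their unique point on the transversal
`X = 1/√n`. -/
theorem exists_singular_family {n : ℕ} (hn : 2 ≤ n) :
    ∃ Γ : ℝ → ℝ → ℝ × ℝ, Continuous (fun p : ℝ × ℝ => Γ p.1 p.2) ∧
      (∀ s, IsSingularTrajectory n univ (Γ s)) ∧
      (∀ s, Tendsto (Γ s) atTop (𝓝 (0, 0))) ∧
      (∀ s s' y, Γ s 0 = Γ s' y → s = s') ∧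
      ∀ (b : ℝ) (γ : ℝ → ℝ × ℝ), IsSingularTrajectory n (Iio b) γ →
        ∃! p : ℝ × ℝ, ∀ y < b, γ y = Γ p.1 (y + p.2) := by
  set a : ℝ := 1 / √(n : ℝ) with ha_def
  have hn' : (1 : ℝ) < n := by exact_mod_cast hn
  have hsq : 1 < √(n : ℝ) := Real.lt_sqrt_of_sq_lt (by simpa using hn')
  have ha : 0 < a := by positivity
  have ha1 : a < 1 := by rw [ha_def, div_lt_one (by positivity)]; exact hsq
  have ha2 : 0 < 1 - a ^ 2 := by nlinarith
  obtain ⟨Γ, hcont, hΓ⟩ := exists_transversal_flow ha ha1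
  have hpos : ∀ s, 0 < crossingHeight a s := fun s =>
    mul_pos (Real.sqrt_pos.2 ha2) (Real.sigmoid_pos s)
  have hinj : ∀ s s', crossingHeight a s = crossingHeight a s' → s = s' := fun s s' h =>
    Real.sigmoid_injective (mul_left_cancel₀ (Real.sqrt_pos.2 ha2).ne' h)
  have hfst : ∀ s, (Γ s 0).1 = a := fun s => by rw [(hΓ s).1]
  have hsnd : ∀ s, (Γ s 0).2 = crossingHeight a s := fun s => by rw [(hΓ s).1]
  have hsign := fun s => fst_sub_sign_of_solution ha (hΓ s).2.1 (hΓ s).2.2 (hfst s)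
  have hQ : ∀ s y, Γ s y ∈ openQuarterDisk := fun s y =>
    mem_openQuarterDisk_of_solution ha (hΓ s).2.1 (hΓ s).2.2 (hfst s) (by rw [hsnd]; exact hpos s) y
  have hcross : ∀ s y, (Γ s y).1 = a → y = 0 := by
    intro s y hy
    rcases lt_trichotomy y 0 with h | h | h
    · exact absurd hy ((hsign s).1 y h).ne'
    · exact h
    · exact absurd hy ((hsign s).2 y h).ne
  have heq : ∀ s s' y, Γ s 0 = Γ s' y → s = s' ∧ y = 0 := by
    intro s s' y h
    have h0 : y = 0 := hcross s' y (by rw [← h, hfst])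
    rw [h0] at h
    exact ⟨hinj _ _ (by rw [← hsnd, ← hsnd, h]), h0⟩
  refine ⟨Γ, hcont, fun s => ⟨isSolutionOn_iff.2 fun y _ => (hΓ s).2.1 y,
    tendsto_atBot_of_solution ha (hΓ s).2.1 (hQ s) (hfst s) (hsign s).1, fun y _ => hQ s y⟩,
    fun s => tendsto_atTop_of_solution ha (hΓ s).2.1 (hQ s) (hsign s).2,
    fun s s' y h => (heq s s' y h).1, fun b γ hγ => ?_⟩
  have hsol := isSolutionOn_iff.1 hγ.solution
  obtain ⟨δ, hδγ, hδ, hδQ⟩ := exists_extension ha hsol hγ.mem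
  have hδL := fun y => (mem_openQuarterDisk_iff.1 (hδQ y)).2.2
  have hδlim : Tendsto δ atBot (𝓝 (1, 0)) := hγ.emanates.congr' (by
    filter_upwards [eventually_lt_atBot b] with y hy using (hδγ y hy).symm)
  obtain ⟨y₁, hy₁⟩ := exists_crossing ha ha1 hδ hδL hδlim
  have hshift : ∀ s c y, HasDerivAt (fun y => Γ s (y + c)) (planarField a (Γ s (y + c))) y :=
    fun s c y => ((hΓ s).2.1 _).comp_add_const y c
  -- solutions through a common point agree everywhere
  have huniq : ∀ s c y₀, δ y₀ = Γ s (y₀ + c) → ∀ y, δ y = Γ s (y + c) := fun s c y₀ h y =>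
    solution_unique (b := max y y₀ + 1) (fun y _ => ⟨hδ y, hδL y⟩)
      (fun y _ => ⟨hshift s c y, (hΓ s).2.2 _⟩) (by linarith [le_max_right y y₀]) h
      (by linarith [le_max_left y y₀])
  obtain ⟨s, hs⟩ : ∃ s, crossingHeight a s = (δ y₁).2 := by
    have hL := hδL y₁
    rw [lyapunov, hy₁] at hL
    have h2 : (δ y₁).2 / √(1 - a ^ 2) ∈ range Real.sigmoid := by
      rw [Real.range_sigmoid]
      refine ⟨div_pos (hδQ y₁).2.1 (Real.sqrt_pos.2 ha2), ?_⟩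
      rw [div_lt_one (Real.sqrt_pos.2 ha2)]
      exact Real.lt_sqrt_of_sq_lt (by linarith)
    obtain ⟨s, hs⟩ := h2
    refine ⟨s, ?_⟩
    rw [crossingHeight, hs, mul_div_cancel₀ _ (Real.sqrt_pos.2 ha2).ne']
  have hδs : ∀ y, δ y = Γ s (y + -y₁) := huniq s (-y₁) y₁ (by
    rw [add_neg_cancel, (hΓ s).1, hs, ← hy₁])
  refine ⟨(s, -y₁), fun y hy => by rw [← hδγ y hy, hδs], ?_⟩
  rintro ⟨s', c⟩ h
  have hδs' : ∀ y, δ y = Γ s' (y + c) := huniq s' c (b - 1) (by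
    rw [hδγ _ (by linarith)]; exact h _ (by linarith))
  have h1 : Γ s 0 = Γ s' (y₁ + c) := by rw [← hδs', hδs, add_neg_cancel]
  obtain ⟨h2, h3⟩ := heq s s' _ h1
  rw [Prod.mk.injEq]
  exact ⟨h2.symm, by linarith⟩

/-! ### Asymptotic lemmas and the phase variables of a soliton -/

/-- If `f' = -A f + B` with `A → A₀ > 0` and `B → B₀`, then `f → B₀ / A₀`. -/
theorem tendsto_of_relaxation {f A B : ℝ → ℝ} {A₀ B₀ : ℝ} (hA₀ : 0 < A₀)
    (hf : ∀ᶠ t in atTop, HasDerivAt f (-(A t) * f t + B t) t)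
    (hA : Tendsto A atTop (𝓝 A₀)) (hB : Tendsto B atTop (𝓝 B₀)) :
    Tendsto f atTop (𝓝 (B₀ / A₀)) := by
  have he : Tendsto (fun t => B t - A t * (B₀ / A₀)) atTop (𝓝 0) := by
    have := hB.sub (hA.mul_const (B₀ / A₀))
    rwa [mul_div_cancel₀ _ hA₀.ne', sub_self] at this
  suffices hsq : Tendsto (fun t => (f t - B₀ / A₀) ^ 2) atTop (𝓝 0) by
    have h1 : Tendsto (fun t => |f t - B₀ / A₀|) atTop (𝓝 0) := by
      simpa [Real.sqrt_sq_eq_abs] using hsq.sqrt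
    have h2 := (tendsto_zero_iff_abs_tendsto_zero _).2 h1
    simpa using h2.add_const (B₀ / A₀)
  set k := A₀ / 2 with hk
  have hk0 : 0 < k := by positivity
  rw [tendsto_order]
  refine ⟨fun b hb => Eventually.of_forall fun t => hb.trans_le (sq_nonneg _), fun b hb => ?_⟩
  -- `η` absorbs the error term `(B - A * (B₀ / A₀)) ^ 2 / k ^ 2`
  set η := b / 2 with hη
  have hη0 : 0 < η := by positivity
  have hev : ∀ᶠ t in atTop, HasDerivAt f (-(A t) * f t + B t) t ∧ k < A t ∧
      (B t - A t * (B₀ / A₀)) ^ 2 < k ^ 2 * η := by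
    have he2 : Tendsto (fun t => (B t - A t * (B₀ / A₀)) ^ 2) atTop (𝓝 0) := by
      simpa using he.pow 2
    filter_upwards [hf, hA.eventually (lt_mem_nhds (half_lt_self hA₀)),
      he2.eventually (gt_mem_nhds (by positivity : 0 < k ^ 2 * η))] with t h1 h2 h3
      using ⟨h1, h2, h3⟩
  obtain ⟨t₀, ht₀⟩ := eventually_atTop.1 hev
  -- the square `h` of the deviation satisfies `h' ≤ -k (h - η)`
  have hd : ∀ t, t₀ ≤ t → HasDerivAt (fun t => ((f t - B₀ / A₀) ^ 2 - η) * Real.exp (k * t))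
      ((2 * (f t - B₀ / A₀) * (-(A t) * f t + B t) + k * ((f t - B₀ / A₀) ^ 2 - η)) *
        Real.exp (k * t)) t := fun t ht => by
    refine (((((ht₀ t ht).1.sub_const _).pow 2).sub_const η).mul
      (((hasDerivAt_id t).const_mul k).exp)).congr_deriv ?_
    simp only [id, Pi.pow_apply]; ring
  have hanti : AntitoneOn (fun t => ((f t - B₀ / A₀) ^ 2 - η) * Real.exp (k * t)) (Ici t₀) := by
    refine antitoneOn_of_deriv_nonpos (convex_Ici _) (HasDerivAt.continuousOn fun t ht => hd t ht)
      (fun t ht => (hd t (interior_subset ht)).differentiableAt.differentiableWithinAt)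
      fun t ht => ?_
    have ht' : t₀ ≤ t := interior_subset ht
    rw [(hd t ht').deriv]
    refine mul_nonpos_of_nonpos_of_nonneg ?_ (Real.exp_pos _).le
    obtain ⟨-, h2, h3⟩ := ht₀ t ht'
    set g := f t - B₀ / A₀ with hg
    set e := B t - A t * (B₀ / A₀) with he
    have h4 : -(A t) * f t + B t = -(A t) * g + e := by rw [hg, he]; ring
    rw [h4]
    have h5 : 2 * g * e * k ≤ k ^ 2 * g ^ 2 + e ^ 2 := by nlinarith [sq_nonneg (k * g - e)]
    have h6 : 0 ≤ (A t - k) * g ^ 2 := mul_nonneg (by linarith) (sq_nonneg g)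
    have h7 : (2 * g * (-(A t) * g + e) + k * (g ^ 2 - η)) * k ≤ 0 := by nlinarith
    exact nonpos_of_mul_nonpos_left h7 hk0
  have hlim : Tendsto (fun t => |(f t₀ - B₀ / A₀) ^ 2 - η| * Real.exp (k * t₀) *
      Real.exp (-(k * t))) atTop (𝓝 0) := by
    have : Tendsto (fun t : ℝ => k * t) atTop atTop := tendsto_id.const_mul_atTop hk0
    simpa using (Real.tendsto_exp_neg_atTop_nhds_zero.comp this).const_mul
      (|(f t₀ - B₀ / A₀) ^ 2 - η| * Real.exp (k * t₀))
  filter_upwards [hlim.eventually (gt_mem_nhds hη0), eventually_ge_atTop t₀] with t h1 h2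
  have h3 := hanti self_mem_Ici h2 h2
  simp only at h3
  have h4 : (f t - B₀ / A₀) ^ 2 - η ≤ |(f t₀ - B₀ / A₀) ^ 2 - η| * Real.exp (k * t₀) *
      Real.exp (-(k * t)) := by
    calc (f t - B₀ / A₀) ^ 2 - η
        = ((f t - B₀ / A₀) ^ 2 - η) * Real.exp (k * t) * Real.exp (-(k * t)) := by
          rw [mul_assoc, ← Real.exp_add]; simp
      _ ≤ ((f t₀ - B₀ / A₀) ^ 2 - η) * Real.exp (k * t₀) * Real.exp (-(k * t)) := by gcongr
      _ ≤ _ := by gcongr; exact le_abs_self _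
  linarith

/-- If `f' → c` at `+∞`, then `f t / t → c`. -/
theorem tendsto_div_of_deriv {f f' : ℝ → ℝ} {c : ℝ}
    (hf : ∀ᶠ t in atTop, HasDerivAt f (f' t) t) (hc : Tendsto f' atTop (𝓝 c)) :
    Tendsto (fun t => f t / t) atTop (𝓝 c) := by
  rw [Metric.tendsto_atTop']
  intro ε hε
  have hev : ∀ᶠ t in atTop, HasDerivAt f (f' t) t ∧ dist (f' t) c < ε / 2 :=
    hf.and (hc.eventually (Metric.ball_mem_nhds c (half_pos hε)))
  obtain ⟨t₀, ht₀⟩ := eventually_atTop.1 hev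
  have hlim : Tendsto (fun t => (|f t₀ - c * t₀| + ε / 2 * |t₀|) / t) atTop (𝓝 0) :=
    tendsto_const_nhds.div_atTop tendsto_id
  obtain ⟨t₁, ht₁⟩ := eventually_atTop.1 (hlim.eventually (gt_mem_nhds (half_pos hε)))
  -- mean value inequality on `[t₀, t]`; the initial data are negligible against `t` beyond `t₁`
  refine ⟨max (max t₀ t₁) 0, fun t ht => ?_⟩
  have htt0 : t₀ < t := (le_max_left _ _).trans_lt ((le_max_left _ _).trans_lt ht)
  have htt1 : t₁ < t := (le_max_right _ _).trans_lt ((le_max_left _ _).trans_lt ht)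
  have ht0 : 0 < t := (le_max_right _ _).trans_lt ht
  have hbound := Convex.norm_image_sub_le_of_norm_hasDerivWithin_le (f := fun t => f t - c * t)
    (f' := fun t => f' t - c) (s := Ici t₀) (C := ε / 2) (x := t₀) (y := t)
    (fun u hu => (((ht₀ u hu).1.sub ((hasDerivAt_id u).const_mul c)).congr_deriv
      (by simp)).hasDerivWithinAt)
    (fun u hu => (ht₀ u hu).2.le) (convex_Ici _) self_mem_Ici htt0.le
  have h1 := ht₁ t htt1.le
  rw [Real.norm_eq_abs, Real.norm_eq_abs, abs_of_pos (sub_pos.2 htt0)] at hbound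
  rw [div_lt_iff₀ ht0] at h1
  rw [Real.dist_eq, div_sub' ht0.ne', abs_div, abs_of_pos ht0, div_lt_iff₀ ht0]
  calc |f t - t * c| = |(f t - c * t - (f t₀ - c * t₀)) + (f t₀ - c * t₀)| := by ring_nf
    _ ≤ ε / 2 * (t - t₀) + |f t₀ - c * t₀| := (abs_add_le _ _).trans (by gcongr)
    _ < ε * t := by nlinarith [neg_abs_le t₀]

section Phase

variable {n : ℕ} {ψ φ : ℝ → ℝ}

theorem hasDerivAt_of_contDiffOn_Ioi {f : ℝ → ℝ} (hf : ContDiffOn ℝ ∞ f (Ioi 0)) {x : ℝ}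
    (hx : 0 < x) : HasDerivAt f (deriv f x) x :=
  ((hf.differentiableOn (by simp)).differentiableAt (Ioi_mem_nhds hx)).hasDerivAt

theorem contDiffOn_deriv_Ioi {f : ℝ → ℝ} (hf : ContDiffOn ℝ ∞ f (Ioi 0)) :
    ContDiffOn ℝ ∞ (deriv f) (Ioi 0) := hf.deriv_of_isOpen isOpen_Ioi (by simp)

theorem SolitonODE.hasDerivAt_phaseW (h : SolitonODE n ψ φ) {x : ℝ} (hx : 0 < x)
    (hW : phaseW n ψ φ x ≠ 0) : HasDerivAt (phaseW n ψ φ) (phaseX n ψ φ x ^ 2) x := by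
  have hψ := hasDerivAt_of_contDiffOn_Ioi h.smooth_metric hx
  have hψ1 := hasDerivAt_of_contDiffOn_Ioi (contDiffOn_deriv_Ioi h.smooth_metric) hx
  have hφ1 := hasDerivAt_of_contDiffOn_Ioi (contDiffOn_deriv_Ioi h.smooth_potential) hx
  have hp := (h.pos x hx).ne'
  have hd : -deriv φ x + n * (deriv ψ x / ψ x) ≠ 0 := fun h0 => hW (by simp [phaseW, h0])
  refine ((hasDerivAt_const x (1 : ℝ)).div (hφ1.fun_neg.add ((hψ1.div hψ hp).const_mul (n : ℝ)))
    hd).congr_deriv ?_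
  have hsq : √(n : ℝ) ^ 2 = n := Real.sq_sqrt n.cast_nonneg
  simp only [phaseX, phaseW, mul_pow, hsq, h.radial x hx, Pi.div_apply, Pi.add_apply]
  set d := -deriv φ x + n * (deriv ψ x / ψ x) with hd_def
  field_simp
  ring

theorem SolitonODE.hasDerivAt_phaseX (hn : 1 ≤ n) (h : SolitonODE n ψ φ) {x : ℝ} (hx : 0 < x)
    (hW : phaseW n ψ φ x ≠ 0) : HasDerivAt (phaseX n ψ φ)
      ((phaseX n ψ φ x ^ 3 - phaseX n ψ φ x + 1 / √(n : ℝ) * phaseY n ψ φ x ^ 2) /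
        phaseW n ψ φ x) x := by
  have hψ := hasDerivAt_of_contDiffOn_Ioi h.smooth_metric hx
  have hψ1 := hasDerivAt_of_contDiffOn_Ioi (contDiffOn_deriv_Ioi h.smooth_metric) hx
  have hp := (h.pos x hx).ne'
  have hn1 : (1 : ℝ) ≤ n := by exact_mod_cast hn
  have hnn : (0 : ℝ) ≤ n * (n - 1) := mul_nonneg n.cast_nonneg (by linarith)
  refine (((h.hasDerivAt_phaseW hx hW).const_mul (√(n : ℝ))).mul (hψ1.div hψ hp)).congr_deriv ?_
  have hd : -deriv φ x + n * (deriv ψ x / ψ x) = 1 / phaseW n ψ φ x := by simp [phaseW]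
  have hs := h.spherical x hx
  have hφ : deriv φ x = n * (deriv ψ x / ψ x) - 1 / phaseW n ψ φ x := by linarith
  have hψ2 : deriv (deriv ψ) x = ((n - 1) * (1 - deriv ψ x ^ 2) +
      ψ x * deriv ψ x * (n * (deriv ψ x / ψ x) - 1 / phaseW n ψ φ x)) / ψ x := by
    rw [eq_div_iff hp, ← hφ, ← hs]; ring
  simp only [phaseX, phaseY, Pi.div_apply, hψ2, div_pow, mul_pow, Real.sq_sqrt hnn]
  set s := √(n : ℝ) with hs_def
  have hs0 : s ≠ 0 := (Real.sqrt_pos.2 (by linarith)).ne'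
  have hsn : (n : ℝ) = s ^ 2 := (Real.sq_sqrt n.cast_nonneg).symm
  rw [hsn]
  field_simp
  ring

theorem SolitonODE.hasDerivAt_phaseY (hn : 1 ≤ n) (h : SolitonODE n ψ φ) {x : ℝ} (hx : 0 < x)
    (hW : phaseW n ψ φ x ≠ 0) : HasDerivAt (phaseY n ψ φ)
      (phaseY n ψ φ x * (phaseX n ψ φ x ^ 2 - 1 / √(n : ℝ) * phaseX n ψ φ x) /
        phaseW n ψ φ x) x := by
  have hψ := hasDerivAt_of_contDiffOn_Ioi h.smooth_metric hx
  have hp := (h.pos x hx).ne'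
  have hn1 : (1 : ℝ) ≤ n := by exact_mod_cast hn
  have hs0 : √(n : ℝ) ≠ 0 := (Real.sqrt_pos.2 (by linarith)).ne'
  refine (((h.hasDerivAt_phaseW hx hW).const_mul (√((n : ℝ) * ((n : ℝ) - 1)))).div hψ
    hp).congr_deriv ?_
  simp only [phaseX, phaseY]
  field_simp

/-- `1 - X² - Y²` is a constant multiple of `W²` along a soliton, since `W' = X²` in terms of `x`.
-/
theorem SolitonODE.exists_lyapunov_eq (hn : 1 ≤ n) (h : SolitonODE n ψ φ)
    (hW : ∀ x, 0 < x → 0 < phaseW n ψ φ x) :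
    ∃ C, ∀ x, 0 < x → lyapunov (phaseX n ψ φ x, phaseY n ψ φ x) = C * phaseW n ψ φ x ^ 2 := by
  have hd : ∀ x ∈ Ioi (0 : ℝ), HasDerivAt (fun x => lyapunov (phaseX n ψ φ x, phaseY n ψ φ x) /
      phaseW n ψ φ x ^ 2) 0 x := by
    intro x hx
    have hWx := (hW x hx).ne'
    have h1 := hasDerivAt_lyapunov_smul (a := 1 / √(n : ℝ)) (c := 1 / phaseW n ψ φ x)
      (((h.hasDerivAt_phaseX hn hx hWx).prodMk (h.hasDerivAt_phaseY hn hx hWx)).congr_deriv (by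
        ext <;> simp [planarField] <;> ring))
    refine (h1.div ((h.hasDerivAt_phaseW hx hWx).pow 2) (pow_ne_zero 2 hWx)).congr_deriv ?_
    rw [div_eq_zero_iff]
    left
    simp only [Pi.pow_apply]
    field_simp
    ring
  obtain ⟨C, hC⟩ := isOpen_Ioi.exists_is_const_of_deriv_eq_zero isPreconnected_Ioi
    (fun x hx => (hd x hx).differentiableAt.differentiableWithinAt) (fun x hx => (hd x hx).deriv)
  exact ⟨C, fun x hx => by rw [← hC x hx, div_mul_cancel₀ _ (pow_ne_zero 2 (hW x hx).ne')]⟩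

end Phase

/-! ### Asymptotics of solitons whose phase curve tends to the origin -/

section Asymptotics

variable {n : ℕ} {ψ φ : ℝ → ℝ}

theorem kappa_pos (hn : 2 ≤ n) : 0 < √((n : ℝ) * ((n : ℝ) - 1)) := by
  have : (2 : ℝ) ≤ n := by exact_mod_cast hn
  exact Real.sqrt_pos.2 (mul_pos (by linarith) (by linarith))

theorem sqrt_dim_pos (hn : 2 ≤ n) : 0 < √(n : ℝ) :=
  Real.sqrt_pos.2 (by exact_mod_cast (by omega : 0 < n))

theorem SolitonODE.phaseY_pos (hn : 2 ≤ n) (h : SolitonODE n ψ φ) {x : ℝ} (hx : 0 < x)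
    (hW : 0 < phaseW n ψ φ x) : 0 < phaseY n ψ φ x :=
  div_pos (mul_pos (kappa_pos hn) hW) (h.pos x hx)

theorem SolitonODE.eq_of_phase (hn : 2 ≤ n) (h : SolitonODE n ψ φ) {x : ℝ} (hx : 0 < x)
    (hW : 0 < phaseW n ψ φ x) :
    ψ x = √((n : ℝ) * ((n : ℝ) - 1)) * phaseW n ψ φ x / phaseY n ψ φ x := by
  have := h.pos x hx
  have := kappa_pos hn
  rw [phaseY]
  field_simp

theorem SolitonODE.deriv_eq_of_phase (hn : 2 ≤ n) (h : SolitonODE n ψ φ) {x : ℝ} (hx : 0 < x)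
    (hW : 0 < phaseW n ψ φ x) :
    deriv ψ x = √((n : ℝ) * ((n : ℝ) - 1)) * (1 / √(n : ℝ)) * phaseX n ψ φ x /
      phaseY n ψ φ x := by
  have := h.pos x hx
  have := kappa_pos hn
  have := sqrt_dim_pos hn
  rw [phaseY, phaseX]
  field_simp

theorem deriv_potential_eq_of_phase (hn : 2 ≤ n) {x : ℝ} (hW : 0 < phaseW n ψ φ x) :
    deriv φ x = (√(n : ℝ) * phaseX n ψ φ x - 1) / phaseW n ψ φ x := by
  have hd : -deriv φ x + n * (deriv ψ x / ψ x) = 1 / phaseW n ψ φ x := by simp [phaseW]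
  have hs := sqrt_dim_pos hn
  rw [phaseX, ← mul_assoc, ← mul_assoc, Real.mul_self_sqrt n.cast_nonneg, sub_div, ← hd]
  field_simp
  ring

/-- In the phase variables, `ψ''` is a multiple of `(Y²/√n - X + X²/√n) / (W Y)`. -/
theorem SolitonODE.deriv2_eq_of_phase (hn : 2 ≤ n) (h : SolitonODE n ψ φ) {x : ℝ} (hx : 0 < x)
    (hW : 0 < phaseW n ψ φ x) :
    deriv (deriv ψ) x = √((n : ℝ) * ((n : ℝ) - 1)) * (1 / √(n : ℝ)) / phaseW n ψ φ x *
      ((1 / √(n : ℝ) * phaseY n ψ φ x ^ 2 - phaseX n ψ φ x + 1 / √(n : ℝ) * phaseX n ψ φ x ^ 2) /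
        phaseY n ψ φ x) := by
  have hp := h.pos x hx
  have hY := h.phaseY_pos hn hx hW
  have hκ := kappa_pos hn
  have hs := sqrt_dim_pos hn
  have h1 : deriv (deriv ψ) x = ((n - 1) * (1 - deriv ψ x ^ 2) + ψ x * deriv ψ x * deriv φ x) /
      ψ x := by rw [← h.spherical x hx]; field_simp
  rw [h1, deriv_potential_eq_of_phase hn hW, h.deriv_eq_of_phase hn hx hW, h.eq_of_phase hn hx hW]
  have hκ2 : √((n : ℝ) * ((n : ℝ) - 1)) ^ 2 = √(n : ℝ) ^ 2 * (√(n : ℝ) ^ 2 - 1) := by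
    have hnn : (1 : ℝ) ≤ n := by exact_mod_cast (by omega : 1 ≤ n)
    rw [Real.sq_sqrt (mul_nonneg n.cast_nonneg (by linarith)), Real.sq_sqrt n.cast_nonneg]
  have hn' : (n : ℝ) = √(n : ℝ) ^ 2 := (Real.sq_sqrt n.cast_nonneg).symm
  set κ := √((n : ℝ) * ((n : ℝ) - 1)) with hκ_def
  set s := √(n : ℝ) with hs_def
  generalize phaseW n ψ φ x = W at *
  generalize phaseX n ψ φ x = X at *
  generalize phaseY n ψ φ x = Y at *
  rw [hn']
  field_simp
  rw [hκ2]
  ring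

/-- The two-sided bounds follow from exact asymptotics; the constants are half of the least limit
and a number exceeding all the limits. -/
theorem hasBryantAsymptotics_of_tendsto {l₁ l₂ l₃ l₄ l₅ : ℝ}
    (h₁ : 0 < l₁) (h₂ : 0 < l₂) (h₃ : 0 < l₃) (h₄ : 0 < l₄)
    (H₁ : Tendsto (fun x => ψ x / √x) atTop (𝓝 l₁))
    (H₂ : Tendsto (fun x => deriv ψ x * √x) atTop (𝓝 l₂))
    (H₃ : Tendsto (fun x => -(deriv (deriv ψ) x * (x * √x))) atTop (𝓝 l₃))
    (H₄ : Tendsto (fun x => -deriv φ x) atTop (𝓝 l₄))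
    (H₅ : Tendsto (fun x => deriv (deriv φ) x * x ^ 2) atTop (𝓝 l₅)) :
    HasBryantAsymptotics ψ φ := by
  set c := min (min l₁ l₂) (min l₃ l₄) / 2 with hc
  set C := l₁ + l₂ + l₃ + l₄ + |l₅| + 1 with hC
  have hm : 0 < min (min l₁ l₂) (min l₃ l₄) := lt_min (lt_min h₁ h₂) (lt_min h₃ h₄)
  have hc0 : 0 < c := half_pos hm
  have hcm : c < min (min l₁ l₂) (min l₃ l₄) := half_lt_self hm
  have hc' := lt_min_iff.1 hcm
  have hc₁ := lt_min_iff.1 hc'.1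
  have hc₂ := lt_min_iff.1 hc'.2
  have h5 := abs_nonneg l₅
  have hev : ∀ᶠ x in atTop, (ψ x / √x ∈ Ioo c C) ∧ (deriv ψ x * √x ∈ Ioo c C) ∧
      (-(deriv (deriv ψ) x * (x * √x)) ∈ Ioo c C) ∧ (-deriv φ x ∈ Ioo c C) ∧
      |deriv (deriv φ) x * x ^ 2| < C ∧ 1 ≤ x := by
    filter_upwards [H₁.eventually (Ioo_mem_nhds hc₁.1 (by linarith : l₁ < C)),
      H₂.eventually (Ioo_mem_nhds hc₁.2 (by linarith : l₂ < C)),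
      H₃.eventually (Ioo_mem_nhds hc₂.1 (by linarith : l₃ < C)),
      H₄.eventually (Ioo_mem_nhds hc₂.2 (by linarith : l₄ < C)),
      H₅.abs.eventually (gt_mem_nhds (by linarith : |l₅| < C)), eventually_ge_atTop 1]
      with x a1 a2 a3 a4 a5 a6 using ⟨a1, a2, a3, a4, a5, a6⟩
  obtain ⟨M, hM⟩ := eventually_atTop.1 hev
  refine ⟨c, C, max M 1, hc0, by positivity, by positivity, fun x hx => ?_⟩
  obtain ⟨b1, b2, b3, b4, b5, b6⟩ := hM x ((le_max_left _ _).trans hx)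
  have hx0 : 0 < x := by linarith
  have hs : 0 < √x := Real.sqrt_pos.2 hx0
  have e1 : x ^ (1 / 2 : ℝ) = √x := (Real.sqrt_eq_rpow x).symm
  have e2 : x ^ (-(1 / 2) : ℝ) = 1 / √x := by rw [Real.rpow_neg hx0.le, e1, one_div]
  have e3 : x ^ (-(3 / 2) : ℝ) = 1 / (x * √x) := by
    rw [show (-(3 / 2) : ℝ) = -1 + -(1 / 2) by norm_num, Real.rpow_add hx0, e2, Real.rpow_neg_one]
    field_simp
  rw [e1, e2, e3]
  rw [mem_Ioo, lt_div_iff₀ hs, div_lt_iff₀ hs] at b1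
  have hxs : 0 < x * √x := by positivity
  refine ⟨⟨b1.1.le, b1.2.le⟩, ⟨?_, ?_⟩, ⟨?_, ?_⟩, ⟨by linarith [b4.2], by linarith [b4.1]⟩, ?_⟩
  · rw [mul_one_div, div_le_iff₀ hs]; exact b2.1.le
  · rw [mul_one_div, le_div_iff₀ hs]; exact b2.2.le
  · rw [mul_one_div, div_le_iff₀ hxs]; linarith [b3.2]
  · rw [mul_one_div, le_div_iff₀ hxs]; linarith [b3.1]
  · rw [le_div_iff₀ (by positivity), ← abs_of_pos (by positivity : 0 < x ^ 2), ← abs_mul]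
    exact b5.le

/-- The phase curve approaches the origin along the centre manifold `X = a Y² + 2 a³ Y⁴ + …` with
`a = 1/√n`. The second coefficient matters: the leading terms of `ψ''` cancel, and its sign comes
from `a · a² - 2 a³ < 0`. -/
theorem SolitonODE.hasBryantAsymptotics (hn : 2 ≤ n) (h : SolitonODE n ψ φ)
    (hW : ∀ x, 0 < x → 0 < phaseW n ψ φ x)
    (hlim : Tendsto (fun x => (phaseX n ψ φ x, phaseY n ψ φ x)) atTop (𝓝 (0, 0))) :
    HasBryantAsymptotics ψ φ := by
  have hn1 : 1 ≤ n := by omega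
  have hs := sqrt_dim_pos hn
  have hκ := kappa_pos hn
  set κ := √((n : ℝ) * ((n : ℝ) - 1)) with hκ_def
  set a := 1 / √(n : ℝ) with ha_def
  have ha : 0 < a := by positivity
  set W := phaseW n ψ φ with hW_def
  set X := phaseX n ψ φ with hX_def
  set Y := phaseY n ψ φ with hY_def
  have hX : Tendsto X atTop (𝓝 0) := (continuous_fst.tendsto _).comp hlim
  have hY : Tendsto Y atTop (𝓝 0) := (continuous_snd.tendsto _).comp hlim
  have hYpos : ∀ x, 0 < x → 0 < Y x := fun x hx => h.phaseY_pos hn hx (hW x hx)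
  have hdX : ∀ x, 0 < x → HasDerivAt X ((X x ^ 3 - X x + a * Y x ^ 2) / W x) x := fun x hx =>
    h.hasDerivAt_phaseX hn1 hx (hW x hx).ne'
  have hdY : ∀ x, 0 < x → HasDerivAt Y (Y x * (X x ^ 2 - a * X x) / W x) x := fun x hx =>
    h.hasDerivAt_phaseY hn1 hx (hW x hx).ne'
  -- `W` has a finite positive limit, because `lyapunov = C * W ^ 2` tends to `1`
  obtain ⟨w, hw, hWlim⟩ : ∃ w, 0 < w ∧ Tendsto W atTop (𝓝 w) := by
    obtain ⟨C, hC⟩ := h.exists_lyapunov_eq hn1 hW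
    have hL : Tendsto (fun x => C * W x ^ 2) atTop (𝓝 1) := by
      have : Tendsto (fun x => lyapunov (X x, Y x)) atTop (𝓝 1) := by
        simpa [lyapunov] using ((hX.pow 2).const_sub 1).sub (hY.pow 2)
      refine this.congr' ?_
      filter_upwards [eventually_gt_atTop 0] with x hx using hC x hx
    have hC0 : 0 < C := by
      obtain ⟨x, hx⟩ := (hL.eventually (lt_mem_nhds one_pos)).exists
      exact pos_of_mul_pos_left hx (sq_nonneg _)
    refine ⟨√(1 / C), by positivity, ?_⟩
    have := (hL.div_const C).sqrt
    refine this.congr' ?_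
    filter_upwards [eventually_gt_atTop 0] with x hx
    rw [mul_div_cancel_left₀ _ hC0.ne', Real.sqrt_sq (hW x hx).le]
  have hWinv : Tendsto (fun x => 1 / W x) atTop (𝓝 (1 / w)) := by
    simpa using hWlim.inv₀ hw.ne'
  -- leading order of the centre manifold: `X / Y ^ 2 → a`
  have hu : Tendsto (fun x => X x / Y x ^ 2) atTop (𝓝 a) := by
    have := tendsto_of_relaxation (f := fun x => X x / Y x ^ 2)
      (A := fun x => (1 + X x ^ 2 - 2 * a * X x) * (1 / W x)) (B := fun x => a * (1 / W x))
      (A₀ := (1 + 0 ^ 2 - 2 * a * 0) * (1 / w)) (B₀ := a * (1 / w)) (by simpa using hw) ?_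
      ((((hX.pow 2).const_add 1).sub (hX.const_mul (2 * a))).mul hWinv) (hWinv.const_mul a)
    · have e : a * (1 / w) / ((1 + 0 ^ 2 - 2 * a * 0) * (1 / w)) = a := by field_simp; simp
      rwa [e] at this
    · filter_upwards [eventually_gt_atTop 0] with x hx
      have hYx := (hYpos x hx).ne'
      have hWx := (hW x hx).ne'
      refine ((hdX x hx).div ((hdY x hx).pow 2) (pow_ne_zero 2 hYx)).congr_deriv ?_
      simp only [Pi.pow_apply]
      field_simp
      ring
  set u := fun x => X x / Y x ^ 2 with hu_def
  have hdu : ∀ x, 0 < x → HasDerivAt u ((a - u x * (1 + X x ^ 2 - 2 * a * X x)) / W x) x := by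
    intro x hx
    have hYx := (hYpos x hx).ne'
    have hWx := (hW x hx).ne'
    refine ((hdX x hx).div ((hdY x hx).pow 2) (pow_ne_zero 2 hYx)).congr_deriv ?_
    simp only [Pi.pow_apply, hu_def]
    field_simp
    ring
  have hXu : ∀ x, 0 < x → X x = u x * Y x ^ 2 := fun x hx => by
    have hYx := (hYpos x hx).ne'
    simp only [hu_def]
    field_simp
  -- next order of the centre manifold
  have hv : Tendsto (fun x => (u x - a) / Y x ^ 2) atTop (𝓝 (2 * a ^ 3)) := by
    have := tendsto_of_relaxation (f := fun x => (u x - a) / Y x ^ 2)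
      (A := fun x => (1 + 2 * X x ^ 2 - 2 * a * X x) * (1 / W x))
      (B := fun x => (2 * a * u x ^ 2 - u x ^ 3 * Y x ^ 2) * (1 / W x))
      (A₀ := (1 + 2 * 0 ^ 2 - 2 * a * 0) * (1 / w))
      (B₀ := (2 * a * a ^ 2 - a ^ 3 * 0 ^ 2) * (1 / w)) (by simpa using hw) ?_
      (((((hX.pow 2).const_mul 2).const_add 1).sub (hX.const_mul (2 * a))).mul hWinv)
      ((((hu.pow 2).const_mul (2 * a)).sub ((hu.pow 3).mul (hY.pow 2))).mul hWinv)
    · have e : (2 * a * a ^ 2 - a ^ 3 * 0 ^ 2) * (1 / w) / ((1 + 2 * 0 ^ 2 - 2 * a * 0) * (1 / w))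
          = 2 * a ^ 3 := by field_simp; simp
      rwa [e] at this
    · filter_upwards [eventually_gt_atTop 0] with x hx
      have hYx := (hYpos x hx).ne'
      have hWx := (hW x hx).ne'
      refine (((hdu x hx).sub_const a).div ((hdY x hx).pow 2) (pow_ne_zero 2 hYx)).congr_deriv ?_
      simp only [Pi.pow_apply]
      rw [hXu x hx]
      field_simp
      ring
  -- `1 / Y ^ 2` grows linearly
  have hσ : Tendsto (fun x => 1 / Y x ^ 2 / x) atTop (𝓝 (2 * a ^ 2 / w)) := by
    refine tendsto_div_of_deriv (f := fun x => 1 / Y x ^ 2)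
      (f' := fun x => (2 * a * u x - 2 * u x ^ 2 * Y x ^ 2) * (1 / W x)) ?_ ?_
    · filter_upwards [eventually_gt_atTop 0] with x hx
      have hYx := (hYpos x hx).ne'
      have hWx := (hW x hx).ne'
      refine ((hasDerivAt_const x (1 : ℝ)).div ((hdY x hx).pow 2)
        (pow_ne_zero 2 hYx)).congr_deriv ?_
      simp only [Pi.pow_apply]
      rw [hXu x hx]
      field_simp
      ring
    · have := ((hu.const_mul (2 * a)).sub (((hu.pow 2).const_mul 2).mul (hY.pow 2))).mul hWinv
      have e : (2 * a * a - 2 * a ^ 2 * 0 ^ 2) * (1 / w) = 2 * a ^ 2 / w := by ring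
      rwa [e] at this
  obtain ⟨τ, hτ, hYτ⟩ : ∃ τ, 0 < τ ∧ Tendsto (fun x => Y x * √x) atTop (𝓝 τ) := by
    have hσ0 : 0 < 2 * a ^ 2 / w := by positivity
    refine ⟨(√(2 * a ^ 2 / w))⁻¹, by positivity, ?_⟩
    refine (hσ.sqrt.inv₀ (Real.sqrt_pos.2 hσ0).ne').congr' ?_
    filter_upwards [eventually_gt_atTop 0] with x hx
    have hYx := hYpos x hx
    rw [div_div, one_div, Real.sqrt_inv, inv_inv, Real.sqrt_mul (by positivity),
      Real.sqrt_sq hYx.le]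
  have L₁ : Tendsto (fun x => ψ x / √x) atTop (𝓝 (κ * w / τ)) := by
    refine ((hWlim.const_mul κ).div hYτ hτ.ne').congr' ?_
    filter_upwards [eventually_gt_atTop 0] with x hx
    rw [h.eq_of_phase hn hx (hW x hx), ← hκ_def]
    simp only [Pi.div_apply, ← hW_def, ← hY_def]
    rw [div_div]
  have L₂ : Tendsto (fun x => deriv ψ x * √x) atTop (𝓝 (κ * a * (a * τ))) := by
    refine ((hu.mul hYτ).const_mul (κ * a)).congr' ?_
    filter_upwards [eventually_gt_atTop 0] with x hx
    have hYx := (hYpos x hx).ne'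
    rw [h.deriv_eq_of_phase hn hx (hW x hx), ← hκ_def, ← ha_def]
    simp only [← hX_def, ← hY_def]
    rw [hXu x hx]
    field_simp
  have L₃ : Tendsto (fun x => -(deriv (deriv ψ) x * (x * √x))) atTop
      (𝓝 (-(κ * a * (1 / w) * ((-(2 * a ^ 3) + a * a ^ 2) * τ ^ 3)))) := by
    refine ((hWinv.const_mul (κ * a)).mul
      ((hv.neg.add ((hu.pow 2).const_mul a)).mul (hYτ.pow 3))).neg.congr' ?_
    filter_upwards [eventually_gt_atTop 0] with x hx
    have hYx := (hYpos x hx).ne'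
    rw [h.deriv2_eq_of_phase hn hx (hW x hx), ← hκ_def, ← ha_def]
    simp only [← hX_def, ← hY_def, ← hW_def]
    rw [hXu x hx, mul_pow (Y x), show √x ^ 3 = x * √x by
      rw [pow_succ, Real.sq_sqrt hx.le]]
    field_simp
    ring
  have L₄ : Tendsto (fun x => -deriv φ x) atTop (𝓝 (-((√(n : ℝ) * 0 - 1) / w))) := by
    refine (((hX.const_mul (√(n : ℝ))).sub_const 1).div hWlim hw.ne').neg.congr' ?_
    filter_upwards [eventually_gt_atTop 0] with x hx
    rw [deriv_potential_eq_of_phase hn (hW x hx)]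
    rfl
  -- `φ'' x ^ 2 = n (ψ'' x ^ (3/2)) / (ψ x ^ (-1/2))` by the radial equation
  have L₅ := (L₃.neg.div L₁ (by positivity)).const_mul (n : ℝ)
  refine hasBryantAsymptotics_of_tendsto (by positivity) (by positivity) ?_ ?_ L₁ L₂ L₃ L₄
    (L₅.congr' ?_)
  · have e : -(κ * a * (1 / w) * ((-(2 * a ^ 3) + a * a ^ 2) * τ ^ 3)) =
        κ * a * (1 / w) * (a ^ 3 * τ ^ 3) := by ring
    rw [e]; positivity
  · have e : -((√(n : ℝ) * 0 - 1) / w) = 1 / w := by ring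
    rw [e]; positivity
  · filter_upwards [eventually_gt_atTop 0] with x hx
    rw [h.radial x hx]
    have := h.pos x hx
    have hsx : √x * √x = x := Real.mul_self_sqrt hx.le
    simp only [Pi.div_apply, neg_neg]
    rw [div_div_eq_mul_div]
    have : x * √x * √x = x ^ 2 := by rw [mul_assoc, hsx, sq]
    rw [← this]
    ring

end Asymptotics

/-! ### Completeness towards infinity -/

/-- The metric splits orthogonally into its radial and spherical parts; `⟪z, v⟫ / ‖z‖` is the radial
component of `v`. -/
theorem warpedMetric_quadratic (n : ℕ) (ψ : ℝ → ℝ) {z : EuclideanSpace ℝ (Fin (n + 1))}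
    (hz : z ≠ 0) (v : EuclideanSpace ℝ (Fin (n + 1))) :
    ∑ i, ∑ j, warpedMetric n ψ z i j * v i * v j =
      (inner ℝ z v / ‖z‖) ^ 2 + (ψ ‖z‖ / ‖z‖) ^ 2 * (‖v‖ ^ 2 - (inner ℝ z v / ‖z‖) ^ 2) := by
  have hzv : inner ℝ z v = ∑ i, z i * v i := by
    rw [PiLp.inner_apply]; exact Finset.sum_congr rfl fun i _ => by simp [mul_comm]
  have key : ∀ i j, warpedMetric n ψ z i j * v i * v j =
      (1 / ‖z‖ ^ 2 - ψ ‖z‖ ^ 2 / ‖z‖ ^ 4) * ((z i * v i) * (z j * v j)) +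
        (if i = j then ψ ‖z‖ ^ 2 / ‖z‖ ^ 2 * (v i * v j) else 0) := by
    intro i j
    rw [warpedMetric_apply n ψ z hz]
    have : ‖z‖ ≠ 0 := norm_ne_zero_iff.2 hz
    split_ifs <;> field_simp <;> ring
  simp only [key, Finset.sum_add_distrib, Finset.sum_ite_eq, Finset.mem_univ, if_true,
    ← Finset.mul_sum, ← Finset.sum_mul, ← hzv, sum_coord_mul_self]
  have : ‖z‖ ≠ 0 := norm_ne_zero_iff.2 hz
  field_simp
  ring

section Curve

variable {n : ℕ} {ψ : ℝ → ℝ} {γ : ℝ → EuclideanSpace ℝ (Fin (n + 1))}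

/-- The speed of the curve `γ` in the metric `dx² + ψ² g_{Sⁿ}`. -/
def speed (n : ℕ) (ψ : ℝ → ℝ) (γ : ℝ → EuclideanSpace ℝ (Fin (n + 1))) (t : ℝ) : ℝ :=
  √(∑ i, ∑ j, warpedMetric n ψ (γ t) i j * deriv γ t i * deriv γ t j)

theorem speed_eq {t : ℝ} (ht : γ t ≠ 0) : speed n ψ γ t =
    √((inner ℝ (γ t) (deriv γ t) / ‖γ t‖) ^ 2 + (ψ ‖γ t‖ / ‖γ t‖) ^ 2 *
      (‖deriv γ t‖ ^ 2 - (inner ℝ (γ t) (deriv γ t) / ‖γ t‖) ^ 2)) := by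
  rw [speed, warpedMetric_quadratic n ψ ht]

theorem sq_radial_le {z v : EuclideanSpace ℝ (Fin (n + 1))} (hz : z ≠ 0) :
    (inner ℝ z v / ‖z‖) ^ 2 ≤ ‖v‖ ^ 2 := by
  have hz' : 0 < ‖z‖ := norm_pos_iff.2 hz
  rw [div_pow, div_le_iff₀ (by positivity), ← mul_pow, ← sq_abs]
  exact pow_le_pow_left₀ (abs_nonneg _) ((abs_real_inner_le_norm z v).trans_eq (mul_comm _ _)) 2

theorem abs_radial_le_speed {t : ℝ} (ht : γ t ≠ 0) :
    |inner ℝ (γ t) (deriv γ t) / ‖γ t‖| ≤ speed n ψ γ t := by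
  rw [speed_eq ht]
  refine Real.abs_le_sqrt ?_
  have := sq_radial_le (v := deriv γ t) ht
  nlinarith [sq_nonneg (ψ ‖γ t‖ / ‖γ t‖)]

/-- The warped metric dominates `c²` times the Euclidean metric wherever `c ≤ 1` and `c ≤ ψ(r)/r`.
-/
theorem mul_norm_deriv_le_speed {t c : ℝ} (ht : γ t ≠ 0) (hc0 : 0 ≤ c) (hc1 : c ≤ 1)
    (hc : c ≤ ψ ‖γ t‖ / ‖γ t‖) : c * ‖deriv γ t‖ ≤ speed n ψ γ t := by
  rw [speed_eq ht]
  refine Real.le_sqrt_of_sq_le ?_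
  have h1 := sq_radial_le (v := deriv γ t) ht
  have h2 : c ^ 2 ≤ (ψ ‖γ t‖ / ‖γ t‖) ^ 2 := pow_le_pow_left₀ hc0 hc 2
  have h3 : c ^ 2 ≤ 1 := pow_le_one₀ hc0 hc1
  have h4 := mul_le_mul_of_nonneg_right h2 (sub_nonneg.2 h1)
  have h5 := mul_le_mul_of_nonneg_right h3 (sq_nonneg (inner ℝ (γ t) (deriv γ t) / ‖γ t‖))
  rw [mul_pow]
  linarith

theorem continuousOn_speed (hψ : ContinuousOn ψ (Ioi 0)) (hγ : ContDiff ℝ 1 γ)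
    (hγ0 : ∀ t ∈ Icc (0 : ℝ) 1, γ t ≠ 0) : ContinuousOn (speed n ψ γ) (Icc 0 1) := by
  have hd : Continuous (deriv γ) := hγ.continuous_deriv le_rfl
  have hc : Continuous γ := hγ.continuous
  have hn : ContinuousOn (fun t => ‖γ t‖) (Icc 0 1) := hc.norm.continuousOn
  have hn0 : ∀ t ∈ Icc (0 : ℝ) 1, ‖γ t‖ ≠ 0 := fun t ht => norm_ne_zero_iff.2 (hγ0 t ht)
  have h1 : ContinuousOn (fun t => inner ℝ (γ t) (deriv γ t) / ‖γ t‖) (Icc 0 1) :=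
    (hc.inner hd).continuousOn.div hn hn0
  have h2 : ContinuousOn (fun t => ψ ‖γ t‖ / ‖γ t‖) (Icc 0 1) :=
    (hψ.comp hn fun t ht => norm_pos_iff.2 (hγ0 t ht)).div hn hn0
  refine ContinuousOn.congr (((h1.pow 2).add ((h2.pow 2).mul
    ((hd.norm.pow 2).continuousOn.sub (h1.pow 2)))).sqrt) fun t ht => speed_eq (hγ0 t ht)

/-- A function growing along the curve at most at the rate of its speed grows at most by the length.
-/
theorem sub_le_curveLength {f f' : ℝ → ℝ} (hψ : ContinuousOn ψ (Ioi 0)) (hγ : ContDiff ℝ 1 γ)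
    (hγ0 : ∀ t ∈ Icc (0 : ℝ) 1, γ t ≠ 0) (hf : ∀ t ∈ Icc (0 : ℝ) 1, HasDerivAt f (f' t) t)
    (hle : ∀ t ∈ Icc (0 : ℝ) 1, f' t ≤ speed n ψ γ t) {t : ℝ} (ht : t ∈ Icc (0 : ℝ) 1) :
    f t - f 0 ≤ curveLength (warpedMetric n ψ) γ := by
  have hsub : Icc 0 t ⊆ Icc (0 : ℝ) 1 := Icc_subset_Icc_right ht.2
  have hs := continuousOn_speed hψ hγ hγ0
  have h1 : f t - f 0 ≤ ∫ u in (0 : ℝ)..t, speed n ψ γ u :=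
    intervalIntegral.sub_le_integral_of_hasDeriv_right_of_le ht.1
      (HasDerivAt.continuousOn fun u hu => hf u (hsub hu))
      (fun u hu => (hf u (hsub (Ioo_subset_Icc_self hu))).hasDerivWithinAt)
      ((hs.mono hsub).integrableOn_Icc) (fun u hu => hle u (hsub (Ioo_subset_Icc_self hu)))
  have h2 : ∫ u in (0 : ℝ)..t, speed n ψ γ u ≤ ∫ u in (0 : ℝ)..1, speed n ψ γ u :=
    intervalIntegral.integral_mono_interval le_rfl ht.1 ht.2
      (Eventually.of_forall fun u => Real.sqrt_nonneg _)
      (hs.intervalIntegrable_of_Icc zero_le_one)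
  exact h1.trans h2

theorem hasDerivAt_norm_curve (hγ : ContDiff ℝ 1 γ) {t : ℝ} (ht : γ t ≠ 0) :
    HasDerivAt (fun t => ‖γ t‖) (inner ℝ (γ t) (deriv γ t) / ‖γ t‖) t := by
  have := (hasFDerivAt_norm_euclidean ht).comp_hasDerivAt t
    ((hγ.differentiable one_ne_zero) t).hasDerivAt
  refine this.congr_deriv ?_
  simp
  ring

/-- The distance of two spheres `‖z‖ = r` and `‖z‖ = r'` is at least `|r - r'|`. -/
theorem abs_norm_sub_le_curveLength (hψ : ContinuousOn ψ (Ioi 0)) (hγ : ContDiff ℝ 1 γ)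
    (hγ0 : ∀ t ∈ Icc (0 : ℝ) 1, γ t ≠ 0) {t : ℝ} (ht : t ∈ Icc (0 : ℝ) 1) :
    |‖γ t‖ - ‖γ 0‖| ≤ curveLength (warpedMetric n ψ) γ := by
  rw [abs_le']
  constructor
  · exact sub_le_curveLength hψ hγ hγ0 (fun t ht => hasDerivAt_norm_curve hγ (hγ0 t ht))
      (fun t ht => (le_abs_self _).trans (abs_radial_le_speed (hγ0 t ht))) ht
  · have := sub_le_curveLength hψ hγ hγ0
      (fun t ht => (hasDerivAt_norm_curve hγ (hγ0 t ht)).fun_neg)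
      (fun t ht => (neg_le_abs _).trans (abs_radial_le_speed (hγ0 t ht))) ht
    linarith

theorem mul_dist_le_curveLength (hψ : ContinuousOn ψ (Ioi 0)) (hγ : ContDiff ℝ 1 γ)
    (hγ0 : ∀ t ∈ Icc (0 : ℝ) 1, γ t ≠ 0) {c : ℝ} (hc0 : 0 ≤ c) (hc1 : c ≤ 1)
    (hc : ∀ t ∈ Icc (0 : ℝ) 1, c ≤ ψ ‖γ t‖ / ‖γ t‖) :
    c * ‖γ 1 - γ 0‖ ≤ curveLength (warpedMetric n ψ) γ := by
  rcases eq_or_ne (γ 1 - γ 0) 0 with h0 | h0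
  · rw [h0, norm_zero, mul_zero]
    exact (abs_nonneg _).trans (abs_norm_sub_le_curveLength hψ hγ hγ0 (t := 0) (by simp))
  -- project the curve to the line through its endpoints
  set u := ‖γ 1 - γ 0‖⁻¹ • (γ 1 - γ 0) with hu
  have hu1 : ‖u‖ = 1 := norm_smul_inv_norm (𝕜 := ℝ) h0
  have h := sub_le_curveLength (f := fun t => c * inner ℝ u (γ t))
    (f' := fun t => c * inner ℝ u (deriv γ t)) hψ hγ hγ0 (fun t _ => by
      have hd := ((hγ.differentiable one_ne_zero) t).hasDerivAt
      have := ((hasDerivAt_const t u).inner ℝ hd).const_mul c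
      simpa using this) (fun t ht => by
      refine le_trans ?_ (mul_norm_deriv_le_speed (hγ0 t ht) hc0 hc1 (hc t ht))
      have := real_inner_le_norm u (deriv γ t)
      rw [hu1, one_mul] at this
      gcongr) (right_mem_Icc.2 zero_le_one)
  refine le_trans (le_of_eq ?_) h
  rw [← mul_sub, ← inner_sub_right, hu, real_inner_smul_left, real_inner_self_eq_norm_sq]
  have : ‖γ 1 - γ 0‖ ≠ 0 := norm_ne_zero_iff.2 h0
  field_simp

end Curve

/-- This holds for every warping function: a Cauchy sequence stays, together with the short curves
joining its points, in a compact annulus, where the metric dominates a multiple of the Euclidean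
one. -/
theorem isCompleteTowardsInfinity {n : ℕ} {ψ : ℝ → ℝ} (hψ : ContinuousOn ψ (Ioi 0))
    (hpos : ∀ x, 0 < x → 0 < ψ x) : IsCompleteTowardsInfinity n ψ := by
  intro δ hδ z hz hcauchy
  obtain ⟨K₀, hK₀⟩ := hcauchy (δ / 2) (half_pos hδ)
  set R := ‖z K₀‖ + δ with hR
  have hRδ : δ / 2 ≤ R := by linarith [hz K₀]
  obtain ⟨r₀, hr₀, hmin⟩ := (isCompact_Icc (a := δ / 2) (b := R)).exists_isMinOn
    ⟨_, left_mem_Icc.2 hRδ⟩ (f := fun r => ψ r / r) ((hψ.mono fun r hr =>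
      (half_pos hδ).trans_le hr.1).div continuousOn_id fun r hr =>
        ((half_pos hδ).trans_le hr.1).ne')
  have hr₀0 : 0 < r₀ := (half_pos hδ).trans_le hr₀.1
  -- the curves considered below stay in the annulus `δ / 2 ≤ ‖z‖ ≤ R`, where `ψ(r) / r` is
  -- minimal at `r₀`
  set c := min 1 (ψ r₀ / r₀) with hc_def
  have hc0 : 0 < c := lt_min one_pos (div_pos (hpos _ hr₀0) hr₀0)
  have hbound : ∀ k, K₀ ≤ k → ‖z k‖ ≤ ‖z K₀‖ + δ / 2 := by
    intro k hk
    obtain ⟨γ, hγ, hγ0, h0, h1, hlen⟩ := hK₀ K₀ le_rfl k hk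
    have := (le_abs_self _).trans
      (abs_norm_sub_le_curveLength hψ hγ hγ0 (right_mem_Icc.2 zero_le_one))
    rw [h0, h1] at this
    linarith
  have hcs : CauchySeq z := by
    rw [Metric.cauchySeq_iff]
    intro ε hε
    obtain ⟨K, hK⟩ := hcauchy (min (δ / 2) (c * ε)) (lt_min (half_pos hδ) (by positivity))
    refine ⟨max K₀ K, fun k hk m hm => ?_⟩
    obtain ⟨γ, hγ, hγ0, h0, h1, hlen⟩ := hK k ((le_max_right _ _).trans hk) m
      ((le_max_right _ _).trans hm)
    rw [lt_min_iff] at hlen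
    have hct : ∀ t ∈ Icc (0 : ℝ) 1, c ≤ ψ ‖γ t‖ / ‖γ t‖ := by
      intro t ht
      have h2 := (abs_norm_sub_le_curveLength hψ hγ hγ0 ht).trans hlen.1.le
      rw [h0, abs_le] at h2
      have h3 := hbound k ((le_max_left _ _).trans hk)
      exact (min_le_right _ _).trans (hmin ⟨by linarith [hz k], by linarith⟩)
    have h4 := (mul_dist_le_curveLength hψ hγ hγ0 hc0.le (min_le_left _ _) hct).trans_lt hlen.2
    rw [h0, h1] at h4
    rw [dist_comm, dist_eq_norm]
    exact lt_of_mul_lt_mul_left h4 hc0.le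
  obtain ⟨zlim, hlim⟩ := cauchySeq_tendsto_of_complete hcs
  exact ⟨zlim, ge_of_tendsto hlim.norm (Eventually.of_forall hz), hlim⟩

/-! ### Arc length along a trajectory -/

theorem exists_hasDerivAt_inverse {f f' : ℝ → ℝ} (hf : ∀ t, HasDerivAt f (f' t) t)
    (hpos : ∀ t, 0 < f' t) (hbot : Tendsto f atBot atBot) (htop : Tendsto f atTop atTop) :
    ∃ g : ℝ → ℝ, (∀ t, g (f t) = t) ∧ (∀ x, f (g x) = x) ∧
      ∀ x, HasDerivAt g (1 / f' (g x)) x := by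
  have hmono : StrictMono f := strictMono_of_deriv_pos fun t => by rw [(hf t).deriv]; exact hpos t
  have hcont : Continuous f := continuous_iff_continuousAt.2 fun t => (hf t).continuousAt
  set e := hmono.orderIsoOfSurjective f (hcont.surjective htop hbot) with he
  have h1 : ∀ x, f (e.symm x) = x := fun x => e.apply_symm_apply x
  refine ⟨e.symm, fun t => e.symm_apply_apply t, h1, fun x => ?_⟩
  rw [one_div]
  exact HasDerivAt.of_local_left_inverse e.symm.continuous.continuousAt (hf _) (hpos _).ne'
    (Eventually.of_forall h1)

section Trajectory

variable {a : ℝ} {γ : ℝ → ℝ × ℝ}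

theorem hasDerivAt_sqrt_lyapunov (h : ∀ y, HasDerivAt γ (planarField a (γ y)) y)
    (hL : ∀ y, 0 < lyapunov (γ y)) (y : ℝ) :
    HasDerivAt (fun y => √(lyapunov (γ y))) ((γ y).1 ^ 2 * √(lyapunov (γ y))) y := by
  refine ((hasDerivAt_lyapunov h y).sqrt (hL y).ne').congr_deriv ?_
  have h1 := Real.mul_self_sqrt (hL y).le
  have h2 := Real.sqrt_pos.2 (hL y)
  rw [div_eq_iff (by positivity)]
  linear_combination (-2 * (γ y).1 ^ 2) * h1

/-- The parameter `x = ∫ W dy` with `W = √(1 - X² - Y²)`, normalized to vanish at `y = -∞`. It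
exhausts `(0, ∞)`, and `W ∼ x` at `-∞` because `dW/dx = X² → 1`. -/
theorem exists_arclength (h : ∀ y, HasDerivAt γ (planarField a (γ y)) y)
    (hL : ∀ y, 0 < lyapunov (γ y)) (hlim : Tendsto γ atBot (𝓝 (1, 0))) :
    ∃ ξ : ℝ → ℝ, (∀ t, 0 < ξ t) ∧ (∀ t, HasDerivAt ξ (√(lyapunov (γ t))) t) ∧
      Tendsto ξ atBot (𝓝 0) ∧ Tendsto ξ atTop atTop ∧
      Tendsto (fun t => √(lyapunov (γ t)) / ξ t) atBot (𝓝 1) := by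
  have hc := continuous_of_solution h
  have hlc : Continuous fun p : ℝ × ℝ => lyapunov p := by unfold lyapunov; fun_prop
  set W := fun t => √(lyapunov (γ t)) with hW_def
  have hW : ∀ t, 0 < W t := fun t => Real.sqrt_pos.2 (hL t)
  have hdW : ∀ t, HasDerivAt W ((γ t).1 ^ 2 * W t) t := hasDerivAt_sqrt_lyapunov h hL
  have hWc : Continuous W := continuous_iff_continuousAt.2 fun t => (hdW t).continuousAt
  have hWmono : Monotone W := monotone_of_deriv_nonneg (fun t => (hdW t).differentiableAt)
    fun t => by rw [(hdW t).deriv]; exact mul_nonneg (sq_nonneg _) (hW t).le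
  have hX : Tendsto (fun y => (γ y).1) atBot (𝓝 1) := (continuous_fst.tendsto _).comp hlim
  have hW0 : Tendsto W atBot (𝓝 0) := by
    have := ((hlc.tendsto _).comp hlim).sqrt
    simpa [lyapunov, W] using this
  set ξ₀ := fun t => ∫ u in (0 : ℝ)..t, W u with hξ₀
  have hdξ₀ : ∀ t, HasDerivAt ξ₀ (W t) t := fun t =>
    intervalIntegral.integral_hasDerivAt_right (hWc.intervalIntegrable _ _)
      (hWc.stronglyMeasurableAtFilter _ _) hWc.continuousAt
  have hmono : StrictMono ξ₀ := strictMono_of_deriv_pos fun t => by rw [(hdξ₀ t).deriv]; exact hW t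
  -- `W ≤ 4 W'` near `-∞` makes the integral of `W` converge there
  obtain ⟨T, hT⟩ := eventually_atBot.1 (hX.eventually (lt_mem_nhds (by norm_num : (1 / 2 : ℝ) < 1)))
  have hanti : AntitoneOn (fun t => ξ₀ t - 4 * W t) (Iic T) := by
    have hd : ∀ t, HasDerivAt (fun t => ξ₀ t - 4 * W t) (W t - 4 * ((γ t).1 ^ 2 * W t)) t :=
      fun t => (hdξ₀ t).sub ((hdW t).const_mul 4)
    refine antitoneOn_of_deriv_nonpos (convex_Iic T) (HasDerivAt.continuousOn fun t _ => hd t)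
      (fun t _ => (hd t).differentiableAt.differentiableWithinAt) fun t ht => ?_
    rw [(hd t).deriv]
    have ht' : t ∈ Iic T := interior_subset ht
    have h1 := hT t ht'
    have h2 : 1 ≤ 4 * (γ t).1 ^ 2 := by nlinarith
    nlinarith [hW t]
  have hbdd : ∀ t, ξ₀ T - 4 * W T ≤ ξ₀ t := by
    intro t
    rcases le_total t T with ht | ht
    · have := hanti ht (mem_Iic.2 le_rfl) ht
      simp only at this
      linarith [hW t]
    · linarith [hmono.monotone ht, hW T]
  have hlim₀ := tendsto_atBot_ciInf hmono.monotone
    ⟨ξ₀ T - 4 * W T, by rintro _ ⟨t, rfl⟩; exact hbdd t⟩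
  set l := ⨅ t, ξ₀ t with hl
  have hle : ∀ t, l ≤ ξ₀ t := fun t =>
    ciInf_le ⟨ξ₀ T - 4 * W T, by rintro _ ⟨t, rfl⟩; exact hbdd t⟩ t
  have hd : ∀ t, HasDerivAt (fun t => ξ₀ t - l) (W t) t := fun t => (hdξ₀ t).sub_const l
  have hbot : Tendsto (fun t => ξ₀ t - l) atBot (𝓝 0) := by simpa using hlim₀.sub_const l
  refine ⟨fun t => ξ₀ t - l, fun t => ?_, hd, hbot, ?_, ?_⟩
  · have := hmono (sub_one_lt t)
    linarith [hle (t - 1)]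
  · have hm : MonotoneOn (fun t => ξ₀ t - W 0 * t) (Ici 0) := by
      have hd : ∀ t, HasDerivAt (fun t => ξ₀ t - W 0 * t) (W t - W 0 * 1) t :=
        fun t => (hdξ₀ t).sub ((hasDerivAt_id t).const_mul (W 0))
      refine monotoneOn_of_deriv_nonneg (convex_Ici 0) (HasDerivAt.continuousOn fun t _ => hd t)
        (fun t _ => (hd t).differentiableAt.differentiableWithinAt) fun t ht => ?_
      rw [(hd t).deriv, mul_one]
      have ht' : t ∈ Ici (0 : ℝ) := interior_subset ht
      exact sub_nonneg.2 (hWmono ht')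
    have hlin : Tendsto (fun t : ℝ => W 0 * t + (ξ₀ 0 - l)) atTop atTop :=
      tendsto_atTop_add_const_right _ _ (tendsto_id.const_mul_atTop (hW 0))
    refine tendsto_atTop_mono' _ ?_ hlin
    filter_upwards [eventually_ge_atTop 0] with t ht
    have := hm (mem_Ici.2 le_rfl) (mem_Ici.2 ht) ht
    simp only [mul_zero, sub_zero] at this
    linarith
  · refine HasDerivAt.lhopital_zero_atBot (Eventually.of_forall hdW) (Eventually.of_forall hd)
      (Eventually.of_forall fun t => (hW t).ne') hW0 hbot ?_
    have := hX.pow 2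
    rw [one_pow] at this
    refine this.congr fun t => ?_
    rw [mul_div_cancel_right₀ _ (hW t).ne']

theorem exists_arclength_inverse {ξ ξ' : ℝ → ℝ} (hpos : ∀ t, 0 < ξ t)
    (hd : ∀ t, HasDerivAt ξ (ξ' t) t) (hξ' : ∀ t, 0 < ξ' t) (hbot : Tendsto ξ atBot (𝓝 0))
    (htop : Tendsto ξ atTop atTop) :
    ∃ y : ℝ → ℝ, (∀ t, y (ξ t) = t) ∧ (∀ x, 0 < x → ξ (y x) = x) ∧
      (∀ x, 0 < x → HasDerivAt y (1 / ξ' (y x)) x) ∧ Tendsto y (𝓝[>] 0) atBot := by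
  -- `log ξ` is a diffeomorphism of `ℝ`
  obtain ⟨g, hg1, hg2, hg⟩ := exists_hasDerivAt_inverse (f := fun t => Real.log (ξ t))
    (f' := fun t => ξ' t / ξ t) (fun t => (hd t).log (hpos t).ne')
    (fun t => div_pos (hξ' t) (hpos t))
    (Real.tendsto_log_nhdsGT_zero.comp (tendsto_nhdsWithin_iff.2
      ⟨hbot, Eventually.of_forall hpos⟩))
    (Real.tendsto_log_atTop.comp htop)
  have h2 : ∀ x, 0 < x → ξ (g (Real.log x)) = x := fun x hx =>
    Real.log_injOn_pos (hpos _) hx (hg2 (Real.log x))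
  refine ⟨fun x => g (Real.log x), hg1, h2, fun x hx => ?_, ?_⟩
  · refine ((hg (Real.log x)).comp x (Real.hasDerivAt_log hx.ne')).congr_deriv ?_
    rw [h2 x hx]
    have := (hξ' (g (Real.log x))).ne'
    field_simp
  · have hmono : StrictMono ξ := strictMono_of_deriv_pos fun t => by
      rw [(hd t).deriv]; exact hξ' t
    refine tendsto_atBot.2 fun b => ?_
    filter_upwards [Ioo_mem_nhdsGT (hpos b)] with x hx
    refine (hmono.lt_iff_lt.1 ?_).le
    rw [h2 x hx.1]
    exact hx.2

end Trajectory

/-! ### The soliton of a trajectory -/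

section Soliton

variable {n : ℕ} {γ : ℝ → ℝ × ℝ}

theorem contDiff_sqrt_lyapunov (h : ∀ y, HasDerivAt γ (planarField (1 / √(n : ℝ)) (γ y)) y)
    (hL : ∀ y, 0 < lyapunov (γ y)) :
    ContDiff ℝ ∞ γ ∧ ContDiff ℝ ∞ fun t => √(lyapunov (γ t)) := by
  have hγ : ContDiff ℝ ∞ γ := contDiffOn_univ.1
    (contDiffOn_of_autonomous isOpen_univ (contDiff_planarField _) fun y _ => h y)
  refine ⟨hγ, ContDiff.sqrt ?_ fun t => (hL t).ne'⟩
  unfold lyapunov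
  exact (contDiff_const.sub (hγ.fst.pow 2)).sub (hγ.snd.pow 2)

/-- The warping function `ψ = √(n(n-1)) W / Y` of the soliton of a trajectory, as a function of `y`,
with the normalization `W = √(1 - X² - Y²)`. -/
def trajectoryRadius (n : ℕ) (γ : ℝ → ℝ × ℝ) (t : ℝ) : ℝ :=
  √((n : ℝ) * ((n : ℝ) - 1)) * √(lyapunov (γ t)) / (γ t).2

/-- The potential `φ = n log ψ - y` of the soliton of a trajectory, as a function of `y`. The
equation `W⁻¹ = -φ' + n ψ'/ψ` with `W⁻¹ = dy/dx` forces this form up to a constant. -/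
def trajectoryPotential (n : ℕ) (γ : ℝ → ℝ × ℝ) (t : ℝ) : ℝ :=
  n * Real.log (trajectoryRadius n γ t) - t

/-- A trajectory, reparametrized by `dx = W dy`, yields a soliton whose phase variables are `W`,
`X`, `Y`. -/
theorem solitonODE_of_trajectory (hn : 2 ≤ n)
    (h : ∀ y, HasDerivAt γ (planarField (1 / √(n : ℝ)) (γ y)) y)
    (hQ : ∀ y, γ y ∈ openQuarterDisk) {y : ℝ → ℝ}
    (hy : ∀ x, 0 < x → HasDerivAt y (1 / √(lyapunov (γ (y x)))) x) :
    SolitonODE n (fun x => trajectoryRadius n γ (y x)) (fun x => trajectoryPotential n γ (y x)) ∧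
    ∀ x, 0 < x →
      phaseW n (fun x => trajectoryRadius n γ (y x)) (fun x => trajectoryPotential n γ (y x)) x =
        √(lyapunov (γ (y x))) ∧
      phaseX n (fun x => trajectoryRadius n γ (y x)) (fun x => trajectoryPotential n γ (y x)) x =
        (γ (y x)).1 ∧
      phaseY n (fun x => trajectoryRadius n γ (y x)) (fun x => trajectoryPotential n γ (y x)) x =
        (γ (y x)).2 := by
  have hQ' := fun y => mem_openQuarterDisk_iff.1 (hQ y)
  have hL := fun y => (hQ' y).2.2
  have hs := sqrt_dim_pos hn
  have hκ := kappa_pos hn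
  have hκ2 : √((n : ℝ) * ((n : ℝ) - 1)) ^ 2 = √(n : ℝ) ^ 2 * (√(n : ℝ) ^ 2 - 1) := by
    have hnn : (1 : ℝ) ≤ n := by exact_mod_cast (by omega : 1 ≤ n)
    rw [Real.sq_sqrt (mul_nonneg n.cast_nonneg (by linarith)), Real.sq_sqrt n.cast_nonneg]
  have hns : (n : ℝ) = √(n : ℝ) ^ 2 := (Real.sq_sqrt n.cast_nonneg).symm
  obtain ⟨hγs, hWs⟩ := contDiff_sqrt_lyapunov h hL
  set ψ := fun x => trajectoryRadius n γ (y x) with hψ_def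
  set φ := fun x => trajectoryPotential n γ (y x) with hφ_def
  set κ := √((n : ℝ) * ((n : ℝ) - 1)) with hκ_def
  set s := √(n : ℝ) with hs_def
  -- the trajectory as a function of `x`
  set W := fun x => √(lyapunov (γ (y x))) with hW_def
  set X := fun x => (γ (y x)).1 with hX_def
  set Y := fun x => (γ (y x)).2 with hY_def
  have hW : ∀ x, 0 < W x := fun x => Real.sqrt_pos.2 (hL _)
  have hY : ∀ x, 0 < Y x := fun x => (hQ' _).2.1
  have hdW : ∀ x, 0 < x → HasDerivAt W (X x ^ 2) x := fun x hx => by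
    refine ((hasDerivAt_sqrt_lyapunov h hL (y x)).comp x (hy x hx)).congr_deriv ?_
    have := (hW x).ne'
    simp only [hW_def] at this
    rw [mul_one_div, mul_div_cancel_right₀ _ this]
  have hdX : ∀ x, 0 < x → HasDerivAt X ((X x ^ 3 - X x + 1 / s * Y x ^ 2) / W x) x :=
    fun x hx => ((hasDerivAt_fst (h (y x))).comp x (hy x hx)).congr_deriv (mul_one_div _ _)
  have hdY : ∀ x, 0 < x → HasDerivAt Y (Y x * (X x ^ 2 - 1 / s * X x) / W x) x :=
    fun x hx => ((hasDerivAt_snd (h (y x))).comp x (hy x hx)).congr_deriv (mul_one_div _ _)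
  have hψ : ∀ x, ψ x = κ * W x / Y x := fun x => rfl
  have hψpos : ∀ x, 0 < ψ x := fun x => div_pos (mul_pos hκ (hW x)) (hY x)
  have hdψ : ∀ x, 0 < x → HasDerivAt ψ (κ * (1 / s) * X x / Y x) x := fun x hx => by
    refine (((hdW x hx).const_mul κ).div (hdY x hx) (hY x).ne').congr_deriv ?_
    have := (hW x).ne'
    have := (hY x).ne'
    field_simp
    ring
  have hdφ : ∀ x, 0 < x → HasDerivAt φ ((s * X x - 1) / W x) x := fun x hx => by
    refine ((((hdψ x hx).log (hψpos x).ne').const_mul (n : ℝ)).sub (hy x hx)).congr_deriv ?_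
    have := (hW x).ne'
    have := (hY x).ne'
    rw [hψ x, hns, show √(lyapunov (γ (y x))) = W x from rfl]
    field_simp
  have hψ1 : ∀ x, 0 < x → deriv ψ x = κ * (1 / s) * X x / Y x := fun x hx => (hdψ x hx).deriv
  have hφ1 : ∀ x, 0 < x → deriv φ x = (s * X x - 1) / W x := fun x hx => (hdφ x hx).deriv
  have hψ2 : ∀ x, 0 < x → deriv (deriv ψ) x =
      κ * (1 / s) / W x * ((1 / s * Y x ^ 2 - X x + 1 / s * X x ^ 2) / Y x) := fun x hx => by
    have heq : deriv ψ =ᶠ[𝓝 x] fun x => κ * (1 / s) * X x / Y x := by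
      filter_upwards [Ioi_mem_nhds hx] with u hu using hψ1 u hu
    rw [heq.deriv_eq, (((hdX x hx).const_mul (κ * (1 / s))).fun_div (hdY x hx) (hY x).ne').deriv]
    have := (hW x).ne'
    have := (hY x).ne'
    field_simp
    ring
  have hφ2 : ∀ x, 0 < x → deriv (deriv φ) x =
      (s * (1 / s * Y x ^ 2 - X x) + X x ^ 2) / W x ^ 2 := fun x hx => by
    have heq : deriv φ =ᶠ[𝓝 x] fun x => (s * X x - 1) / W x := by
      filter_upwards [Ioi_mem_nhds hx] with u hu using hφ1 u hu
    rw [heq.deriv_eq,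
      ((((hdX x hx).const_mul s).sub_const 1).fun_div (hdW x hx) (hW x).ne').deriv]
    have := (hW x).ne'
    field_simp
    ring
  have hyc : ContDiffOn ℝ ∞ y (Ioi 0) := contDiffOn_of_autonomous isOpen_Ioi
    (G := fun t => 1 / √(lyapunov (γ t)))
    (contDiff_const.div hWs fun t => (Real.sqrt_pos.2 (hL t)).ne') fun x hx => hy x hx
  have hψs : ContDiffOn ℝ ∞ ψ (Ioi 0) := by
    have : ContDiff ℝ ∞ (trajectoryRadius n γ) :=
      (contDiff_const.mul hWs).div hγs.snd fun t => (hQ' t).2.1.ne'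
    exact this.comp_contDiffOn hyc
  have hφs : ContDiffOn ℝ ∞ φ (Ioi 0) :=
    (contDiffOn_const.mul (hψs.log fun x _ => (hψpos x).ne')).sub hyc
  have hphaseW : ∀ x, 0 < x → phaseW n ψ φ x = W x := fun x hx => by
    rw [phaseW, hψ1 x hx, hφ1 x hx, hψ x, hns]
    have := (hW x).ne'
    have := (hY x).ne'
    have e : -((s * X x - 1) / W x) + s ^ 2 * (κ * (1 / s) * X x / Y x / (κ * W x / Y x)) =
      1 / W x := by field_simp; ring
    rw [e, one_div_one_div]
  refine ⟨⟨hψs, fun x _ => hψpos x, hφs, fun x hx => ?_, fun x hx => ?_⟩,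
    fun x hx => ⟨hphaseW x hx, ?_, ?_⟩⟩
  · rw [hφ2 x hx, hψ2 x hx, hψ x, hns]
    have := (hW x).ne'
    have := (hY x).ne'
    field_simp
  · rw [hψ2 x hx, hψ x, hψ1 x hx, hφ1 x hx, hns]
    have := (hW x).ne'
    have := (hY x).ne'
    field_simp
    rw [hκ2]
    ring
  · change _ = X x
    rw [phaseX, hphaseW x hx, hψ1 x hx, hψ x, ← hs_def]
    have := (hW x).ne'
    have := (hY x).ne'
    field_simp
  · change _ = Y x
    rw [phaseY, hphaseW x hx, hψ x, ← hκ_def]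
    have := (hW x).ne'
    have := (hY x).ne'
    field_simp

/-- `ψ ∼ A W^{1/√n}` at `y = -∞`: the logarithm of the quotient has derivative `a X (1 - X) ≥ 0`,
whose integral towards `-∞` converges. -/
theorem exists_tendsto_trajectoryRadius {n : ℕ} (hn : 2 ≤ n)
    (h : ∀ y, HasDerivAt γ (planarField (1 / √(n : ℝ)) (γ y)) y)
    (hQ : ∀ y, γ y ∈ openQuarterDisk) (hlim : Tendsto γ atBot (𝓝 (1, 0))) :
    ∃ A, 0 < A ∧ Tendsto (fun t => trajectoryRadius n γ t /
      √(lyapunov (γ t)) ^ (1 / √(n : ℝ))) atBot (𝓝 A) := by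
  have hQ' := fun y => mem_openQuarterDisk_iff.1 (hQ y)
  have hL := fun y => (hQ' y).2.2
  have hs := sqrt_dim_pos hn
  have hκ := kappa_pos hn
  have hs1 : 1 < √(n : ℝ) := Real.lt_sqrt_of_sq_lt (by
    rw [one_pow]; exact_mod_cast (by omega : 1 < n))
  have hX : Tendsto (fun y => (γ y).1) atBot (𝓝 1) := (continuous_fst.tendsto _).comp hlim
  set a := 1 / √(n : ℝ) with ha_def
  have ha : 0 < a := by positivity
  have ha1 : a < 1 := by rw [ha_def, div_lt_one hs]; exact hs1
  set κ := √((n : ℝ) * ((n : ℝ) - 1)) with hκ_def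
  set W := fun t => √(lyapunov (γ t)) with hW_def
  have hW : ∀ t, 0 < W t := fun t => Real.sqrt_pos.2 (hL t)
  have hdW : ∀ t, HasDerivAt W ((γ t).1 ^ 2 * W t) t := hasDerivAt_sqrt_lyapunov h hL
  set f := fun t => (1 - a) * Real.log (W t) - Real.log (γ t).2 with hf_def
  have hdf : ∀ t, HasDerivAt f (a * (γ t).1 * (1 - (γ t).1)) t := fun t => by
    refine ((((hdW t).log (hW t).ne').const_mul (1 - a)).sub
      ((hasDerivAt_snd (h t)).log (hQ' t).2.1.ne')).congr_deriv ?_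
    simp only [planarField]
    have := (hW t).ne'
    have := (hQ' t).2.1.ne'
    field_simp
    ring
  have hlt1 : ∀ t, (γ t).1 < 1 := fun t => by
    have := hL t
    rw [lyapunov] at this
    nlinarith [(hQ' t).1, sq_nonneg (γ t).2]
  have hmono : Monotone f := monotone_of_deriv_nonneg (fun t => (hdf t).differentiableAt)
    fun t => by
      rw [(hdf t).deriv]
      exact mul_nonneg (mul_nonneg ha.le (hQ' t).1.le) (sub_nonneg.2 (hlt1 t).le)
  -- `f' ≤ a (1 - X ^ 2) = a (L + Y ^ 2)`, and `L`, `Y ^ 2` are dominated by their derivatives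
  set M := a * (2 + 2 / (1 - a)) with hM_def
  obtain ⟨T, hT⟩ := eventually_atBot.1 (hX.eventually
    (lt_mem_nhds (by linarith : (1 + a) / 2 < 1)))
  set g := fun t => f t - M * (lyapunov (γ t) + (γ t).2 ^ 2) with hg_def
  have hdg : ∀ t, HasDerivAt g (a * (γ t).1 * (1 - (γ t).1) - M * (2 * (γ t).1 ^ 2 *
      lyapunov (γ t) + 2 * ((γ t).2 ^ 2 * ((γ t).1 * ((γ t).1 - a))))) t := fun t => by
    refine ((hdf t).sub (((hasDerivAt_lyapunov h t).add
      ((hasDerivAt_snd (h t)).pow 2)).const_mul M)).congr_deriv ?_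
    simp only [planarField]
    ring
  have hanti : AntitoneOn g (Iic T) := by
    refine antitoneOn_of_deriv_nonpos (convex_Iic T) (HasDerivAt.continuousOn fun t _ => hdg t)
      (fun t _ => (hdg t).differentiableAt.differentiableWithinAt) fun t ht => ?_
    have ht' : t ∈ Iic T := interior_subset ht
    rw [(hdg t).deriv]
    have hXt := hT t ht'
    have hLt := hL t
    have h1 := hlt1 t
    have hLY : lyapunov (γ t) + (γ t).2 ^ 2 = 1 - (γ t).1 ^ 2 := by rw [lyapunov]; ring
    set X := (γ t).1 with hX_def
    set Y := (γ t).2 with hY_def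
    set L := lyapunov (γ t) with hL_def
    have h2 : a * X * (1 - X) ≤ a * (L + Y ^ 2) := by
      rw [hLY]
      nlinarith [mul_pos ha (sub_pos.2 h1)]
    have hXh : 1 / 2 < X := by linarith
    have h3 : a * L ≤ M * (2 * X ^ 2 * L) := by
      have h1a : 0 < 2 / (1 - a) := div_pos two_pos (by linarith)
      have hM2 : 2 * a ≤ M := by rw [hM_def]; nlinarith
      have hX2 : 1 / 4 ≤ X ^ 2 := by nlinarith
      have h4 : a ≤ M * (2 * X ^ 2) := by nlinarith
      calc a * L ≤ M * (2 * X ^ 2) * L := by gcongr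
        _ = _ := by ring
    have h4 : a * Y ^ 2 ≤ M * (2 * (Y ^ 2 * (X * (X - a)))) := by
      have h5 : (1 - a) / 4 ≤ X * (X - a) := by nlinarith
      have h6 : a = 2 * (a * (2 / (1 - a))) * ((1 - a) / 4) := by
        have : (1 - a) ≠ 0 := by linarith
        field_simp; norm_num
      have h7 : a * (2 / (1 - a)) ≤ M := by rw [hM_def]; nlinarith
      have h8 : 0 < a * (2 / (1 - a)) := mul_pos ha (div_pos two_pos (by linarith))
      have h9 : a ≤ 2 * M * (X * (X - a)) := by
        calc a = 2 * (a * (2 / (1 - a))) * ((1 - a) / 4) := h6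
          _ ≤ 2 * M * (X * (X - a)) := by
            have : 0 < (1 - a) / 4 := by linarith
            gcongr
      nlinarith [sq_nonneg Y]
    nlinarith
  have hbdd : ∀ t, g T ≤ f t := by
    have hLY : ∀ t, 0 ≤ M * (lyapunov (γ t) + (γ t).2 ^ 2) := fun t => by
      have := hL t
      have : 0 < 2 / (1 - a) := div_pos two_pos (by linarith)
      positivity
    intro t
    rcases le_total t T with ht | ht
    · have h1 := hanti ht (mem_Iic.2 le_rfl) ht
      have h2 := hLY t
      simp only [hg_def] at h1 ⊢
      linarith
    · have h1 := hmono ht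
      have h2 := hLY T
      simp only [hg_def]
      linarith
  have hlimf := tendsto_atBot_ciInf hmono ⟨g T, by rintro _ ⟨t, rfl⟩; exact hbdd t⟩
  refine ⟨κ * Real.exp (⨅ t, f t), by positivity,
    (((Real.continuous_exp.tendsto _).comp hlimf).const_mul κ).congr fun t => ?_⟩
  have hWt := hW t
  have hYt := (hQ' t).2.1
  simp only [Function.comp_apply, hf_def, trajectoryRadius, ← hκ_def]
  rw [Real.exp_sub, Real.exp_log hYt, mul_comm (1 - a), ← Real.rpow_def_of_pos hWt,
    Real.rpow_sub hWt, Real.rpow_one]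
  change _ = κ * W t / _ / W t ^ a
  field_simp

end Soliton

/-! ### Endpoint behaviour, homotheties and classification -/

section Classification

variable {n : ℕ}

theorem hasBryantAsymptotics_of_correspondsTo (hn : 2 ≤ n) {ψ φ : ℝ → ℝ} {γ : ℝ → ℝ × ℝ}
    (h : SolitonODE n ψ φ) (hc : CorrespondsTo n ψ φ γ) (hγ : Tendsto γ atTop (𝓝 (0, 0))) :
    HasBryantAsymptotics ψ φ := by
  obtain ⟨y, hbij, hy⟩ := hc
  have hmono : StrictMonoOn y (Ioi 0) := strictMonoOn_of_deriv_pos (convex_Ioi 0)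
    (HasDerivAt.continuousOn fun x hx => (hy x hx).2.1) fun x hx => by
      rw [interior_Ioi] at hx
      rw [(hy x hx).2.1.deriv]
      exact one_div_pos.2 (hy x hx).1
  have htop : Tendsto y atTop atTop := by
    refine tendsto_atTop.2 fun b => ?_
    obtain ⟨x₀, hx₀, rfl⟩ := hbij.surjOn (mem_univ b)
    filter_upwards [eventually_ge_atTop x₀] with x hx
    exact hmono.monotoneOn hx₀ (lt_of_lt_of_le hx₀ hx) hx
  refine h.hasBryantAsymptotics hn (fun x hx => (hy x hx).1) ((hγ.comp htop).congr' ?_)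
  filter_upwards [eventually_gt_atTop 0] with x hx using (hy x hx).2.2.symm

theorem hasSingularProfile_of_trajectory (hn : 2 ≤ n) {γ : ℝ → ℝ × ℝ}
    (h : ∀ y, HasDerivAt γ (planarField (1 / √(n : ℝ)) (γ y)) y)
    (hQ : ∀ y, γ y ∈ openQuarterDisk) (hlim : Tendsto γ atBot (𝓝 (1, 0))) {ξ y : ℝ → ℝ}
    (hξ : Tendsto (fun t => √(lyapunov (γ t)) / ξ t) atBot (𝓝 1))
    (hξy : ∀ x, 0 < x → ξ (y x) = x)
    (hy : ∀ x, 0 < x → HasDerivAt y (1 / √(lyapunov (γ (y x)))) x)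
    (hy0 : Tendsto y (𝓝[>] 0) atBot) :
    HasSingularProfile n (fun x => trajectoryRadius n γ (y x))
      (fun x => trajectoryPotential n γ (y x)) := by
  have hL := fun y => (mem_openQuarterDisk_iff.1 (hQ y)).2.2
  have hs := sqrt_dim_pos hn
  have hs1 : 1 < √(n : ℝ) := Real.lt_sqrt_of_sq_lt (by
    rw [one_pow]; exact_mod_cast (by omega : 1 < n))
  have hW : ∀ t, 0 < √(lyapunov (γ t)) := fun t => Real.sqrt_pos.2 (hL t)
  constructor
  · obtain ⟨A, hA, hlimA⟩ := exists_tendsto_trajectoryRadius hn h hQ hlim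
    refine ⟨A, hA, ?_⟩
    rw [isEquivalent_iff_tendsto_one]
    · have h1 : Tendsto (fun t => trajectoryRadius n γ t / √(lyapunov (γ t)) ^ (1 / √(n : ℝ)) *
          (√(lyapunov (γ t)) / ξ t) ^ (1 / √(n : ℝ)) / A) atBot (𝓝 1) := by
        have := (hlimA.mul (hξ.rpow_const (p := 1 / √(n : ℝ)) (Or.inl one_ne_zero))).div_const A
        rwa [Real.one_rpow, mul_one, div_self hA.ne'] at this
      refine (h1.comp hy0).congr' ?_
      filter_upwards [self_mem_nhdsWithin] with x hx
      have hx0 : 0 < x := hx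
      have h2 := Real.rpow_pos_of_pos (hW (y x)) (1 / √(n : ℝ))
      have h3 := Real.rpow_pos_of_pos hx0 (1 / √(n : ℝ))
      simp only [Function.comp_apply, Pi.div_apply]
      rw [hξy x hx0, Real.div_rpow (hW _).le hx0.le]
      field_simp
    · filter_upwards [self_mem_nhdsWithin] with x hx
      exact (mul_pos hA (Real.rpow_pos_of_pos hx _)).ne'
  · rw [isEquivalent_iff_tendsto_one]
    · have hX : Tendsto (fun y => (γ y).1) atBot (𝓝 1) := (continuous_fst.tendsto _).comp hlim
      have h1 : Tendsto (fun t => (√(n : ℝ) * (γ t).1 - 1) / (√(n : ℝ) - 1) *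
          (√(lyapunov (γ t)) / ξ t)⁻¹) atBot (𝓝 1) := by
        have := (((hX.const_mul (√(n : ℝ))).sub_const 1).div_const (√(n : ℝ) - 1)).mul
          (hξ.inv₀ one_ne_zero)
        rwa [mul_one, div_self (by linarith), inv_one, mul_one] at this
      obtain ⟨-, hphase⟩ := solitonODE_of_trajectory hn h hQ hy
      refine (h1.comp hy0).congr' ?_
      filter_upwards [self_mem_nhdsWithin] with x hx
      have hx0 : 0 < x := hx
      obtain ⟨p1, p2, -⟩ := hphase x hx0
      have hWx := hW (y x)
      have : √(n : ℝ) - 1 ≠ 0 := by linarith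
      simp only [Function.comp_apply, Pi.div_apply]
      rw [deriv_potential_eq_of_phase hn (by rw [p1]; exact hWx), p1, p2, hξy x hx0]
      field_simp
    · filter_upwards [self_mem_nhdsWithin] with x hx
      exact div_ne_zero (by linarith) (ne_of_gt hx)

/-- The metric alone determines the phase point wherever `ψ' ≠ 0`, and homothetic metrics have the
same phase points. -/
theorem phase_eq_of_homothetic {ψ₁ φ₁ ψ₂ φ₂ : ℝ → ℝ} (h₁ : SolitonODE n ψ₁ φ₁)
    (h₂ : SolitonODE n ψ₂ φ₂) {k : ℝ} (hk : 0 < k)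
    (hψ : ∀ x, 0 < x → ψ₂ (k * x) = k * ψ₁ x) {x : ℝ} (hx : 0 < x) (hne : deriv ψ₁ x ≠ 0) :
    phaseX n ψ₂ φ₂ (k * x) = phaseX n ψ₁ φ₁ x ∧ phaseY n ψ₂ φ₂ (k * x) = phaseY n ψ₁ φ₁ x := by
  have hd1 : ∀ x, 0 < x → deriv ψ₂ (k * x) = deriv ψ₁ x := by
    intro x hx
    have e1 : HasDerivAt (fun x => ψ₂ (k * x)) (deriv ψ₂ (k * x) * (k * 1)) x :=
      (hasDerivAt_of_contDiffOn_Ioi h₂.smooth_metric (mul_pos hk hx)).comp x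
        ((hasDerivAt_id x).const_mul k)
    have e2 : HasDerivAt (fun x => ψ₂ (k * x)) (k * deriv ψ₁ x) x :=
      ((hasDerivAt_of_contDiffOn_Ioi h₁.smooth_metric hx).const_mul k).congr_of_eventuallyEq (by
        filter_upwards [Ioi_mem_nhds hx] with u hu using hψ u hu)
    have e3 := e1.unique e2
    exact mul_left_cancel₀ hk.ne' (by linarith)
  have hd2 : k * deriv (deriv ψ₂) (k * x) = deriv (deriv ψ₁) x := by
    have e1 : HasDerivAt (fun x => deriv ψ₂ (k * x)) (deriv (deriv ψ₂) (k * x) * (k * 1)) x :=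
      (hasDerivAt_of_contDiffOn_Ioi (contDiffOn_deriv_Ioi h₂.smooth_metric)
        (mul_pos hk hx)).comp x ((hasDerivAt_id x).const_mul k)
    have e2 : HasDerivAt (fun x => deriv ψ₂ (k * x)) (deriv (deriv ψ₁) x) x :=
      (hasDerivAt_of_contDiffOn_Ioi (contDiffOn_deriv_Ioi h₁.smooth_metric)
        hx).congr_of_eventuallyEq (by
        filter_upwards [Ioi_mem_nhds hx] with u hu using hd1 u hu)
    have e3 := e1.unique e2
    linarith
  have hp := (h₁.pos x hx).ne'
  have hk0 := hk.ne'
  -- the spherical equation determines the potential wherever `ψ' ≠ 0`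
  have hφ : deriv φ₂ (k * x) = deriv φ₁ x / k := by
    have e1 := h₁.spherical x hx
    have e2 := h₂.spherical (k * x) (mul_pos hk hx)
    rw [hψ x hx, hd1 x hx] at e2
    have e3 : k * ψ₁ x * deriv (deriv ψ₂) (k * x) = ψ₁ x * deriv (deriv ψ₁) x := by
      rw [← hd2]; ring
    rw [e3, e1] at e2
    rw [eq_div_iff hk0]
    refine mul_left_cancel₀ (mul_ne_zero hp hne) ?_
    linarith
  have hW : phaseW n ψ₂ φ₂ (k * x) = k * phaseW n ψ₁ φ₁ x := by
    rw [phaseW, phaseW, hφ, hd1 x hx, hψ x hx]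
    rw [show -(deriv φ₁ x / k) + n * (deriv ψ₁ x / (k * ψ₁ x)) =
      (-deriv φ₁ x + n * (deriv ψ₁ x / ψ₁ x)) / k by field_simp]
    rw [one_div_div, mul_one_div]
  constructor
  · rw [phaseX, phaseX, hW, hd1 x hx, hψ x hx]
    field_simp
  · rw [phaseY, phaseY, hW, hψ x hx]
    field_simp

/-- The phase curve of a soliton, reparametrized by `y` (so that `r` is the inverse of `x ↦ y`), is
a trajectory on all of `ℝ` emanating from `(1, 0)`. -/
theorem exists_singularTrajectory_of_soliton (hn : 2 ≤ n) {ψ φ : ℝ → ℝ} (h : SolitonODE n ψ φ)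
    (hQ : ∀ x, 0 < x → (phaseX n ψ φ x, phaseY n ψ φ x) ∈ openQuarterDisk)
    (hlim : Tendsto (fun x => (phaseX n ψ φ x, phaseY n ψ φ x)) (𝓝[>] 0) (𝓝 (1, 0))) :
    (∀ x, 0 < x → 0 < phaseW n ψ φ x) ∧ ∃ r : ℝ → ℝ, (∀ u, 0 < r u) ∧
      (∀ u, HasDerivAt r (phaseW n ψ φ (r u)) u) ∧ Tendsto r atBot (𝓝 0) ∧
      IsSingularTrajectory n univ fun u => (phaseX n ψ φ (r u), phaseY n ψ φ (r u)) := by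
  have hn1 : 1 ≤ n := by omega
  have hκ := kappa_pos hn
  have hW : ∀ x, 0 < x → 0 < phaseW n ψ φ x := by
    intro x hx
    have h1 := (hQ x hx).2.1
    simp only [phaseY] at h1
    have h2 := (div_pos_iff_of_pos_right (h.pos x hx)).1 h1
    exact (mul_pos_iff_of_pos_left hκ).1 h2
  refine ⟨hW, ?_⟩
  set W := phaseW n ψ φ with hW_def
  have hdW : ∀ x, 0 < x → HasDerivAt W (phaseX n ψ φ x ^ 2) x := fun x hx =>
    h.hasDerivAt_phaseW hx (hW x hx).ne'
  obtain ⟨C, hC⟩ := h.exists_lyapunov_eq hn1 hW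
  have hL : ∀ x, 0 < x → 0 < lyapunov (phaseX n ψ φ x, phaseY n ψ φ x) := fun x hx =>
    (mem_openQuarterDisk_iff.1 (hQ x hx)).2.2
  have hC0 : 0 < C := by
    have := hL 1 one_pos
    rw [hC 1 one_pos] at this
    exact pos_of_mul_pos_left this (sq_nonneg _)
  have hW0 : Tendsto W (𝓝[>] 0) (𝓝 0) := by
    have hlc : Continuous fun p : ℝ × ℝ => lyapunov p := by unfold lyapunov; fun_prop
    have h1 : Tendsto (fun x => √(lyapunov (phaseX n ψ φ x, phaseY n ψ φ x) / C)) (𝓝[>] 0)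
        (𝓝 0) := by
      have := (((hlc.tendsto _).comp hlim).div_const C).sqrt
      simpa [lyapunov] using this
    refine h1.congr' ?_
    filter_upwards [self_mem_nhdsWithin] with x hx
    rw [hC x hx, mul_div_cancel_left₀ _ hC0.ne', Real.sqrt_sq (hW x hx).le]
  -- `W' = X ^ 2 < 1` and `W → 0`, hence `W ≤ x` and the parameter `y` covers all of `ℝ`
  have hWle : ∀ x, 0 < x → W x ≤ x := by
    have hd : ∀ x ∈ Ioi (0 : ℝ), HasDerivAt (fun x => W x - x) (phaseX n ψ φ x ^ 2 - 1) x :=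
      fun x hx => (hdW x hx).sub (hasDerivAt_id x)
    have hanti : AntitoneOn (fun x => W x - x) (Ioi 0) := by
      refine antitoneOn_of_deriv_nonpos (convex_Ioi 0) (HasDerivAt.continuousOn hd)
        (fun x hx => (hd x (interior_subset hx)).differentiableAt.differentiableWithinAt)
        fun x hx => ?_
      have hx' : x ∈ Ioi (0 : ℝ) := interior_subset hx
      rw [(hd x hx').deriv]
      have := hL x hx'
      simp only [lyapunov] at this
      nlinarith [sq_nonneg (phaseY n ψ φ x)]
    intro x hx
    have hl : Tendsto (fun x => W x - x) (𝓝[>] 0) (𝓝 0) := by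
      simpa using hW0.sub (tendsto_nhdsWithin_of_tendsto_nhds (s := Ioi (0 : ℝ)) tendsto_id)
    have := ge_of_tendsto hl (b := W x - x) (by
      filter_upwards [Ioo_mem_nhdsGT hx] with u hu
      exact hanti hu.1 hx hu.2.le)
    linarith
  -- the substitution `x = exp t` replaces `(0, ∞)` by `ℝ`: `f t = y (exp t) - y 1`
  have hWc : Continuous fun t => W (Real.exp t) := continuous_iff_continuousAt.2 fun t =>
    ((hdW _ (Real.exp_pos t)).continuousAt).comp Real.continuous_exp.continuousAt
  have hq : Continuous fun t => Real.exp t / W (Real.exp t) :=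
    Real.continuous_exp.div hWc fun t => (hW _ (Real.exp_pos t)).ne'
  have hq1 : ∀ t, 1 ≤ Real.exp t / W (Real.exp t) := fun t => by
    rw [one_le_div (hW _ (Real.exp_pos t))]; exact hWle _ (Real.exp_pos t)
  have hdf : ∀ t, HasDerivAt (fun t => ∫ v in (0 : ℝ)..t, Real.exp v / W (Real.exp v))
      (Real.exp t / W (Real.exp t)) t := fun t =>
    intervalIntegral.integral_hasDerivAt_right (hq.intervalIntegrable _ _)
      (hq.stronglyMeasurableAtFilter _ _) hq.continuousAt
  set f := fun t => ∫ v in (0 : ℝ)..t, Real.exp v / W (Real.exp v) with hf_def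
  have hf0 : f 0 = 0 := by simp [hf_def]
  have hfm : Monotone fun t => f t - t := monotone_of_deriv_nonneg
    (fun t => ((hdf t).sub (hasDerivAt_id t)).differentiableAt) fun t => by
      have hd : HasDerivAt (fun t => f t - t) (Real.exp t / W (Real.exp t) - 1) t :=
        (hdf t).sub (hasDerivAt_id t)
      rw [hd.deriv]
      exact sub_nonneg.2 (hq1 t)
  have htop : Tendsto f atTop atTop := by
    refine tendsto_atTop_mono' _ ?_ tendsto_id
    filter_upwards [eventually_ge_atTop 0] with t ht
    have := hfm ht
    simp only [hf0, sub_zero] at this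
    simpa using this
  have hbot : Tendsto f atBot atBot := by
    refine tendsto_atBot_mono' _ ?_ tendsto_id
    filter_upwards [eventually_le_atBot 0] with t ht
    have := hfm ht
    simp only [hf0, sub_zero] at this
    simpa using this
  obtain ⟨g, hgf, hfg, hdg⟩ := exists_hasDerivAt_inverse hdf
    (fun t => one_pos.trans_le (hq1 t)) hbot htop
  have hgbot : Tendsto g atBot atBot := by
    have hgm : Monotone g := monotone_of_deriv_nonneg (fun t => (hdg t).differentiableAt)
      fun t => by rw [(hdg t).deriv]; exact one_div_nonneg.2 (zero_le_one.trans (hq1 _))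
    refine tendsto_atBot.2 fun b => ?_
    filter_upwards [eventually_le_atBot (f b)] with u hu
    exact (hgm hu).trans_eq (hgf b)
  have hdr : ∀ u, HasDerivAt (fun u => Real.exp (g u)) (W (Real.exp (g u))) u := fun u => by
    refine (hdg u).exp.congr_deriv ?_
    have := (hW _ (Real.exp_pos (g u))).ne'
    field_simp
  have hr0 : Tendsto (fun u => Real.exp (g u)) atBot (𝓝 0) := Real.tendsto_exp_atBot.comp hgbot
  refine ⟨fun u => Real.exp (g u), fun u => Real.exp_pos _, hdr, hr0, ?_, ?_, ?_⟩
  · rw [isSolutionOn_iff]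
    intro u _
    have hx := Real.exp_pos (g u)
    have hWx := (hW _ hx).ne'
    refine (((h.hasDerivAt_phaseX hn1 hx hWx).comp u (hdr u)).prodMk
      ((h.hasDerivAt_phaseY hn1 hx hWx).comp u (hdr u))).congr_deriv ?_
    simp only [planarField, ← hW_def]
    rw [div_mul_cancel₀ _ hWx, div_mul_cancel₀ _ hWx]
  · exact hlim.comp (tendsto_nhdsWithin_iff.2 ⟨hr0, Eventually.of_forall fun u => Real.exp_pos _⟩)
  · exact fun u _ => hQ _ (Real.exp_pos _)

/-- Two solitons with the same trajectory differ by a scaling `k = 1/√C`, where `1 - X² - Y² = C W²`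
along the first one, while `C = 1` for the second. -/
theorem isRescalingOf_of_trajectory (hn : 2 ≤ n) {ψ φ : ℝ → ℝ} (h : SolitonODE n ψ φ)
    (hW : ∀ x, 0 < x → 0 < phaseW n ψ φ x) {γ : ℝ → ℝ × ℝ}
    (hγ : ∀ y, HasDerivAt γ (planarField (1 / √(n : ℝ)) (γ y)) y)
    (hQ : ∀ y, γ y ∈ openQuarterDisk) {ξ y r : ℝ → ℝ} {c : ℝ}
    (hdξ : ∀ t, HasDerivAt ξ (√(lyapunov (γ t))) t) (hξ0 : Tendsto ξ atBot (𝓝 0))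
    (hξy : ∀ x, 0 < x → ξ (y x) = x)
    (hy : ∀ x, 0 < x → HasDerivAt y (1 / √(lyapunov (γ (y x)))) x)
    (hr : ∀ u, 0 < r u) (hdr : ∀ u, HasDerivAt r (phaseW n ψ φ (r u)) u)
    (hr0 : Tendsto r atBot (𝓝 0))
    (heq : ∀ u, (phaseX n ψ φ (r u), phaseY n ψ φ (r u)) = γ (u + c)) :
    ∃ k, 0 < k ∧ IsRescalingOf k ψ φ (fun x => trajectoryRadius n γ (y x))
      (fun x => trajectoryPotential n γ (y x)) := by
  have hn1 : 1 ≤ n := by omega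
  have hL := fun y => (mem_openQuarterDisk_iff.1 (hQ y)).2.2
  have hs := sqrt_dim_pos hn
  obtain ⟨C, hC⟩ := h.exists_lyapunov_eq hn1 hW
  have hC0 : 0 < C := by
    have := hL (0 + c)
    rw [← heq, hC _ (hr 0)] at this
    exact pos_of_mul_pos_left this (sq_nonneg _)
  have hsC : 0 < √C := Real.sqrt_pos.2 hC0
  have hWL : ∀ u, √(lyapunov (γ (u + c))) = √C * phaseW n ψ φ (r u) := fun u => by
    rw [← heq, hC _ (hr u), Real.sqrt_mul hC0.le, Real.sqrt_sq (hW _ (hr u)).le]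
  -- both arc lengths vanish at `-∞`, so they are proportional
  have hξr : ∀ u, ξ (u + c) = √C * r u := by
    have hd : ∀ u, HasDerivAt (fun u => ξ (u + c) - √C * r u) 0 u := fun u => by
      refine (((hdξ (u + c)).comp_add_const u c).sub ((hdr u).const_mul (√C))).congr_deriv ?_
      rw [hWL, sub_self]
    have hconst : ∀ u v, ξ (u + c) - √C * r u = ξ (v + c) - √C * r v :=
      is_const_of_deriv_eq_zero (fun u => (hd u).differentiableAt) fun u => (hd u).deriv
    intro u
    have h1 : Tendsto (fun u => ξ (u + c) - √C * r u) atBot (𝓝 (0 - √C * 0)) :=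
      (hξ0.comp (tendsto_atBot_add_const_right _ c tendsto_id)).sub (hr0.const_mul (√C))
    have h2 : Tendsto (fun v => ξ (v + c) - √C * r v) atBot (𝓝 (ξ (u + c) - √C * r u)) :=
      tendsto_const_nhds.congr fun v => hconst u v
    have h3 := tendsto_nhds_unique h1 h2
    simp only [mul_zero, sub_zero] at h3
    linarith
  set k := 1 / √C with hk_def
  have hk : 0 < k := by positivity
  have hrk : ∀ x, 0 < x → r (y x - c) = k * x := fun x hx => by
    have h1 := hξr (y x - c)
    rw [sub_add_cancel, hξy x hx] at h1
    generalize r (y x - c) = ρ at h1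
    rw [hk_def, h1]
    field_simp
  have hphase : ∀ x, 0 < x → phaseW n ψ φ (k * x) = k * √(lyapunov (γ (y x))) ∧
      phaseX n ψ φ (k * x) = (γ (y x)).1 ∧ phaseY n ψ φ (k * x) = (γ (y x)).2 := by
    intro x hx
    have h1 := hWL (y x - c)
    have h2 := heq (y x - c)
    rw [sub_add_cancel, hrk x hx] at h1 h2
    refine ⟨?_, by rw [← h2], by rw [← h2]⟩
    rw [h1, hk_def]
    field_simp
  obtain ⟨hode, hphase'⟩ := solitonODE_of_trajectory hn hγ hQ hy
  have hWpos : ∀ t, 0 < √(lyapunov (γ t)) := fun t => Real.sqrt_pos.2 (hL t)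
  have hdφ : ∀ x ∈ Ioi (0 : ℝ), HasDerivAt (fun x => φ (k * x) - trajectoryPotential n γ (y x))
      0 x := by
    intro x hx
    have hx0 : 0 < x := hx
    obtain ⟨p1, p2, -⟩ := hphase x hx0
    obtain ⟨q1, q2, -⟩ := hphase' x hx0
    have hkx : 0 < k * x := mul_pos hk hx0
    have e1 : HasDerivAt (fun x => φ (k * x)) (deriv φ (k * x) * (k * 1)) x :=
      (hasDerivAt_of_contDiffOn_Ioi h.smooth_potential hkx).comp x
        ((hasDerivAt_id x).const_mul k)
    have e2 := hasDerivAt_of_contDiffOn_Ioi hode.smooth_potential hx0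
    refine (e1.sub e2).congr_deriv ?_
    rw [deriv_potential_eq_of_phase hn (hW _ hkx),
      deriv_potential_eq_of_phase hn (by rw [q1]; exact hWpos _), p1, p2, q1, q2]
    have := (hWpos (y x)).ne'
    field_simp
    ring
  obtain ⟨b, hb⟩ := isOpen_Ioi.exists_is_const_of_deriv_eq_zero isPreconnected_Ioi
    (fun x hx => (hdφ x hx).differentiableAt.differentiableWithinAt) fun x hx => (hdφ x hx).deriv
  refine ⟨k, hk, b, fun x hx => ⟨?_, ?_⟩⟩
  · obtain ⟨p1, p2, p3⟩ := hphase x hx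
    rw [h.eq_of_phase hn (mul_pos hk hx) (hW _ (mul_pos hk hx)), p1, p3]
    simp only [trajectoryRadius]
    ring
  · have := hb x hx
    simp only at this ⊢
    linarith

end Classification

end SteadySoliton

end

open SteadySoliton

theorem proposition2p2 (n : ℕ) (hn : 2 ≤ n) :
    ∃ (Γ : ℝ → ℝ → ℝ × ℝ) (ψ φ : ℝ → ℝ → ℝ),
      -- the trajectories emanating from `(1, 0)` in the open quarter disk form a continuous
      -- one-parameter family, each of them exactly once up to a translation of `y`
      Continuous (fun p : ℝ × ℝ => Γ p.1 p.2) ∧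
      (∀ s, SteadySoliton.IsSingularTrajectory n Set.univ (Γ s)) ∧
      (∀ (b : ℝ) (γ : ℝ → ℝ × ℝ), SteadySoliton.IsSingularTrajectory n (Set.Iio b) γ →
        ∃! p : ℝ × ℝ, ∀ y < b, γ y = Γ p.1 (y + p.2)) ∧
      -- each of them corresponds to a steady soliton with the asserted behaviour at both ends
      (∀ s, SteadySoliton.IsGradientSoliton n 0 (ψ s) (φ s) ∧
        SteadySoliton.CorrespondsTo n (ψ s) (φ s) (Γ s) ∧
        SteadySoliton.HasSingularProfile n (ψ s) (φ s) ∧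
        SteadySoliton.IsCompleteTowardsInfinity n (ψ s) ∧
        SteadySoliton.HasBryantAsymptotics (ψ s) (φ s)) ∧
      -- the metrics of the family are pairwise non-homothetic
      (∀ s s' k : ℝ, 0 < k → (∀ x, 0 < x → ψ s' (k * x) = k * ψ s x) → s = s') ∧
      -- every steady soliton whose phase curve emanates from `(1, 0)` and lies in the open quarter
      -- disk belongs to the family, up to scaling
      (∀ ψ₁ φ₁ : ℝ → ℝ, SteadySoliton.IsGradientSoliton n 0 ψ₁ φ₁ →
        (∀ x, 0 < x → (SteadySoliton.phaseX n ψ₁ φ₁ x, SteadySoliton.phaseY n ψ₁ φ₁ x) ∈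
          SteadySoliton.openQuarterDisk) →
        Tendsto (fun x => (SteadySoliton.phaseX n ψ₁ φ₁ x, SteadySoliton.phaseY n ψ₁ φ₁ x))
          (𝓝[>] 0) (𝓝 (1, 0)) →
        ∃ s k : ℝ, 0 < k ∧ SteadySoliton.IsRescalingOf k ψ₁ φ₁ (ψ s) (φ s)) ∧
      -- the Bryant soliton has the same behaviour at infinity
      (∀ (γ : ℝ → ℝ × ℝ) (ψB φB : ℝ → ℝ), SteadySoliton.IsBryantTrajectory n γ →
        SteadySoliton.IsGradientSoliton n 0 ψB φB → SteadySoliton.CorrespondsTo n ψB φB γ →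
        SteadySoliton.HasBryantAsymptotics ψB φB) := by
  have hn1 : 1 ≤ n := by omega
  obtain ⟨Γ, hcont, hsing, htop, hinj, hclass⟩ := exists_singular_family hn
  have hsol : ∀ s y, HasDerivAt (Γ s) (planarField (1 / √(n : ℝ)) (Γ s y)) y := fun s y =>
    isSolutionOn_iff.1 (hsing s).solution y (mem_univ y)
  have hQ : ∀ s y, Γ s y ∈ openQuarterDisk := fun s y => (hsing s).mem y (mem_univ y)
  have hL : ∀ s y, 0 < lyapunov (Γ s y) := fun s y => (mem_openQuarterDisk_iff.1 (hQ s y)).2.2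
  have hW : ∀ s y, 0 < √(lyapunov (Γ s y)) := fun s y => Real.sqrt_pos.2 (hL s y)
  choose ξ hξpos hdξ hξbot hξtop hξW using fun s =>
    exists_arclength (hsol s) (hL s) (hsing s).emanates
  choose y hyξ hξy hdy hy0 using fun s =>
    exists_arclength_inverse (hξpos s) (hdξ s) (hW s) (hξbot s) (hξtop s)
  have hode := fun s => solitonODE_of_trajectory hn (hsol s) (hQ s) (hdy s)
  have hcorr : ∀ s, CorrespondsTo n (fun x => trajectoryRadius n (Γ s) (y s x))
      (fun x => trajectoryPotential n (Γ s) (y s x)) (Γ s) := by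
    refine fun s => ⟨y s, ⟨fun _ _ => mem_univ _, fun x hx x' hx' h => ?_, fun t _ =>
      ⟨ξ s t, hξpos s t, hyξ s t⟩⟩, fun x hx => ?_⟩
    · rw [← hξy s x hx, ← hξy s x' hx', h]
    · obtain ⟨p1, p2, p3⟩ := (hode s).2 x hx
      rw [p1, p2, p3]
      exact ⟨hW s _, hdy s x hx, rfl⟩
  refine ⟨Γ, fun s x => trajectoryRadius n (Γ s) (y s x),
    fun s x => trajectoryPotential n (Γ s) (y s x), hcont, hsing, hclass, fun s => ⟨
    (isGradientSoliton_zero_iff hn1).2 (hode s).1, hcorr s,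
    hasSingularProfile_of_trajectory hn (hsol s) (hQ s) (hsing s).emanates (hξW s) (hξy s)
      (hdy s) (hy0 s),
    isCompleteTowardsInfinity (hode s).1.smooth_metric.continuousOn (hode s).1.pos,
    hasBryantAsymptotics_of_correspondsTo hn (hode s).1 (hcorr s) (htop s)⟩, ?_, ?_, ?_⟩
  · intro s s' k hk hψ
    have hx := hξpos s 0
    have hkx : 0 < k * ξ s 0 := mul_pos hk hx
    obtain ⟨p1, p2, p3⟩ := (hode s).2 _ hx
    obtain ⟨-, q2, q3⟩ := (hode s').2 _ hkx
    -- the soliton `s` meets the transversal at `x = ξ s 0`, and `ψ' > 0` there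
    have hne : deriv (fun x => trajectoryRadius n (Γ s) (y s x)) (ξ s 0) ≠ 0 := by
      rw [(hode s).1.deriv_eq_of_phase hn hx (by rw [p1]; exact hW s _), p2, p3]
      exact (div_pos (mul_pos (mul_pos (kappa_pos hn) (one_div_pos.2 (sqrt_dim_pos hn)))
        (hQ s _).1) (hQ s _).2.1).ne'
    obtain ⟨e1, e2⟩ := phase_eq_of_homothetic (hode s).1 (hode s').1 hk hψ hx hne
    rw [p2, q2] at e1
    rw [p3, q3] at e2
    rw [hyξ s 0] at e1 e2
    exact hinj s s' _ (Prod.ext e1 e2).symm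
  · intro ψ₁ φ₁ hsoliton hQ₁ hlim₁
    have h₁ := (isGradientSoliton_zero_iff hn1).1 hsoliton
    obtain ⟨hW₁, r, hr, hdr, hr0, hγ⟩ := exists_singularTrajectory_of_soliton hn h₁ hQ₁ hlim₁
    -- the classification applies to the restriction to `y < 1`; uniqueness extends it to `ℝ`
    obtain ⟨⟨s, c⟩, hsc, -⟩ := hclass 1 _ ⟨fun t _ => hγ.solution t (mem_univ t), hγ.emanates,
      fun t _ => hγ.mem t (mem_univ t)⟩
    have hγsol := isSolutionOn_iff.1 hγ.solution
    have heq : ∀ u, (phaseX n ψ₁ φ₁ (r u), phaseY n ψ₁ φ₁ (r u)) = Γ s (u + c) := fun u =>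
      solution_unique (a := 1 / √(n : ℝ)) (b := max u 0 + 1) (y₀ := 0)
        (fun t _ => ⟨hγsol t (mem_univ t),
          (mem_openQuarterDisk_iff.1 (hγ.mem t (mem_univ t))).2.2⟩)
        (fun t _ => ⟨(hsol s _).comp_add_const t c, hL s _⟩) (by linarith [le_max_right u 0])
        (hsc 0 one_pos) (by linarith [le_max_left u 0])
    exact ⟨s, isRescalingOf_of_trajectory hn h₁ hW₁ (hsol s) (hQ s) (hdξ s) (hξbot s) (hξy s)
      (hdy s) hr hdr hr0 heq⟩
  · intro γ ψB φB hγ hsoliton hc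
    exact hasBryantAsymptotics_of_correspondsTo hn ((isGradientSoliton_zero_iff hn1).1 hsoliton) hc
      hγ.converges
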